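/- Throughout, $[t]$ denotes the largest integer $\le t$ and $e(t)=\exp(2\pi i t)$. For $y,s>0$ put, for $u>0$, $\phi_{y,s}(u)=\dfrac{y\,u^{1-s}}{1-s}$ if $s\ne1$ and $\phi_{y,s}(u)=y\log u$ if $s=1$. For $N,y,s,\epsilon>0$ and a positive integer $P$, let $\mathscr F(N,P,y,s,\epsilon)$ be the set of real-valued functions $f$ on an interval $[a,b]\subset[N,2N]$, $a<b$, that are $P$ times continuously differentiable on $[a,b]$ and satisfy $$|f^{(p)}(u)-\phi_{y,s}^{(p)}(u)|\le\epsilon\,|\phi_{y,s}^{(p)}(u)|\qquad(1\le p\le P,\ u\in[a,b]).$$ A pair of real numbers $(k,\ell)$ with $0\le k\le\frac12\le\ell\le1$ is called an exponent pair if for every $s>0$ there are a positive integer $P$, a real $\epsilon>0$ and a constant $C>0$, depending only on $k,\ell,s$, such that for all $N,y>0$ and every $f\in\mathscr F(N,P,y,s,\epsilon)$, defined on $[a,b]$, $$\Bigl|\sum_{a<n\le b}e(f(n))\Bigr|\le C\bigl(L^{k}N^{\ell}+L^{-1}\bigr),\qquad L=yN^{-s}.$$ **Theorem 1.3.** Let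 $(k,\ell)$ be an exponent pair. The series $$\mathfrak S=\sum_{\substack{m,n\ge1\\ \gcd(m,n)=1}}\frac1{mn(m+1)(n+1)}$$ converges, and for all real $x\ge2$, $$\#\{(m,n)\in\mathbb Z^2:\ 1\le m,n\le x,\ \gcd([x/m],[x/n])=1\}=\mathfrak S\,x^{2}+O\bigl(x^{1+\frac{k+\ell}{2k+2}}\bigr),$$ where the implicit constant depends only on $(k,\ell)$. -/

import Mathlib

/-- The model phase function `φ_{y,s}` of amplitude `y` and index `s` (used on `x > 0`). -/
noncomputable def modelPhase (y s x : ℝ) : ℝ :=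
  if s = 1 then y * Real.log x else y * x ^ (1 - s) / (1 - s)

/-- `f`, restricted to `[a, b]`, is an admissible phase function of scale `N`, order `P`,
amplitude `y`, index `s` and precision `ε`. Derivatives of `f` are taken within `[a, b]`
(one-sided at the endpoints), and only the values of `f` on `[a, b]` matter. -/
structure IsAdmissiblePhase (N : ℝ) (P : ℕ) (y s ε : ℝ) (a b : ℝ) (f : ℝ → ℝ) : Prop where
  lt : a < b
  subset : Set.Icc a b ⊆ Set.Icc N (2 * N)
  contDiffOn : ContDiffOn ℝ P f (Set.Icc a b)
  deriv_close : ∀ p : ℕ, 1 ≤ p → p ≤ P → ∀ x ∈ Set.Icc a b,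
    |iteratedDerivWithin p f (Set.Icc a b) x - iteratedDeriv p (modelPhase y s) x|
      ≤ ε * |iteratedDeriv p (modelPhase y s) x|

/-- `(k, ℓ)` is an exponent pair. For `0 ≤ a ≤ b` the integers `n` with `a < n ≤ b` are those of
`Finset.Ioc ⌊a⌋₊ ⌊b⌋₊`; the quantity `L` is `y * N ^ (-s)`. The implicit constant `C`, like `P`
and `ε`, depends only on `k`, `ℓ` and `s`. -/
def IsExponentPair (k l : ℝ) : Prop :=
  0 ≤ k ∧ k ≤ 1 / 2 ∧ 1 / 2 ≤ l ∧ l ≤ 1 ∧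
    ∀ s : ℝ, 0 < s → ∃ P : ℕ, 1 ≤ P ∧ ∃ ε : ℝ, 0 < ε ∧ ∃ C : ℝ, 0 < C ∧
      ∀ N y : ℝ, 0 < N → 0 < y → ∀ (a b : ℝ) (f : ℝ → ℝ), IsAdmissiblePhase N P y s ε a b f →
        ‖∑ n ∈ Finset.Ioc ⌊a⌋₊ ⌊b⌋₊, Complex.exp (2 * Real.pi * Complex.I * (f n : ℂ))‖
          ≤ C * ((y * N ^ (-s)) ^ k * N ^ l + (y * N ^ (-s))⁻¹)

/-- The number of pairs of integers `1 ≤ m, n ≤ x` with `gcd([x/m], [x/n]) = 1`. -/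
noncomputable def primitivePairCount (x : ℝ) : ℕ :=
  ((Finset.Icc 1 ⌊x⌋₊ ×ˢ Finset.Icc 1 ⌊x⌋₊).filter
    (fun p : ℕ × ℕ => Nat.Coprime ⌊x / (p.1 : ℝ)⌋₊ ⌊x / (p.2 : ℝ)⌋₊)).card

/-- The term of index `(m, n)` of the series `𝔖`, extended by zero to all of `ℕ × ℕ`. -/
noncomputable def primitiveTerm (p : ℕ × ℕ) : ℝ :=
  if 1 ≤ p.1 ∧ 1 ≤ p.2 ∧ Nat.Coprime p.1 p.2 then
    1 / ((p.1 : ℝ) * (p.2 : ℝ) * ((p.1 : ℝ) + 1) * ((p.2 : ℝ) + 1))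
  else 0

/-- The constant `𝔖 = ∑_{m, n ≥ 1, (m, n) = 1} 1 / (m n (m + 1) (n + 1))`. -/
noncomputable def primitiveConst : ℝ := ∑' p : ℕ × ℕ, primitiveTerm p

/-! Put `S_d` for the number of `m ≤ x` with `d ∣ [x/m]`. Möbius inversion over the gcd turns the
pair count into `∑ μ(d) S_d²`, and the truncated series `𝔖` into `∑ μ(d) G_d²`, where `G_d = ∑_j 1 /
(dj (dj + 1))`. So it suffices to show `S_d = x G_d + O((x/d)^θ)` with `θ = (k + l) / (2k + 2)`:
since `θ ≤ 1/2` and `G_d ≪ d⁻²`, both the squared errors and the cross terms sum over `d` to `O(x^(1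
+ θ))`.

For `S_d`, let `X = x/d` and split as in the hyperbola method. For `m` up to about `√X` the
indicator of `d ∣ [x/m]` is a difference of two sawtooth values. For larger `m` one counts by `j =
[x/m] / d`, so that `m` lies in `(x / (dj + 1), x / (dj)]` with `j ≤ √X`. All errors are then sums
of `ψ(X / (n + α) + β)` over `n ≤ J` with `J² ≤ X` and `0 ≤ α ≤ 1` (`abs_divCount_sub_le`). Such a
sum is `O(X^θ)`: approximate `ψ` by difference quotients of the second Bernoulli function, expand in
Fourier series, and bound the exponential sums over dyadic blocks by `(Y/J²)^k J^l`, which is the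
property `RecipSumBound`. The shift `α` perturbs the model phase of index 2 so little that an
exponent pair provides this bound.

The Fourier sum needs `k > 0` and the dyadic sum needs `k < l`. Both hold if `θ < 1/3`: then `k + 3l
< 2`, so `k < 1/2 ≤ l`, while `k = 0` would force `l ≥ 1`. If `θ ≥ 1/3`, the exponent `1/3` is
enough, and it comes from the classical pair `(2/7, 4/7)`. That pair is proved here for the phases
`Y / (n + α)`. With `L = Y/J²`, the third difference test suffices for `L ≥ J^(4/5)`. For smaller
`L`, Poisson summation and stationary phase lead to a dual sum of length about `L` with phase
`2√(Yr) - αr`, to which the fourth difference test applies. The difference tests follow from the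
Kusmin–Landau inequality by Weyl differencing. -/

open intervalIntegral

/-! ### The additive character -/

/-- The additive character `t ↦ exp (2 π i t)`. -/
noncomputable def ee (t : ℝ) : ℂ := Complex.exp (2 * Real.pi * Complex.I * (t : ℂ))

theorem ee_eq (t : ℝ) : ee t = Complex.exp (((2 * Real.pi * t : ℝ) : ℂ) * Complex.I) := by
  unfold ee; congr 1; push_cast; ring

theorem norm_ee (t : ℝ) : ‖ee t‖ = 1 := by
  rw [ee_eq, Complex.norm_exp_ofReal_mul_I]

theorem ee_add (s t : ℝ) : ee (s + t) = ee s * ee t := by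
  unfold ee; rw [← Complex.exp_add]; congr 1; push_cast; ring

theorem ee_zero : ee 0 = 1 := by simp [ee]

theorem ee_neg (t : ℝ) : ee (-t) = (starRingEnd ℂ) (ee t) := by
  rw [ee_eq, ee_eq, ← Complex.exp_conj, map_mul, Complex.conj_ofReal, Complex.conj_I]
  congr 1
  push_cast
  ring

theorem ee_sub (s t : ℝ) : ee (s - t) = ee s * (starRingEnd ℂ) (ee t) := by
  rw [sub_eq_add_neg, ee_add, ee_neg]

theorem ee_int (n : ℤ) : ee n = 1 := by
  unfold ee
  rw [Complex.exp_eq_one_iff]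
  exact ⟨n, by push_cast; ring⟩

theorem ee_nat (n : ℕ) : ee n = 1 := by
  have := ee_int n
  exact_mod_cast this

theorem ee_add_int (t : ℝ) (n : ℤ) : ee (t + n) = ee t := by
  rw [ee_add, ee_int, mul_one]

theorem ee_re (t : ℝ) : (ee t).re = Real.cos (2 * Real.pi * t) := by
  rw [ee_eq, Complex.exp_ofReal_mul_I_re]

theorem ee_im (t : ℝ) : (ee t).im = Real.sin (2 * Real.pi * t) := by
  rw [ee_eq, Complex.exp_ofReal_mul_I_im]

theorem norm_sum_ee_le_card {ι : Type*} (s : Finset ι) (f : ι → ℝ) :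
    ‖∑ n ∈ s, ee (f n)‖ ≤ s.card := by
  refine (norm_sum_le _ _).trans ?_
  simp [norm_ee]

/-- `1 / (1 - e(g))` has real part `1 / 2` and imaginary part `cot (π g) / 2`. -/
theorem inv_one_sub_ee (g : ℝ) (hg : Real.sin (Real.pi * g) ≠ 0) :
    (1 - ee g)⁻¹ = (1 / 2 : ℂ)
      + ((Real.cos (Real.pi * g) / Real.sin (Real.pi * g) / 2 : ℝ) : ℂ) * Complex.I := by
  have h2 := Real.sin_sq_add_cos_sq (Real.pi * g)
  have hre : (ee g).re = 1 - 2 * Real.sin (Real.pi * g) ^ 2 := by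
    rw [ee_re, show 2 * Real.pi * g = 2 * (Real.pi * g) by ring, Real.cos_two_mul]
    linarith
  have him : (ee g).im = 2 * Real.sin (Real.pi * g) * Real.cos (Real.pi * g) := by
    rw [ee_im, show 2 * Real.pi * g = 2 * (Real.pi * g) by ring, Real.sin_two_mul]
  apply inv_eq_of_mul_eq_one_right
  set s := Real.sin (Real.pi * g)
  set c := Real.cos (Real.pi * g)
  apply Complex.ext
  · simp only [Complex.mul_re, Complex.mul_im, Complex.sub_re, Complex.sub_im, Complex.add_re,
      Complex.add_im, Complex.one_re, Complex.one_im, hre, him, Complex.ofReal_re,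
      Complex.ofReal_im, Complex.I_re, Complex.I_im, Complex.div_re, Complex.div_im]
    norm_num [Complex.normSq]
    field_simp
    nlinarith
  · simp only [Complex.mul_re, Complex.mul_im, Complex.sub_re, Complex.sub_im, Complex.add_re,
      Complex.add_im, Complex.one_re, Complex.one_im, hre, him, Complex.ofReal_re,
      Complex.ofReal_im, Complex.I_re, Complex.I_im, Complex.div_re, Complex.div_im]
    norm_num [Complex.normSq]
    field_simp
    ring

theorem two_mul_le_sin_pi_mul {g : ℝ} (h0 : 0 ≤ g) (h1 : g ≤ 1 / 2) :
    2 * g ≤ Real.sin (Real.pi * g) := by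
  have := Real.mul_le_sin (x := Real.pi * g) (by positivity) (by nlinarith [Real.pi_pos])
  have h3 : 2 / Real.pi * (Real.pi * g) = 2 * g := by field_simp
  linarith

theorem sin_pi_mul_ge {g θ : ℝ} (hθ : 0 < θ) (h0 : θ ≤ g) (h1 : g ≤ 1 - θ) :
    2 * θ ≤ Real.sin (Real.pi * g) := by
  rcases le_total g (1 / 2) with h | h
  · have := two_mul_le_sin_pi_mul (by linarith) h
    linarith
  · have := two_mul_le_sin_pi_mul (g := 1 - g) (by linarith) (by linarith)
    rw [show Real.pi * (1 - g) = Real.pi - Real.pi * g by ring, Real.sin_pi_sub] at this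
    linarith

/-- After cross-multiplication this says `sin (π (h - g)) ≥ 0`. -/
theorem cot_pi_mul_anti {g h : ℝ} (hg : 0 < g) (hgh : g ≤ h) (hh : h < 1) :
    Real.cos (Real.pi * h) / Real.sin (Real.pi * h)
      ≤ Real.cos (Real.pi * g) / Real.sin (Real.pi * g) := by
  have hp := Real.pi_pos
  have h1 : 0 < Real.sin (Real.pi * g) :=
    Real.sin_pos_of_pos_of_lt_pi (by positivity) (by nlinarith)
  have h2 : 0 < Real.sin (Real.pi * h) :=
    Real.sin_pos_of_pos_of_lt_pi (by nlinarith) (by nlinarith)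
  rw [div_le_div_iff₀ h2 h1]
  have h3 : 0 ≤ Real.sin (Real.pi * h - Real.pi * g) :=
    Real.sin_nonneg_of_nonneg_of_le_pi (by nlinarith) (by nlinarith)
  rw [Real.sin_sub] at h3
  nlinarith

/-! ### The Kusmin–Landau inequality and the second difference test -/

/-- The Kusmin–Landau inequality, for sequences with monotone differences. -/
theorem kusmin_landau (f : ℕ → ℝ) (M : ℕ) (θ : ℝ) (ν : ℤ) (hθ : 0 < θ)
    (hmono : ∀ n, n + 1 < M → f (n + 1) - f n ≤ f (n + 2) - f (n + 1))
    (hlo : ∀ n < M, ν + θ ≤ f (n + 1) - f n) (hhi : ∀ n < M, f (n + 1) - f n ≤ ν + 1 - θ) :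
    ‖∑ n ∈ Finset.range M, ee (f n)‖ ≤ 2 / θ := by
  rcases Nat.eq_zero_or_pos M with rfl | hM
  · simp; positivity
  set g : ℕ → ℝ := fun n => f (n + 1) - f n - ν with hgdef
  have hg1 : ∀ n < M, θ ≤ g n := fun n hn => by have := hlo n hn; simp only [hgdef]; linarith
  have hg2 : ∀ n < M, g n ≤ 1 - θ := fun n hn => by have := hhi n hn; simp only [hgdef]; linarith
  have hs : ∀ n < M, 2 * θ ≤ Real.sin (Real.pi * g n) := fun n hn =>
    sin_pi_mul_ge hθ (hg1 n hn) (hg2 n hn)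
  -- Here `1 / (1 - e(g n)) = 1/2 + i c n`, so each term is a difference of consecutive values of
  -- `e(f)` times this factor. Only the real sequence `c` varies, and it is monotone.
  set c : ℕ → ℝ := fun n => Real.cos (Real.pi * g n) / Real.sin (Real.pi * g n) / 2 with hc
  have hcabs : ∀ n < M, |c n| ≤ 1 / (4 * θ) := by
    intro n hn
    have h1 := hs n hn
    simp only [hc]
    rw [abs_div, abs_div, abs_of_pos (show (0:ℝ) < 2 by norm_num),
      abs_of_pos (lt_of_lt_of_le (by positivity) h1), div_div]
    exact div_le_div₀ zero_le_one (Real.abs_cos_le_one _) (by positivity) (by linarith)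
  have hterm : ∀ n < M, ee (f n)
      = (ee (f n) - ee (f (n + 1))) * (1 / 2 + (c n : ℂ) * Complex.I) := by
    intro n hn
    have h1 : ee (f (n + 1)) = ee (f n) * ee (g n) := by
      rw [← ee_add]
      have : f n + g n + (ν : ℝ) = f (n + 1) := by simp only [hgdef]; ring
      rw [← this, ee_add_int]
    have h2 := hs n hn
    have h3 : Real.sin (Real.pi * g n) ≠ 0 := by
      have : 0 < 2 * θ := by positivity
      exact (this.trans_le h2).ne'
    rw [← inv_one_sub_ee (g n) h3, h1]
    have h4 : (1 : ℂ) - ee (g n) ≠ 0 := by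
      intro h
      have h5 := inv_one_sub_ee (g n) h3
      rw [h, inv_zero] at h5
      have := congrArg Complex.re h5
      simp only [Complex.zero_re, Complex.add_re, Complex.re_ofReal_mul, Complex.I_re,
        mul_zero, add_zero] at this
      norm_num at this
    field_simp
  -- Summation by parts; the constant `1/2` telescopes completely.
  have key : ∀ K, K + 1 ≤ M → ∑ n ∈ Finset.range (K + 1), ee (f n)
      = (1 / 2) * (ee (f 0) - ee (f (K + 1))) + Complex.I * (c 0 * ee (f 0) - c K * ee (f (K + 1))
        + ∑ n ∈ Finset.range K, ((c (n + 1) - c n : ℝ) : ℂ) * ee (f (n + 1))) := by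
    intro K
    induction K with
    | zero =>
      intro h
      simp only [zero_add, Finset.sum_range_one, Finset.sum_range_zero]
      conv_lhs => rw [hterm 0 h]
      ring
    | succ K ih =>
      intro h
      rw [Finset.sum_range_succ, ih (by omega), Finset.sum_range_succ _ K]
      push_cast
      linear_combination hterm (K + 1) (by omega)
  obtain ⟨K, rfl⟩ : ∃ K, M = K + 1 := ⟨M - 1, by omega⟩
  rw [key K le_rfl]
  -- As `c` decreases, its total variation is `c 0 - c K`.
  have hsum : ‖∑ n ∈ Finset.range K, ((c (n + 1) - c n : ℝ) : ℂ) * ee (f (n + 1))‖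
      ≤ 1 / (2 * θ) := by
    refine (norm_sum_le _ _).trans ?_
    have : ∀ n ∈ Finset.range K, ‖((c (n + 1) - c n : ℝ) : ℂ) * ee (f (n + 1))‖
        = c n - c (n + 1) := by
      intro n hn
      rw [Finset.mem_range] at hn
      rw [norm_mul, norm_ee, mul_one, Complex.norm_real, Real.norm_eq_abs, abs_sub_comm,
        abs_of_nonneg]
      have h1 := hmono n (by omega)
      have := cot_pi_mul_anti (g := g n) (h := g (n + 1)) (by linarith [hg1 n (by omega)])
        (by simp only [hgdef]; linarith) (by linarith [hg2 (n + 1) (by omega)])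
      simp only [hc]
      linarith
    rw [Finset.sum_congr rfl this, Finset.sum_range_sub']
    have h1 := abs_le.1 (hcabs 0 (by omega))
    have h2 := abs_le.1 (hcabs K (by omega))
    have h3 : 1 / (4 * θ) + 1 / (4 * θ) = 1 / (2 * θ) := by field_simp; norm_num
    linarith
  have hb : ∀ n m, n < K + 1 → ‖(c n : ℂ) * ee (f m)‖ ≤ 1 / (4 * θ) := by
    intro n m hn
    rw [norm_mul, norm_ee, mul_one, Complex.norm_real]
    exact hcabs n hn
  have hθ2 : θ ≤ 1 / 2 := by linarith [hg1 0 hM, hg2 0 hM]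
  have h1 : ‖(1 / 2 : ℂ) * (ee (f 0) - ee (f (K + 1)))‖ ≤ 1 := by
    rw [norm_mul]
    have := norm_sub_le (ee (f 0)) (ee (f (K + 1)))
    rw [norm_ee, norm_ee] at this
    norm_num
    linarith
  have h2 : ‖Complex.I * (c 0 * ee (f 0) - c K * ee (f (K + 1))
        + ∑ n ∈ Finset.range K, ((c (n + 1) - c n : ℝ) : ℂ) * ee (f (n + 1)))‖
      ≤ 1 / (4 * θ) + 1 / (4 * θ) + 1 / (2 * θ) := by
    rw [norm_mul, Complex.norm_I, one_mul]
    refine (norm_add_le _ _).trans (add_le_add ((norm_sub_le _ _).trans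
      (add_le_add (hb _ _ (by omega)) (hb _ _ (by omega)))) hsum)
  refine (norm_add_le _ _).trans ((add_le_add h1 h2).trans ?_)
  have h3 : 1 / (4 * θ) + 1 / (4 * θ) + 1 / (2 * θ) = 1 / θ := by field_simp; norm_num
  have h4 : 1 ≤ 1 / θ := by rw [le_div_iff₀ hθ]; linarith
  have h5 : 2 / θ = 1 / θ + 1 / θ := by ring
  linarith

theorem exists_filter_lt_eq_range (g : ℕ → ℝ) (M : ℕ)
    (hg : ∀ n, n + 1 < M → g n ≤ g (n + 1)) (c : ℝ) :
    ∃ i ≤ M, ∀ n < M, g n < c ↔ n < i := by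
  have hmono : ∀ n m, n ≤ m → m < M → g n ≤ g m := by
    intro n m hnm
    induction m, hnm using Nat.le_induction with
    | base => intro _; exact le_rfl
    | succ m hm ih => intro h; exact (ih (by omega)).trans (hg m h)
  classical
  by_cases h : ∃ n, n < M ∧ c ≤ g n
  · refine ⟨Nat.find h, (Nat.find_spec h).1.le, fun n hn => ⟨fun h1 => ?_, fun h1 => ?_⟩⟩
    · by_contra h2
      push Not at h2
      exact absurd (h1.trans_le ((Nat.find_spec h).2.trans (hmono _ _ h2 hn))) (lt_irrefl _)
    · have := Nat.find_min h h1
      push Not at this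
      exact this hn
  · push Not at h
    exact ⟨M, le_rfl, fun n hn => ⟨fun _ => hn, fun _ => h n hn⟩⟩

/-- Kusmin–Landau applies to consecutive integers only, so the level sets of the differences have to
be intervals. -/
theorem exists_filter_eq_Ico (g : ℕ → ℝ) (M : ℕ)
    (hg : ∀ n, n + 1 < M → g n ≤ g (n + 1)) (c d : ℝ) :
    ∃ i j, j ≤ M ∧ (Finset.range M).filter (fun n => c ≤ g n ∧ g n < d) = Finset.Ico i j := by
  obtain ⟨i, -, hi⟩ := exists_filter_lt_eq_range g M hg c
  obtain ⟨j, hj, hj'⟩ := exists_filter_lt_eq_range g M hg d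
  refine ⟨i, j, hj, ?_⟩
  ext n
  simp only [Finset.mem_filter, Finset.mem_range, Finset.mem_Ico]
  constructor
  · rintro ⟨h1, h2, h3⟩
    refine ⟨?_, (hj' n h1).1 h3⟩
    by_contra h4
    push Not at h4
    exact absurd ((hi n h1).2 h4) (not_lt.2 h2)
  · rintro ⟨h1, h2⟩
    have h3 : n < M := by omega
    refine ⟨h3, ?_, (hj' n h3).2 h2⟩
    by_contra h4
    push Not at h4
    have := (hi n h3).1 h4
    omega

/-- The indices form an interval, over which `g` gains at least `lam` per step while staying in `[c,
d)`. -/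
theorem card_filter_le_of_increment (g : ℕ → ℝ) (M : ℕ) {lam : ℝ} (hlam : 0 < lam)
    (hg : ∀ n, n + 1 < M → g n + lam ≤ g (n + 1)) {c d : ℝ} (hcd : c ≤ d) :
    (((Finset.range M).filter (fun n => c ≤ g n ∧ g n < d)).card : ℝ) ≤ (d - c) / lam + 1 := by
  obtain ⟨i, j, hj, h⟩ := exists_filter_eq_Ico g M (fun n hn => by linarith [hg n hn]) c d
  rw [h, Nat.card_Ico]
  have h0 : 0 ≤ (d - c) / lam := div_nonneg (by linarith) hlam.le
  rcases le_or_gt j i with hij | hij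
  · rw [Nat.sub_eq_zero_of_le hij]; push_cast; linarith
  have hinc : ∀ k, i + k < M → g i + k * lam ≤ g (i + k) := by
    intro k
    induction k with
    | zero => intro _; simp
    | succ k ih =>
      intro hk
      have h1 := ih (by omega)
      have h2 := hg (i + k) (by omega)
      rw [← add_assoc]
      push_cast
      linarith
  have h1 := hinc (j - 1 - i) (by omega)
  have h2 : i + (j - 1 - i) = j - 1 := by omega
  rw [h2] at h1
  have hi : i ∈ Finset.Ico i j := Finset.mem_Ico.2 ⟨le_rfl, hij⟩
  have hj1 : j - 1 ∈ Finset.Ico i j := Finset.mem_Ico.2 ⟨by omega, by omega⟩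
  rw [← h, Finset.mem_filter] at hi hj1
  have h3 : ((j - 1 - i : ℕ) : ℝ) ≤ (d - c) / lam := by
    rw [le_div_iff₀ hlam]
    linarith [hi.2.1, hj1.2.2]
  have h4 : j - i = (j - 1 - i) + 1 := by omega
  rw [h4]
  push_cast
  linarith

/-- Where the difference is within `θ` of `ν` or `ν + 1`, terms are counted trivially, at most `θ /
lam + 1` of them at each end. The Kusmin–Landau inequality handles the middle range. -/
theorem norm_sum_fiber_le (f : ℕ → ℝ) (M : ℕ) {lam θ : ℝ} (hlam : 0 < lam) (hθ : 0 < θ)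
    (hθ2 : θ ≤ 1 / 2) (ν : ℤ)
    (hf : ∀ n < M, f (n + 1) - f n + lam ≤ f (n + 2) - f (n + 1)) :
    ‖∑ n ∈ (Finset.range M).filter (fun n => ⌊f (n + 1) - f n⌋ = ν), ee (f n)‖
      ≤ 2 * (θ / lam + 1) + 2 / θ := by
  set g : ℕ → ℝ := fun n => f (n + 1) - f n with hgdef
  have hg : ∀ n, n + 1 < M → g n + lam ≤ g (n + 1) := fun n hn => hf n (by omega)
  set S := fun c d : ℝ => (Finset.range M).filter (fun n => c ≤ g n ∧ g n < d) with hS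
  have hsplit : (Finset.range M).filter (fun n => ⌊f (n + 1) - f n⌋ = ν)
      = S ν (ν + θ) ∪ (S (ν + θ) (ν + 1 - θ) ∪ S (ν + 1 - θ) (ν + 1)) := by
    ext n
    simp only [hS, Finset.mem_union, Finset.mem_filter, Int.floor_eq_iff]
    change _ ∧ _ ≤ g n ∧ g n < _ ↔ _
    constructor
    · rintro ⟨h1, h2, h3⟩
      rcases lt_or_ge (g n) (ν + θ) with h4 | h4
      · exact Or.inl ⟨h1, h2, h4⟩
      · rcases lt_or_ge (g n) (ν + 1 - θ) with h5 | h5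
        · exact Or.inr (Or.inl ⟨h1, h4, h5⟩)
        · exact Or.inr (Or.inr ⟨h1, h5, h3⟩)
    · rintro (⟨h1, h2, h3⟩ | ⟨h1, h2, h3⟩ | ⟨h1, h2, h3⟩) <;> refine ⟨h1, ?_, ?_⟩ <;> linarith
  have hd1 : Disjoint (S ν (ν + θ)) (S (ν + θ) (ν + 1 - θ) ∪ S (ν + 1 - θ) (ν + 1)) := by
    rw [Finset.disjoint_left]
    intro n h1 h2
    simp only [hS, Finset.mem_union, Finset.mem_filter] at h1 h2
    rcases h2 with h2 | h2 <;> linarith [h1.2.2, h2.2.1]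
  have hd2 : Disjoint (S (ν + θ) (ν + 1 - θ)) (S (ν + 1 - θ) (ν + 1)) := by
    rw [Finset.disjoint_left]
    intro n h1 h2
    simp only [hS, Finset.mem_filter] at h1 h2
    linarith [h1.2.2, h2.2.1]
  rw [hsplit, Finset.sum_union hd1, Finset.sum_union hd2]
  have e1 : ‖∑ n ∈ S ν (ν + θ), ee (f n)‖ ≤ θ / lam + 1 := by
    refine (norm_sum_ee_le_card _ _).trans ?_
    have := card_filter_le_of_increment g M hlam hg (c := ν) (d := ν + θ) (by linarith)
    simpa using this
  have e3 : ‖∑ n ∈ S (ν + 1 - θ) (ν + 1), ee (f n)‖ ≤ θ / lam + 1 := by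
    refine (norm_sum_ee_le_card _ _).trans ?_
    have := card_filter_le_of_increment g M hlam hg (c := ν + 1 - θ) (d := ν + 1) (by linarith)
    rw [show ((ν : ℝ) + 1 - (ν + 1 - θ)) = θ by ring] at this
    exact this
  have e2 : ‖∑ n ∈ S (ν + θ) (ν + 1 - θ), ee (f n)‖ ≤ 2 / θ := by
    obtain ⟨i, j, hj, h⟩ := exists_filter_eq_Ico g M (fun n hn => by linarith [hg n hn])
      (ν + θ) (ν + 1 - θ)
    have hmem : ∀ n, i ≤ n → n < j → ν + θ ≤ g n ∧ g n < ν + 1 - θ := by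
      intro n h1 h2
      have : n ∈ Finset.Ico i j := Finset.mem_Ico.2 ⟨h1, h2⟩
      rw [← h, Finset.mem_filter] at this
      exact this.2
    simp only [hS]
    rw [h, Finset.sum_Ico_eq_sum_range]
    refine kusmin_landau (fun n => f (i + n)) (j - i) θ ν hθ ?_ ?_ ?_
    · intro n hn
      have := hf (i + n) (by omega)
      simp only [← add_assoc]
      linarith
    · intro n hn
      exact (hmem (i + n) (by omega) (by omega)).1
    · intro n hn
      exact (hmem (i + n) (by omega) (by omega)).2.le
  refine (norm_add_le _ _).trans ((add_le_add e1 ((norm_add_le _ _).trans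
    (add_le_add e2 e3))).trans ?_)
  linarith

/-- The second difference test of van der Corput. -/
theorem second_difference_test (f : ℕ → ℝ) (M : ℕ) {lam A : ℝ} (hlam : 0 < lam) (hA : 1 ≤ A)
    (hlo : ∀ n < M, lam ≤ f (n + 2) - 2 * f (n + 1) + f n)
    (hhi : ∀ n < M, f (n + 2) - 2 * f (n + 1) + f n ≤ A * lam) :
    ‖∑ n ∈ Finset.range M, ee (f n)‖ ≤ 12 * A * (M * lam ^ (1 / 2 : ℝ) + lam ^ (-(1 / 2) : ℝ)) := by
  rw [Real.rpow_neg hlam.le, ← Real.sqrt_eq_rpow]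
  set r := √lam with hr
  have hr0 : 0 < r := Real.sqrt_pos.2 hlam
  have hrr : lam = r * r := (Real.mul_self_sqrt hlam.le).symm
  have hM0 : (0 : ℝ) ≤ M := Nat.cast_nonneg _
  have hri : 0 < r⁻¹ := inv_pos.2 hr0
  rcases Nat.eq_zero_or_pos M with rfl | hM
  · simp; positivity
  -- With `θ = r = √lam` the two costs `θ / lam` and `1 / θ` agree; the choice requires `r ≤ 1/2`,
  -- and otherwise the trivial bound is good enough.
  rcases lt_or_ge (1 / 2) r with h | h
  · refine (norm_sum_ee_le_card _ _).trans ?_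
    rw [Finset.card_range]
    have h1 : (M : ℝ) * (1 / 2) ≤ M * r := by gcongr
    have h2 : (M * r + r⁻¹) ≤ A * (M * r + r⁻¹) := le_mul_of_one_le_left (by positivity) hA
    nlinarith
  set g : ℕ → ℝ := fun n => f (n + 1) - f n with hg
  have hf : ∀ n < M, f (n + 1) - f n + lam ≤ f (n + 2) - f (n + 1) := fun n hn => by
    linarith [hlo n hn]
  have hup : ∀ n < M, g 0 ≤ g n ∧ g n ≤ g 0 + n * (A * lam) := by
    intro n
    induction n with
    | zero => intro _; simp
    | succ n ih =>
      intro hn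
      have h1 := ih (by omega)
      have h2 := hlo n (by omega)
      have h3 := hhi n (by omega)
      simp only [hg] at h1 ⊢
      push_cast
      rw [show n + 1 + 1 = n + 2 by ring]
      constructor <;> linarith
  have hmaps : ∀ n ∈ Finset.range M, ⌊f (n + 1) - f n⌋
      ∈ Finset.Icc ⌊g 0⌋ ⌊g 0 + M * (A * lam)⌋ := by
    intro n hn
    rw [Finset.mem_range] at hn
    have h1 := hup n hn
    rw [Finset.mem_Icc]
    refine ⟨Int.floor_le_floor h1.1, Int.floor_le_floor (h1.2.trans ?_)⟩
    have : (n : ℝ) ≤ M := by exact_mod_cast hn.le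
    gcongr
  -- The differences increase by at most `A * lam` per step, so at most `M * A * lam + 2` integer
  -- parts occur.
  rw [← Finset.sum_fiberwise_of_maps_to hmaps]
  refine (norm_sum_le _ _).trans ?_
  refine (Finset.sum_le_card_nsmul _ _ _ (fun ν _ =>
    norm_sum_fiber_le f M hlam hr0 h ν hf)).trans ?_
  rw [nsmul_eq_mul, Int.card_Icc]
  have hcard : ((⌊g 0 + M * (A * lam)⌋ + 1 - ⌊g 0⌋).toNat : ℝ) ≤ M * (A * lam) + 2 := by
    have h1 : ⌊g 0⌋ ≤ ⌊g 0 + M * (A * lam)⌋ := Int.floor_le_floor (by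
      have : 0 ≤ M * (A * lam) := by positivity
      linarith)
    have h2 : ((⌊g 0 + M * (A * lam)⌋ + 1 - ⌊g 0⌋).toNat : ℤ)
        = ⌊g 0 + M * (A * lam)⌋ + 1 - ⌊g 0⌋ := Int.toNat_of_nonneg (by omega)
    have h3 : ((⌊g 0 + M * (A * lam)⌋ + 1 - ⌊g 0⌋).toNat : ℝ)
        = ⌊g 0 + M * (A * lam)⌋ + 1 - ⌊g 0⌋ := by exact_mod_cast h2
    rw [h3]
    linarith [Int.floor_le (g 0 + M * (A * lam)), Int.lt_floor_add_one (g 0)]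
  have hfib : 2 * (r / lam + 1) + 2 / r ≤ 5 * r⁻¹ := by
    have h1 : r / lam = r⁻¹ := by rw [hrr]; field_simp
    have h2 : 2 ≤ r⁻¹ := by rw [le_inv_comm₀ (by norm_num) hr0]; linarith
    rw [h1, div_eq_mul_inv]; linarith
  calc _ ≤ (M * (A * lam) + 2) * (5 * r⁻¹) := by gcongr
    _ = 5 * A * (M * r) + 10 * r⁻¹ := by rw [hrr]; field_simp; ring
    _ ≤ 12 * A * (M * r + r⁻¹) := by
      have h1 : 0 ≤ A * (M * r) := by positivity
      have h2 : r⁻¹ ≤ A * r⁻¹ := le_mul_of_one_le_left hri.le hA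
      nlinarith

/-! ### Weyl differencing and the third and fourth difference tests -/

/-- The inequality of Weyl and van der Corput. -/
theorem weyl_van_der_corput (z : ℕ → ℂ) (M Q : ℕ) (hQ : 0 < Q) :
    ‖∑ n ∈ Finset.range M, z n‖ ^ 2 * Q ≤ (M + Q) * (2 * ∑ q ∈ Finset.range Q,
      ‖∑ n ∈ Finset.range (M - q), z (n + q) * (starRingEnd ℂ) (z n)‖) := by
  set T : ℕ → ℝ := fun q =>
    ‖∑ n ∈ Finset.range (M - q), z (n + q) * (starRingEnd ℂ) (z n)‖ with hT
  -- Copies of `z`, extended by zero and shifted by `q < Q`. All have the same total, so `Q` times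
  -- the sum is a double sum whose outer variable has `M + Q` values; Cauchy–Schwarz is applied
  -- there.
  set w : ℕ → ℕ → ℂ := fun q m => if q ≤ m ∧ m - q < M then z (m - q) else 0 with hw
  have hsum : ∀ q < Q, ∑ m ∈ Finset.range (M + Q), w q m = ∑ n ∈ Finset.range M, z n := by
    intro q hq
    simp only [hw]
    rw [← Finset.sum_filter]
    symm
    refine Finset.sum_bij (fun n _ => n + q) ?_ ?_ ?_ ?_
    · intro n hn
      rw [Finset.mem_range] at hn
      rw [Finset.mem_filter, Finset.mem_range]
      omega
    · intro a _ b _ h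
      simpa using h
    · intro m hm
      rw [Finset.mem_filter, Finset.mem_range] at hm
      exact ⟨m - q, Finset.mem_range.2 hm.2.2, by omega⟩
    · intro n _
      simp
  have hcorr : ∀ q₁ q₂, q₁ ≤ q₂ → q₂ < Q →
      ‖∑ m ∈ Finset.range (M + Q), w q₁ m * (starRingEnd ℂ) (w q₂ m)‖ = T (q₂ - q₁) := by
    intro q₁ q₂ h h2
    simp only [hT]
    congr 1
    have h3 : ∀ m, w q₁ m * (starRingEnd ℂ) (w q₂ m)
        = if q₂ ≤ m ∧ m - q₁ < M then z (m - q₁) * (starRingEnd ℂ) (z (m - q₂)) else 0 := by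
      intro m
      simp only [hw]
      by_cases h4 : q₂ ≤ m ∧ m - q₁ < M
      · rw [if_pos h4, if_pos ⟨by omega, h4.2⟩, if_pos ⟨h4.1, by omega⟩]
      · rw [if_neg h4]
        by_cases h5 : q₂ ≤ m ∧ m - q₂ < M
        · rw [if_neg (by omega), zero_mul]
        · rw [if_neg h5, map_zero, mul_zero]
    simp_rw [h3]
    rw [← Finset.sum_filter]
    symm
    refine Finset.sum_bij (fun n _ => n + q₂) ?_ ?_ ?_ ?_
    · intro n hn
      rw [Finset.mem_range] at hn
      rw [Finset.mem_filter, Finset.mem_range]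
      omega
    · intro a _ b _ h
      simpa using h
    · intro m hm
      rw [Finset.mem_filter, Finset.mem_range] at hm
      exact ⟨m - q₂, Finset.mem_range.2 (by omega), by omega⟩
    · intro n _
      rw [Nat.add_sub_cancel, Nat.add_sub_assoc h]
  have hcorr' : ∀ q₁ q₂, q₂ ≤ q₁ → q₁ < Q →
      ‖∑ m ∈ Finset.range (M + Q), w q₁ m * (starRingEnd ℂ) (w q₂ m)‖ = T (q₁ - q₂) := by
    intro q₁ q₂ h h2
    rw [← hcorr q₂ q₁ h h2, ← Complex.norm_conj, map_sum]
    congr 1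
    refine Finset.sum_congr rfl fun m _ => ?_
    rw [map_mul, Complex.conj_conj, mul_comm]
  have hT0 : ∀ q, 0 ≤ T q := fun q => norm_nonneg _
  -- For fixed `q₁`, each value of `|q₁ - q₂|` arises at most once from `q₂ < q₁` and once from `q₂
  -- ≥ q₁`, whence the factor 2.
  have hrow : ∀ q₁ ∈ Finset.range Q, ∑ q₂ ∈ Finset.range Q,
      ‖∑ m ∈ Finset.range (M + Q), w q₁ m * (starRingEnd ℂ) (w q₂ m)‖
        ≤ 2 * ∑ q ∈ Finset.range Q, T q := by
    intro q₁ hq₁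
    rw [Finset.mem_range] at hq₁
    rw [← Finset.sum_range_add_sum_Ico _ hq₁.le, two_mul]
    refine add_le_add ?_ ?_
    · rw [← Finset.sum_range_reflect]
      calc _ = ∑ j ∈ Finset.range q₁, T (j + 1) := by
            refine Finset.sum_congr rfl fun j hj => ?_
            rw [Finset.mem_range] at hj
            rw [hcorr' _ _ (by omega) hq₁]
            congr 1
            omega
        _ ≤ ∑ q ∈ Finset.range (q₁ + 1), T q := by
            rw [Finset.sum_range_succ']
            linarith [hT0 0]
        _ ≤ _ := Finset.sum_le_sum_of_subset_of_nonneg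
            (Finset.range_subset_range.2 (by omega)) fun q _ _ => hT0 q
    · rw [Finset.sum_Ico_eq_sum_range]
      calc _ = ∑ j ∈ Finset.range (Q - q₁), T j := by
            refine Finset.sum_congr rfl fun j hj => ?_
            rw [Finset.mem_range] at hj
            rw [hcorr _ _ (by omega) (by omega)]
            congr 1
            omega
        _ ≤ _ := Finset.sum_le_sum_of_subset_of_nonneg
            (Finset.range_subset_range.2 (by omega)) fun q _ _ => hT0 q
  have hQS : (Q : ℂ) * ∑ n ∈ Finset.range M, z n
      = ∑ m ∈ Finset.range (M + Q), ∑ q ∈ Finset.range Q, w q m := by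
    rw [Finset.sum_comm, Finset.sum_congr rfl fun q hq => hsum q (Finset.mem_range.1 hq)]
    simp
  have hCS : ‖(Q : ℂ) * ∑ n ∈ Finset.range M, z n‖ ^ 2
      ≤ (M + Q) * ∑ m ∈ Finset.range (M + Q), ‖∑ q ∈ Finset.range Q, w q m‖ ^ 2 := by
    rw [hQS]
    have h1 := norm_sum_le (Finset.range (M + Q)) (fun m => ∑ q ∈ Finset.range Q, w q m)
    have h2 := sq_sum_le_card_mul_sum_sq (s := Finset.range (M + Q))
      (f := fun m => ‖∑ q ∈ Finset.range Q, w q m‖)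
    rw [Finset.card_range] at h2
    push_cast at h2
    exact (pow_le_pow_left₀ (norm_nonneg _) h1 2).trans h2
  have hexp : ∑ m ∈ Finset.range (M + Q), ‖∑ q ∈ Finset.range Q, w q m‖ ^ 2
      ≤ Q * (2 * ∑ q ∈ Finset.range Q, T q) := by
    have h1 : ((∑ m ∈ Finset.range (M + Q), ‖∑ q ∈ Finset.range Q, w q m‖ ^ 2 : ℝ) : ℂ)
        = ∑ q₁ ∈ Finset.range Q, ∑ q₂ ∈ Finset.range Q,
          ∑ m ∈ Finset.range (M + Q), w q₁ m * (starRingEnd ℂ) (w q₂ m) := by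
      push_cast
      rw [Finset.sum_congr rfl fun q₁ _ => Finset.sum_comm, Finset.sum_comm]
      refine Finset.sum_congr rfl fun m _ => ?_
      rw [← Complex.mul_conj', map_sum, Finset.sum_mul_sum]
    have h2 : ∑ m ∈ Finset.range (M + Q), ‖∑ q ∈ Finset.range Q, w q m‖ ^ 2
        = ‖((∑ m ∈ Finset.range (M + Q), ‖∑ q ∈ Finset.range Q, w q m‖ ^ 2 : ℝ) : ℂ)‖ := by
      rw [Complex.norm_real, Real.norm_of_nonneg (Finset.sum_nonneg fun _ _ => by positivity)]
    rw [h2, h1]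
    refine (norm_sum_le _ _).trans ((Finset.sum_le_sum fun q₁ hq₁ =>
      (norm_sum_le _ _).trans (hrow q₁ hq₁)).trans ?_)
    simp
  rw [norm_mul, Complex.norm_natCast, mul_pow] at hCS
  have hQ' : (0 : ℝ) < Q := by exact_mod_cast hQ
  have h5 : (M + Q : ℝ) * ∑ m ∈ Finset.range (M + Q), ‖∑ q ∈ Finset.range Q, w q m‖ ^ 2
      ≤ (M + Q) * (Q * (2 * ∑ q ∈ Finset.range Q, T q)) := by gcongr
  have h6 := hCS.trans h5
  refine le_of_mul_le_mul_left ?_ hQ'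
  linarith

/-- A `j`-th difference test with exponents `κ`, `δ` for exponential sums. -/
def DifferenceTest (j : ℕ) (κ δ : ℝ) : Prop :=
  ∀ A : ℝ, 1 ≤ A → ∃ C : ℝ, 0 < C ∧ ∀ (f : ℕ → ℝ) (M : ℕ) (lam : ℝ), 0 < lam →
    (∀ n < M, lam ≤ (fwdDiff 1)^[j] f n ∧ (fwdDiff 1)^[j] f n ≤ A * lam) →
      ‖∑ n ∈ Finset.range M, ee (f n)‖ ≤ C * (M * lam ^ κ + (M : ℝ) ^ (1 - δ) * lam ^ (-κ))

theorem differenceTest_two : DifferenceTest 2 (1 / 2) 1 := by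
  intro A hA
  refine ⟨12 * A, by linarith, fun f M lam hlam h => ?_⟩
  have h2 : ∀ n, (fwdDiff 1)^[2] f n = f (n + 2) - 2 * f (n + 1) + f n := by
    intro n
    simp only [Function.iterate_succ, Function.iterate_zero, Function.comp_apply, id, fwdDiff]
    rw [show n + 1 + 1 = n + 2 by ring]
    ring
  have := second_difference_test f M hlam hA (fun n hn => h2 n ▸ (h n hn).1)
    (fun n hn => h2 n ▸ (h n hn).2)
  simpa using this

/-- Telescoping in `q`. It shows that Weyl differencing by `q` trades a condition on differences of
order `j + 1` and size `lam` for one of order `j` and size `q * lam`. -/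
theorem fwdDiff_iterate_shift_sub (f : ℕ → ℝ) (j q n : ℕ) :
    (fwdDiff 1)^[j] (fun m => f (m + q) - f m) n
      = ∑ i ∈ Finset.range q, (fwdDiff 1)^[j + 1] f (n + i) := by
  induction q with
  | zero =>
    simp only [add_zero, sub_self, Finset.range_zero, Finset.sum_empty]
    have : (fwdDiff 1)^[j] (0 : ℕ → ℝ) = 0 := by
      have := fwdDiff_iter_const_smul (M := ℕ) (G := ℝ) 1 (0 : ℝ) (0 : ℕ → ℝ) j
      simpa using this
    exact congrFun this n
  | succ q ih =>
    rw [Finset.sum_range_succ, ← ih, ← fwdDiff_iter_comp_add, Function.iterate_succ_apply]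
    have h := fwdDiff_iter_add (M := ℕ) (G := ℝ) 1 (fun m => f (m + q) - f m)
      (fwdDiff 1 (fun m => f (m + q))) j
    rw [← Pi.add_apply, ← h]
    refine congrFun (congrArg _ ?_) n
    funext m
    simp only [Pi.add_apply, fwdDiff]
    rw [show m + (q + 1) = m + 1 + q by ring]
    ring

theorem sum_Ico_rpow_neg_half_le (Q : ℕ) :
    ∑ q ∈ Finset.Ico 1 (Q + 1), (q : ℝ) ^ (-(1 / 2) : ℝ) ≤ 2 * (Q : ℝ) ^ (1 / 2 : ℝ) := by
  induction Q with
  | zero => simp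
  | succ Q ih =>
    rw [Finset.sum_Ico_succ_top (by omega)]
    refine (add_le_add_left ih _).trans ?_
    rw [Real.rpow_neg (by positivity), ← Real.sqrt_eq_rpow, ← Real.sqrt_eq_rpow]
    push_cast
    have h0 : (0 : ℝ) ≤ Q := Nat.cast_nonneg _
    have h1 := Real.sq_sqrt h0
    have h2 := Real.sq_sqrt (show (0 : ℝ) ≤ Q + 1 by linarith)
    have h3 : 0 < √((Q : ℝ) + 1) := Real.sqrt_pos.2 (by linarith)
    have h4 : (√((Q : ℝ) + 1))⁻¹ * √((Q : ℝ) + 1) = 1 := inv_mul_cancel₀ h3.ne'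
    have h5 := Real.sqrt_nonneg (Q : ℝ)
    refine le_of_mul_le_mul_right ?_ h3
    -- The inequality `1 / √(Q + 1) ≤ 2 (√(Q + 1) - √Q)` is equivalent to the nonnegativity of this
    -- square.
    nlinarith [sq_nonneg (√((Q : ℝ) + 1) - √(Q : ℝ))]

/-- Extracting `Q ^ (1/2 - κ)` reduces to the exponent `1/2` and keeps the constant 2 uniform in
`κ`. -/
theorem sum_Ico_rpow_neg_le {κ : ℝ} (hκ2 : κ ≤ 1 / 2) (Q : ℕ) :
    ∑ q ∈ Finset.Ico 1 Q, (q : ℝ) ^ (-κ) ≤ 2 * (Q : ℝ) ^ (1 - κ) := by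
  rcases Nat.eq_zero_or_pos Q with rfl | hQ
  · simp; positivity
  have hQ' : (0 : ℝ) < Q := by exact_mod_cast hQ
  calc ∑ q ∈ Finset.Ico 1 Q, (q : ℝ) ^ (-κ)
      ≤ ∑ q ∈ Finset.Ico 1 (Q + 1), (Q : ℝ) ^ (1 / 2 - κ) * (q : ℝ) ^ (-(1 / 2) : ℝ) := by
        refine (Finset.sum_le_sum fun q hq => ?_).trans
          (Finset.sum_le_sum_of_subset_of_nonneg
            (Finset.Ico_subset_Ico le_rfl (Nat.le_succ _)) fun q _ _ => by positivity)
        rw [Finset.mem_Ico] at hq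
        have hq0 : (0 : ℝ) < q := by exact_mod_cast hq.1
        have : (q : ℝ) ^ (-κ) = (q : ℝ) ^ (1 / 2 - κ) * (q : ℝ) ^ (-(1 / 2) : ℝ) := by
          rw [← Real.rpow_add hq0]; congr 1; ring
        rw [this]
        gcongr
        exact_mod_cast hq.2.le
    _ = (Q : ℝ) ^ (1 / 2 - κ) * ∑ q ∈ Finset.Ico 1 (Q + 1), (q : ℝ) ^ (-(1 / 2) : ℝ) := by
        rw [Finset.mul_sum]
    _ ≤ (Q : ℝ) ^ (1 / 2 - κ) * (2 * (Q : ℝ) ^ (1 / 2 : ℝ)) := by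
        gcongr
        exact sum_Ico_rpow_neg_half_le Q
    _ = 2 * (Q : ℝ) ^ (1 - κ) := by
        rw [mul_left_comm, ← Real.rpow_add hQ']; congr 2; ring

/-- Van der Corput's A-process before the number `Q` of shifts is chosen. The shift `q = 0` gives
the diagonal term `M² / Q`; the other shifts are bounded by the test `hT` with `q * lam` in place of
`lam`. -/
theorem norm_sum_sq_le_of_differenceTest {j : ℕ} {κ δ A C lam : ℝ} (hκ : 0 < κ)
    (hκ2 : κ ≤ 1 / 2) (hδ2 : δ ≤ 1) (hC : 0 < C) (hlam : 0 < lam)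
    (hT : ∀ (f : ℕ → ℝ) (M : ℕ) (lam : ℝ), 0 < lam →
      (∀ n < M, lam ≤ (fwdDiff 1)^[j] f n ∧ (fwdDiff 1)^[j] f n ≤ A * lam) →
      ‖∑ n ∈ Finset.range M, ee (f n)‖ ≤ C * (M * lam ^ κ + (M : ℝ) ^ (1 - δ) * lam ^ (-κ)))
    (f : ℕ → ℝ) (M Q : ℕ) (hQ : 0 < Q) (hQM : Q ≤ M)
    (h : ∀ n < M, lam ≤ (fwdDiff 1)^[j + 1] f n ∧ (fwdDiff 1)^[j + 1] f n ≤ A * lam) :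
    ‖∑ n ∈ Finset.range M, ee (f n)‖ ^ 2 ≤ 4 * M ^ 2 / Q + 4 * C * (M ^ 2 * (Q * lam) ^ κ)
      + 8 * C * (M ^ (2 - δ) * (Q * lam) ^ (-κ)) := by
  have hM : 0 < M := by omega
  have hM' : (0 : ℝ) < M := by exact_mod_cast hM
  have hQ' : (0 : ℝ) < Q := by exact_mod_cast hQ
  have hQM' : (Q : ℝ) ≤ M := by exact_mod_cast hQM
  have hq : ∀ q ∈ Finset.Ico 1 Q, ‖∑ n ∈ Finset.range (M - q),
      ee (f (n + q)) * (starRingEnd ℂ) (ee (f n))‖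
      ≤ C * M * (Q * lam) ^ κ + C * (M : ℝ) ^ (1 - δ) * lam ^ (-κ) * (q : ℝ) ^ (-κ) := by
    intro q hq
    rw [Finset.mem_Ico] at hq
    have hq0 : (0 : ℝ) < q := by exact_mod_cast hq.1
    have hqQ : (q : ℝ) ≤ Q := by exact_mod_cast hq.2.le
    simp_rw [← ee_sub]
    have hMq : ((M - q : ℕ) : ℝ) ≤ M := by exact_mod_cast Nat.sub_le _ _
    refine (hT (fun n => f (n + q) - f n) (M - q) (q * lam) (by positivity) ?_).trans ?_
    · intro n hn
      rw [fwdDiff_iterate_shift_sub]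
      constructor
      · have := Finset.card_nsmul_le_sum (Finset.range q)
          (fun i => (fwdDiff 1)^[j + 1] f (n + i)) lam (fun i hi => by
            rw [Finset.mem_range] at hi; exact (h (n + i) (by omega)).1)
        simpa using this
      · have := Finset.sum_le_card_nsmul (Finset.range q)
          (fun i => (fwdDiff 1)^[j + 1] f (n + i)) (A * lam) (fun i hi => by
            rw [Finset.mem_range] at hi; exact (h (n + i) (by omega)).2)
        simp only [Finset.card_range, nsmul_eq_mul] at this
        linarith
    · have h1 : ((M - q : ℕ) : ℝ) * (q * lam) ^ κ ≤ M * (Q * lam) ^ κ := by gcongr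
      have h2 : ((M - q : ℕ) : ℝ) ^ (1 - δ) * (q * lam) ^ (-κ)
          ≤ (M : ℝ) ^ (1 - δ) * (lam ^ (-κ) * (q : ℝ) ^ (-κ)) := by
        rw [Real.mul_rpow hq0.le hlam.le, mul_comm ((q : ℝ) ^ (-κ))]
        gcongr
      calc _ ≤ C * (M * (Q * lam) ^ κ + (M : ℝ) ^ (1 - δ) * (lam ^ (-κ) * (q : ℝ) ^ (-κ))) := by
            gcongr
        _ = _ := by ring
  have hsum : ∑ q ∈ Finset.range Q, ‖∑ n ∈ Finset.range (M - q),
      ee (f (n + q)) * (starRingEnd ℂ) (ee (f n))‖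
      ≤ M + (Q * (C * M * (Q * lam) ^ κ)
        + C * (M : ℝ) ^ (1 - δ) * lam ^ (-κ) * (2 * (Q : ℝ) ^ (1 - κ))) := by
    rw [Finset.range_eq_Ico, Finset.sum_eq_sum_Ico_succ_bot hQ]
    refine add_le_add ?_ ((Finset.sum_le_sum hq).trans ?_)
    · refine (norm_sum_le _ _).trans ?_
      simp [norm_ee]
    · rw [Finset.sum_add_distrib, Finset.sum_const, nsmul_eq_mul, Nat.card_Ico, ← Finset.mul_sum]
      refine add_le_add ?_ ?_
      · have : ((Q - 1 : ℕ) : ℝ) ≤ Q := by exact_mod_cast Nat.sub_le _ _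
        exact mul_le_mul_of_nonneg_right this (by positivity)
      · exact mul_le_mul_of_nonneg_left (sum_Ico_rpow_neg_le hκ2 Q) (by positivity)
  have hW := weyl_van_der_corput (fun n => ee (f n)) M Q hQ
  have h3 : (‖∑ n ∈ Finset.range M, ee (f n)‖ ^ 2) * Q ≤ (M + M) * (2 * (M + (Q * (C * M * (Q * lam) ^ κ)
        + C * (M : ℝ) ^ (1 - δ) * lam ^ (-κ) * (2 * (Q : ℝ) ^ (1 - κ))))) := by
    refine hW.trans ?_
    gcongr
  rw [← le_div_iff₀ hQ'] at h3
  refine h3.trans (le_of_eq ?_)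
  have e1 : (Q : ℝ) ^ (1 - κ) = Q * (Q : ℝ) ^ (-κ) := by
    rw [sub_eq_add_neg, Real.rpow_add hQ', Real.rpow_one]
  have e2 : (M : ℝ) ^ (2 - δ) = M * (M : ℝ) ^ (1 - δ) := by
    rw [show 2 - δ = 1 + (1 - δ) by ring, Real.rpow_add hM', Real.rpow_one]
  rw [e1, e2, Real.mul_rpow hQ'.le hlam.le, Real.mul_rpow hQ'.le hlam.le]
  field_simp
  ring

theorem eight_mul_sq_add_le {C x y : ℝ} (hC : 0 ≤ C) (hx : 0 ≤ x) (hy : 0 ≤ y) :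
    8 * x ^ 2 + 4 * C * x ^ 2 + 16 * C * y ^ 2 ≤ ((8 + 20 * C) * (x + y)) ^ 2 := by
  have h0 : x ^ 2 + y ^ 2 ≤ (x + y) ^ 2 := by nlinarith
  have h1 : 8 + 20 * C ≤ (8 + 20 * C) ^ 2 := by nlinarith
  have h2 : (8 + 20 * C) * (x ^ 2 + y ^ 2) ≤ (8 + 20 * C) ^ 2 * (x + y) ^ 2 := by gcongr
  have h4 : 0 ≤ C * x ^ 2 := by positivity
  have h5 : 0 ≤ C * y ^ 2 := by positivity
  have h6 : 0 ≤ y ^ 2 := by positivity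
  rw [mul_pow]
  linarith

/-- The A-process with `Q` about `lam ^ (-κ / (1 + κ))`, the value for which `1 / Q = (Q lam)^κ`. A
square root then halves the saving `δ` and gives the new exponent `κ / (2 (1 + κ))`. -/
theorem DifferenceTest.succ {j : ℕ} {κ δ : ℝ} (hκ : 0 < κ) (hκ2 : κ ≤ 1 / 2)
    (hδ2 : δ ≤ 1) (hT : DifferenceTest j κ δ) :
    DifferenceTest (j + 1) (κ / (2 * (1 + κ))) (δ / 2) := by
  intro A hA
  obtain ⟨C, hC, hT⟩ := hT A hA
  refine ⟨8 + 20 * C, by positivity, fun f M lam hlam h => ?_⟩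
  set κ' := κ / (2 * (1 + κ)) with hκ'
  have hκ'0 : 0 < κ' := by positivity
  rcases Nat.eq_zero_or_pos M with rfl | hM
  · simp; positivity
  have hM' : (1 : ℝ) ≤ M := by exact_mod_cast hM
  have hM0 : (0 : ℝ) < M := by linarith
  have htriv : (M : ℝ) ≤ M * lam ^ κ' + (M : ℝ) ^ (1 - δ / 2) * lam ^ (-κ') →
      ‖∑ n ∈ Finset.range M, ee (f n)‖
        ≤ (8 + 20 * C) * (M * lam ^ κ' + (M : ℝ) ^ (1 - δ / 2) * lam ^ (-κ')) := by
    intro h1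
    refine (norm_sum_ee_le_card _ _).trans ?_
    rw [Finset.card_range]
    exact h1.trans (le_mul_of_one_le_left (by positivity) (by linarith))
  rcases le_or_gt 1 lam with hl | hl
  · apply htriv
    have : 1 ≤ lam ^ κ' := Real.one_le_rpow hl hκ'0.le
    have h2 : (0 : ℝ) ≤ (M : ℝ) ^ (1 - δ / 2) * lam ^ (-κ') := by positivity
    nlinarith
  set D := lam ^ (-(2 * κ')) with hD
  have hD1 : 1 ≤ D := Real.one_le_rpow_of_pos_of_le_one_of_nonpos hlam hl.le (by linarith)
  have hDhalf : lam ^ (-κ') = D ^ (1 / 2 : ℝ) := by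
    rw [hD, ← Real.rpow_mul hlam.le]; congr 1; ring
  -- At most `M` shifts are allowed. If `M < D`, then `lam ^ (-κ')` exceeds `√M`, and as `δ ≤ 1` the
  -- second term of the claim already exceeds `M`.
  rcases lt_or_ge (M : ℝ) D with hDM | hDM
  · apply htriv
    have h1 : (M : ℝ) ^ (1 - δ / 2) * M ^ (1 / 2 : ℝ) ≤ (M : ℝ) ^ (1 - δ / 2) * lam ^ (-κ') := by
      rw [hDhalf]; gcongr
    rw [← Real.rpow_add hM0] at h1
    have h2 : (M : ℝ) ^ (1 : ℝ) ≤ (M : ℝ) ^ (1 - δ / 2 + 1 / 2) :=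
      Real.rpow_le_rpow_of_exponent_le hM' (by linarith)
    rw [Real.rpow_one] at h2
    have h3 : 0 ≤ M * lam ^ κ' := by positivity
    linarith
  set Q := ⌊D⌋₊ with hQdef
  have hQ : 0 < Q := Nat.floor_pos.2 hD1
  have hQ1 : (1 : ℝ) ≤ Q := by exact_mod_cast hQ
  have hQD : (Q : ℝ) ≤ D := Nat.floor_le (by linarith)
  have hDQ : D ≤ 2 * Q := by
    have := Nat.lt_floor_add_one D
    linarith
  have hQM : Q ≤ M := by exact_mod_cast hQD.trans hDM
  have hQ0 : (0 : ℝ) < Q := by linarith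
  have hmain := norm_sum_sq_le_of_differenceTest hκ hκ2 hδ2 hC hlam hT f M Q hQ hQM h
  set U := lam ^ κ' with hU
  set V := lam ^ (-κ') with hV
  have hU2 : lam ^ (2 * κ') = U ^ 2 := by
    rw [hU, ← Real.rpow_natCast, ← Real.rpow_mul hlam.le]; congr 1; push_cast; ring
  have hV2 : D = V ^ 2 := by
    rw [hV, hD, ← Real.rpow_natCast, ← Real.rpow_mul hlam.le]; congr 1; push_cast; ring
  have hUV : U * V = 1 := by rw [hU, hV, ← Real.rpow_add hlam]; simp
  have hU0 : 0 < U := by positivity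
  have hV0 : 0 < V := by positivity
  have hexp : (-(2 * κ') + 1) * κ = 2 * κ' := by rw [hκ']; field_simp; ring
  have hDl : D * lam = lam ^ (-(2 * κ') + 1) := by
    rw [Real.rpow_add hlam, Real.rpow_one]
  have b1 : 4 * (M : ℝ) ^ 2 / Q ≤ 8 * (M * U) ^ 2 := by
    rw [div_le_iff₀ hQ0]
    have h1 : 1 ≤ U ^ 2 * (2 * Q) := by
      calc (1 : ℝ) = U ^ 2 * V ^ 2 := by rw [← mul_pow, hUV, one_pow]
        _ ≤ U ^ 2 * (2 * Q) := by rw [← hV2]; gcongr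
    have : 4 * (M : ℝ) ^ 2 * 1 ≤ 4 * (M : ℝ) ^ 2 * (U ^ 2 * (2 * Q)) := by gcongr
    linarith
  have b2 : (Q * lam) ^ κ ≤ U ^ 2 := by
    calc (Q * lam) ^ κ ≤ (D * lam) ^ κ := by gcongr
      _ = U ^ 2 := by rw [hDl, ← Real.rpow_mul hlam.le, hexp, hU2]
  have b3 : (Q * lam) ^ (-κ) ≤ 2 * V ^ 2 := by
    have h1 : (D * lam) ^ (-κ) = V ^ 2 := by
      rw [hDl, ← Real.rpow_mul hlam.le, ← hV2, hD]; congr 1; linarith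
    calc (Q * lam) ^ (-κ) ≤ ((1 / 2) * (D * lam)) ^ (-κ) := by
          apply Real.rpow_le_rpow_of_nonpos (by positivity) _ (by linarith)
          nlinarith
      _ = (1 / 2) ^ (-κ) * V ^ 2 := by rw [Real.mul_rpow (by norm_num) (by positivity), h1]
      _ ≤ 2 * V ^ 2 := by
          gcongr
          rw [Real.rpow_neg (by norm_num), ← Real.inv_rpow (by norm_num)]
          norm_num
          calc (2 : ℝ) ^ κ ≤ 2 ^ (1 : ℝ) :=
                Real.rpow_le_rpow_of_exponent_le (by norm_num) (by linarith)
            _ = 2 := Real.rpow_one 2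
  have e2 : (M : ℝ) ^ (2 - δ) = ((M : ℝ) ^ (1 - δ / 2)) ^ 2 := by
    rw [← Real.rpow_natCast, ← Real.rpow_mul hM0.le]; congr 1; push_cast; ring
  set W := (M : ℝ) ^ (1 - δ / 2) with hW
  have hW0 : 0 < W := by positivity
  rw [e2] at hmain
  have hfin : ‖∑ n ∈ Finset.range M, ee (f n)‖ ^ 2
      ≤ ((8 + 20 * C) * (M * U + W * V)) ^ 2 := by
    refine hmain.trans ?_
    have c2 : 4 * C * ((M : ℝ) ^ 2 * (Q * lam) ^ κ) ≤ 4 * C * (M * U) ^ 2 := by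
      rw [mul_pow]; gcongr
    have c3 : 8 * C * (W ^ 2 * (Q * lam) ^ (-κ)) ≤ 16 * C * (W * V) ^ 2 := by
      have : 8 * C * (W ^ 2 * (Q * lam) ^ (-κ)) ≤ 8 * C * (W ^ 2 * (2 * V ^ 2)) := by gcongr
      linarith
    have c4 := eight_mul_sq_add_le hC.le (x := M * U) (y := W * V) (by positivity) (by positivity)
    linarith
  exact le_of_sq_le_sq hfin (by positivity)

theorem differenceTest_three : DifferenceTest 3 (1 / 6) (1 / 2) := by
  have := differenceTest_two.succ (by norm_num) (by norm_num) (by norm_num)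
  norm_num at this ⊢
  exact this

theorem differenceTest_four : DifferenceTest 4 (1 / 14) (1 / 4) := by
  have := differenceTest_three.succ (by norm_num) (by norm_num) (by norm_num)
  norm_num at this ⊢
  exact this

/-! ### Oscillatory integrals by partial integration -/

theorem hasDerivAt_ee {φ : ℝ → ℝ} {d t : ℝ} (h : HasDerivAt φ d t) :
    HasDerivAt (fun u => ee (φ u)) (2 * Real.pi * Complex.I * (d : ℂ) * ee (φ t)) t := by
  have h1 : HasDerivAt (fun u => ((φ u : ℝ) : ℂ)) (d : ℂ) t := h.ofReal_comp
  have h2 := (h1.const_mul (2 * Real.pi * Complex.I)).cexp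
  simp only [ee]
  convert h2 using 1
  ring

theorem continuous_ee : Continuous ee := by
  unfold ee
  fun_prop

theorem two_pi_I_ne_zero : (2 * Real.pi * Complex.I : ℂ) ≠ 0 := Complex.two_pi_I_ne_zero

theorem norm_two_pi_I : ‖(2 * Real.pi * Complex.I : ℂ)‖ = 2 * Real.pi := by
  simp [abs_of_pos Real.pi_pos]

/-- Partial integration of an oscillating integral against a monotone weight. -/
theorem norm_integral_ee_sub_boundary_le {a b : ℝ} (hab : a ≤ b) {φ φ' q q' : ℝ → ℝ}
    (hφ : ∀ t ∈ Set.Icc a b, HasDerivAt φ (φ' t) t)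
    (hq : ∀ t ∈ Set.Icc a b, HasDerivAt q (q' t) t)
    (hφ' : ContinuousOn φ' (Set.Icc a b)) (hq' : ContinuousOn q' (Set.Icc a b))
    (hsign : (∀ t ∈ Set.Icc a b, 0 ≤ q' t) ∨ (∀ t ∈ Set.Icc a b, q' t ≤ 0)) :
    ‖(∫ t in a..b, ee (φ t) * ((φ' t * q t : ℝ) : ℂ))
      - (ee (φ b) * (q b : ℂ) - ee (φ a) * (q a : ℂ)) / (2 * Real.pi * Complex.I)‖
      ≤ |q b - q a| / (2 * Real.pi) := by
  have hu : Set.uIcc a b = Set.Icc a b := Set.uIcc_of_le hab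
  have hφc : ContinuousOn φ (Set.Icc a b) := fun t ht => (hφ t ht).continuousAt.continuousWithinAt
  have hqc : ContinuousOn q (Set.Icc a b) := fun t ht => (hq t ht).continuousAt.continuousWithinAt
  have hec : ContinuousOn (fun t => ee (φ t)) (Set.Icc a b) := continuous_ee.comp_continuousOn hφc
  have hi1 : IntervalIntegrable (fun t => ee (φ t) * ((φ' t * q t : ℝ) : ℂ)) MeasureTheory.volume a b := by
    apply ContinuousOn.intervalIntegrable
    rw [hu]
    exact hec.mul (Complex.continuous_ofReal.comp_continuousOn (hφ'.mul hqc))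
  have hi2 : IntervalIntegrable (fun t => ee (φ t) * ((q' t : ℝ) : ℂ) / (2 * Real.pi * Complex.I))
      MeasureTheory.volume a b := by
    apply ContinuousOn.intervalIntegrable
    rw [hu]
    exact (hec.mul (Complex.continuous_ofReal.comp_continuousOn hq')).div_const _
  have hi3 : IntervalIntegrable q' MeasureTheory.volume a b := by
    apply ContinuousOn.intervalIntegrable; rwa [hu]
  have hFTC := integral_eq_sub_of_hasDerivAt (a := a) (b := b)
    (f := fun t => ee (φ t) * (q t : ℂ) / (2 * Real.pi * Complex.I))
    (f' := fun t => ee (φ t) * ((φ' t * q t : ℝ) : ℂ)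
      + ee (φ t) * ((q' t : ℝ) : ℂ) / (2 * Real.pi * Complex.I))
    (fun t ht => by
      rw [hu] at ht
      have h1 := ((hasDerivAt_ee (hφ t ht)).mul (hq t ht).ofReal_comp).div_const
        (2 * Real.pi * Complex.I)
      refine h1.congr_deriv ?_
      have := two_pi_I_ne_zero
      push_cast
      rw [add_div]
      congr 1
      rw [div_eq_iff this]
      ring)
    (hi1.add hi2)
  rw [integral_add hi1 hi2] at hFTC
  have hq2 := integral_eq_sub_of_hasDerivAt (a := a) (b := b) (f := q) (f' := q')
    (fun t ht => hq t (hu ▸ ht)) hi3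
  have hrem : ‖∫ t in a..b, ee (φ t) * ((q' t : ℝ) : ℂ) / (2 * Real.pi * Complex.I)‖
      ≤ |q b - q a| / (2 * Real.pi) := by
    refine (norm_integral_le_integral_norm hab).trans ?_
    have hn : ∀ t, ‖ee (φ t) * ((q' t : ℝ) : ℂ) / (2 * Real.pi * Complex.I)‖
        = |q' t| / (2 * Real.pi) := by
      intro t
      rw [norm_div, norm_mul, norm_ee, norm_two_pi_I, Complex.norm_real, one_mul,
        Real.norm_eq_abs]
    simp_rw [hn]
    rw [integral_div]
    -- Since `q'` has constant sign, the integral of its absolute value is the total change of `q`.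
    apply le_of_eq
    congr 1
    rcases hsign with h | h
    · rw [integral_congr (g := q') (fun t ht => abs_of_nonneg (h t (hu ▸ ht))), hq2,
        abs_of_nonneg]
      rw [← hq2]
      exact integral_nonneg hab h
    · rw [integral_congr (g := fun t => - q' t) (fun t ht => abs_of_nonpos (h t (hu ▸ ht))),
        integral_neg, hq2, abs_of_nonpos]
      rw [← hq2]
      have := integral_nonneg (μ := MeasureTheory.volume) (f := fun t => - q' t) hab
        (fun t ht => neg_nonneg.2 (h t ht))
      rw [integral_neg] at this
      linarith
  have : (∫ t in a..b, ee (φ t) * ((φ' t * q t : ℝ) : ℂ))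
      - (ee (φ b) * (q b : ℂ) - ee (φ a) * (q a : ℂ)) / (2 * Real.pi * Complex.I)
      = - ∫ t in a..b, ee (φ t) * ((q' t : ℝ) : ℂ) / (2 * Real.pi * Complex.I) := by
    rw [sub_div]
    linear_combination hFTC
  rw [this, norm_neg]
  exact hrem

/-- The boundary terms and the variation of `q` each contribute at most `m / π`, and `2 / π < 1`. -/
theorem norm_integral_ee_le {a b : ℝ} (hab : a ≤ b) {φ φ' q q' : ℝ → ℝ}
    (hφ : ∀ t ∈ Set.Icc a b, HasDerivAt φ (φ' t) t)
    (hq : ∀ t ∈ Set.Icc a b, HasDerivAt q (q' t) t)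
    (hφ' : ContinuousOn φ' (Set.Icc a b)) (hq' : ContinuousOn q' (Set.Icc a b))
    (hsign : (∀ t ∈ Set.Icc a b, 0 ≤ q' t) ∨ (∀ t ∈ Set.Icc a b, q' t ≤ 0))
    {m : ℝ} (hma : |q a| ≤ m) (hmb : |q b| ≤ m) :
    ‖∫ t in a..b, ee (φ t) * ((φ' t * q t : ℝ) : ℂ)‖ ≤ m := by
  have h := norm_integral_ee_sub_boundary_le hab hφ hq hφ' hq' hsign
  have hm : 0 ≤ m := (abs_nonneg _).trans hma
  have h1 : ‖(ee (φ b) * (q b : ℂ) - ee (φ a) * (q a : ℂ)) / (2 * Real.pi * Complex.I)‖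
      ≤ (m + m) / (2 * Real.pi) := by
    rw [norm_div, norm_two_pi_I]
    gcongr
    refine (norm_sub_le _ _).trans ?_
    rw [norm_mul, norm_mul, norm_ee, norm_ee, Complex.norm_real, Complex.norm_real, one_mul,
      one_mul]
    exact add_le_add hmb hma
  have h2 : |q b - q a| / (2 * Real.pi) ≤ (m + m) / (2 * Real.pi) := by
    gcongr
    exact (abs_sub _ _).trans (add_le_add hmb hma)
  have h3 := norm_sub_norm_le (∫ t in a..b, ee (φ t) * ((φ' t * q t : ℝ) : ℂ))
    ((ee (φ b) * (q b : ℂ) - ee (φ a) * (q a : ℂ)) / (2 * Real.pi * Complex.I))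
  have h4 : (m + m) / (2 * Real.pi) + (m + m) / (2 * Real.pi) ≤ m := by
    rw [← add_div, div_le_iff₀ (by positivity)]
    nlinarith [Real.pi_gt_three]
  linarith

/-! ### Euler–Maclaurin and Poisson summation -/

theorem HasSum.congr_val {ι α : Type*} [AddCommMonoid α] [TopologicalSpace α] {f : ι → α}
    {a b : α} (h : HasSum f a) (hab : a = b) : HasSum f b := hab ▸ h

theorem hasSum_cos_div_sq {t : ℝ} (ht : t ∈ Set.Icc (0 : ℝ) 1) : HasSum
    (fun r : ℕ => 1 / ((r + 1 : ℕ) : ℝ) ^ 2 * Real.cos (2 * Real.pi * (r + 1 : ℕ) * t))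
    (Real.pi ^ 2 * (t ^ 2 - t + 1 / 6)) := by
  have h1 := hasSum_one_div_nat_pow_mul_cos (k := 1) one_ne_zero ht
  -- The series starts at index 0, where the term `1 / 0 ^ 2` has the value 0 and may be dropped.
  have h2 := (hasSum_nat_add_iff' 1).2 h1
  have h3 : (-1 : ℝ) ^ (1 + 1) * (2 * Real.pi) ^ (2 * 1) / 2 / (2 * 1).factorial
      * (Polynomial.map (algebraMap ℚ ℝ) (Polynomial.bernoulli (2 * 1))).eval t
      = Real.pi ^ 2 * (t ^ 2 - t + 1 / 6) := by
    have := bernoulliFun_two t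
    rw [bernoulliFun] at this
    rw [mul_one, this]
    simp only [show (2 * 1).factorial = 2 from rfl]
    push_cast
    ring
  rw [h3] at h2
  simpa using h2

/-- The Euler–Maclaurin formula on the unit interval as a cosine series. -/
theorem hasSum_integral_cos {G G' G'' : ℝ → ℂ}
    (hG : ∀ t ∈ Set.Icc (0 : ℝ) 1, HasDerivAt G (G' t) t)
    (hG' : ∀ t ∈ Set.Icc (0 : ℝ) 1, HasDerivAt G' (G'' t) t)
    (hG'' : ContinuousOn G'' (Set.Icc 0 1)) :
    HasSum (fun r : ℕ => 2 * ∫ t in (0 : ℝ)..1,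
        G t * ((Real.cos (2 * Real.pi * (r + 1 : ℕ) * t) : ℝ) : ℂ))
      ((G 0 + G 1) / 2 - ∫ t in (0 : ℝ)..1, G t) := by
  have hu : Set.uIcc (0 : ℝ) 1 = Set.Icc 0 1 := Set.uIcc_of_le zero_le_one
  have hGc : ContinuousOn G (Set.Icc 0 1) := fun t ht => (hG t ht).continuousAt.continuousWithinAt
  have hGc' : ContinuousOn G' (Set.Icc 0 1) :=
    fun t ht => (hG' t ht).continuousAt.continuousWithinAt
  have hiG : IntervalIntegrable G MeasureTheory.volume 0 1 :=
    ContinuousOn.intervalIntegrable (by rwa [hu])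
  have hiG' : IntervalIntegrable G' MeasureTheory.volume 0 1 :=
    ContinuousOn.intervalIntegrable (by rwa [hu])
  have hiG'' : IntervalIntegrable G'' MeasureTheory.volume 0 1 :=
    ContinuousOn.intervalIntegrable (by rwa [hu])
  have hpi : (Real.pi : ℂ) ≠ 0 := by exact_mod_cast Real.pi_ne_zero
  -- Two partial integrations produce coefficients `1 / r²`, so that summation and integration may
  -- be interchanged by dominated convergence.
  have hterm : ∀ r : ℕ, 2 * ∫ t in (0 : ℝ)..1,
      G t * ((Real.cos (2 * Real.pi * (r + 1 : ℕ) * t) : ℝ) : ℂ)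
      = (G' 1 - G' 0) * ((1 / (r + 1 : ℕ) ^ 2 : ℝ) : ℂ) / (2 * Real.pi ^ 2)
        - ∫ t in (0 : ℝ)..1, G'' t *
          ((1 / (r + 1 : ℕ) ^ 2 * Real.cos (2 * Real.pi * (r + 1 : ℕ) * t) : ℝ) : ℂ)
            / (2 * Real.pi ^ 2) := by
    intro r
    set k : ℝ := ((r + 1 : ℕ) : ℝ) with hk
    have hk0 : k ≠ 0 := by rw [hk]; positivity
    have hkC : (k : ℂ) ≠ 0 := by exact_mod_cast hk0
    have hw : 2 * Real.pi * k ≠ 0 := by have := Real.pi_ne_zero; positivity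
    have hsd : ∀ t : ℝ, HasDerivAt (fun t : ℝ => ((Real.sin (2 * Real.pi * k * t)
        / (2 * Real.pi * k) : ℝ) : ℂ)) ((Real.cos (2 * Real.pi * k * t) : ℝ) : ℂ) t := by
      intro t
      have h1 : HasDerivAt (fun t : ℝ => 2 * Real.pi * k * t) (2 * Real.pi * k) t := by
        simpa using (hasDerivAt_id t).const_mul (2 * Real.pi * k)
      have h2 := (h1.sin.div_const (2 * Real.pi * k)).ofReal_comp
      convert h2 using 2
      field_simp
    have hcd : ∀ t : ℝ, HasDerivAt (fun t : ℝ => ((-Real.cos (2 * Real.pi * k * t)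
        / (2 * Real.pi * k) ^ 2 : ℝ) : ℂ))
        ((Real.sin (2 * Real.pi * k * t) / (2 * Real.pi * k) : ℝ) : ℂ) t := by
      intro t
      have h1 : HasDerivAt (fun t : ℝ => 2 * Real.pi * k * t) (2 * Real.pi * k) t := by
        simpa using (hasDerivAt_id t).const_mul (2 * Real.pi * k)
      have h2 := (h1.cos.fun_neg.div_const ((2 * Real.pi * k) ^ 2)).ofReal_comp
      convert h2 using 2
      rw [neg_mul, neg_neg, sq, mul_div_mul_right _ _ hw]
    have hs1 : Real.sin (2 * Real.pi * k * 1) = 0 := by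
      rw [mul_one, hk, show 2 * Real.pi * ((r + 1 : ℕ) : ℝ) = ((2 * (r + 1) : ℕ) : ℝ) * Real.pi by
        push_cast; ring]
      exact Real.sin_nat_mul_pi _
    have hc1 : Real.cos (2 * Real.pi * k * 1) = 1 := by
      rw [mul_one, hk, show 2 * Real.pi * ((r + 1 : ℕ) : ℝ) = ((r + 1 : ℕ) : ℝ) * (2 * Real.pi) by
        ring]
      exact Real.cos_nat_mul_two_pi _
    have hci : ∀ c : ℝ, IntervalIntegrable
        (fun t : ℝ => ((Real.cos (2 * Real.pi * k * t) / c : ℝ) : ℂ)) MeasureTheory.volume 0 1 := by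
      intro c
      apply Continuous.intervalIntegrable
      fun_prop
    have hsi : IntervalIntegrable
        (fun t : ℝ => ((Real.sin (2 * Real.pi * k * t) / (2 * Real.pi * k) : ℝ) : ℂ))
        MeasureTheory.volume 0 1 := by
      apply Continuous.intervalIntegrable
      fun_prop
    have p1 := integral_mul_deriv_eq_deriv_mul (a := (0 : ℝ)) (b := 1) (u := G)
      (fun t ht => hG t (hu ▸ ht)) (fun t _ => hsd t) hiG' (by simpa using hci 1)
    have p2 := integral_mul_deriv_eq_deriv_mul (a := (0 : ℝ)) (b := 1) (u := G')
      (fun t ht => hG' t (hu ▸ ht)) (fun t _ => hcd t) hiG'' hsi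
    rw [p1, p2, hs1, hc1]
    have e1 : ∫ t in (0 : ℝ)..1, G'' t * ((1 / k ^ 2 * Real.cos (2 * Real.pi * k * t) : ℝ) : ℂ)
          / (2 * Real.pi ^ 2)
        = -(2 * ∫ t in (0 : ℝ)..1, G'' t * ((-Real.cos (2 * Real.pi * k * t)
        / (2 * Real.pi * k) ^ 2 : ℝ) : ℂ)) := by
      rw [← integral_const_mul, ← integral_neg]
      refine integral_congr fun t _ => ?_
      push_cast
      field_simp
    rw [e1]
    simp only [mul_zero, Real.sin_zero, Real.cos_zero, zero_div, Complex.ofReal_zero, sub_zero,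
      zero_sub]
    push_cast
    field_simp
    ring
  simp_rw [hterm]
  have hz : HasSum (fun r : ℕ => ((1 / (r + 1 : ℕ) ^ 2 : ℝ))) (Real.pi ^ 2 / 6) := by
    have := (hasSum_nat_add_iff' (f := fun n : ℕ => (1 : ℝ) / (n : ℝ) ^ 2) 1).2 hasSum_zeta_two
    simpa using this
  have hB := fun t ht => hasSum_cos_div_sq (t := t) ht
  have hsum1 : HasSum (fun r : ℕ => (G' 1 - G' 0) * ((1 / (r + 1 : ℕ) ^ 2 : ℝ) : ℂ)
      / (2 * Real.pi ^ 2)) ((G' 1 - G' 0) * ((Real.pi ^ 2 / 6 : ℝ) : ℂ) / (2 * Real.pi ^ 2)) :=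
    ((Complex.hasSum_ofReal.2 hz).mul_left _).div_const _
  obtain ⟨c, hc⟩ := isCompact_Icc.exists_bound_of_continuousOn hG''
  have hsum2 : HasSum (fun r : ℕ => ∫ t in (0 : ℝ)..1, G'' t *
          ((1 / (r + 1 : ℕ) ^ 2 * Real.cos (2 * Real.pi * (r + 1 : ℕ) * t) : ℝ) : ℂ)
            / (2 * Real.pi ^ 2))
      (∫ t in (0 : ℝ)..1, G'' t * ((Real.pi ^ 2 * (t ^ 2 - t + 1 / 6) : ℝ) : ℂ)
        / (2 * Real.pi ^ 2)) := by
    refine hasSum_integral_of_dominated_convergence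
      (bound := fun r _ => c * (1 / ((r + 1 : ℕ) : ℝ) ^ 2) / (2 * Real.pi ^ 2)) ?_ ?_ ?_ ?_ ?_
    · intro r
      have : IntervalIntegrable (fun t : ℝ => G'' t *
          ((1 / (r + 1 : ℕ) ^ 2 * Real.cos (2 * Real.pi * (r + 1 : ℕ) * t) : ℝ) : ℂ)
            / (2 * Real.pi ^ 2)) MeasureTheory.volume 0 1 := by
        apply ContinuousOn.intervalIntegrable
        rw [hu]
        exact (hG''.mul (by fun_prop)).div_const _
      exact this.def'.aestronglyMeasurable
    · intro r
      refine Filter.Eventually.of_forall fun t ht => ?_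
      rw [Set.uIoc_of_le zero_le_one] at ht
      have h1 := hc t ⟨ht.1.le, ht.2⟩
      rw [norm_div, norm_mul, Complex.norm_real, norm_mul, Real.norm_eq_abs, Real.norm_eq_abs]
      have h2 : ‖(2 * Real.pi ^ 2 : ℂ)‖ = 2 * Real.pi ^ 2 := by simp
      rw [h2]
      have h3 : |1 / ((r + 1 : ℕ) : ℝ) ^ 2| * |Real.cos (2 * Real.pi * (r + 1 : ℕ) * t)|
          ≤ 1 / ((r + 1 : ℕ) : ℝ) ^ 2 := by
        rw [abs_of_nonneg (by positivity)]
        exact mul_le_of_le_one_right (by positivity) (Real.abs_cos_le_one _)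
      gcongr
      exact (norm_nonneg _).trans h1
    · exact Filter.Eventually.of_forall fun t _ => (hz.summable.mul_left c).div_const _
    · exact intervalIntegrable_const
    · refine Filter.Eventually.of_forall fun t ht => ?_
      rw [Set.uIoc_of_le zero_le_one] at ht
      exact ((Complex.hasSum_ofReal.2 (hB t ⟨ht.1.le, ht.2⟩)).mul_left _).div_const _
  -- The cosine series has been summed to `t² - t + 1/6`; two partial integrations in the opposite
  -- direction recover the endpoint values and the integral of `G`.
  refine (hsum1.sub hsum2).congr_val ?_
  have hd2 : ∀ t : ℝ, HasDerivAt (fun t : ℝ => ((t ^ 2 - t + 1 / 6 : ℝ) : ℂ))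
      ((2 * t - 1 : ℝ) : ℂ) t := by
    intro t
    have := (((hasDerivAt_pow 2 t).sub (hasDerivAt_id t)).add_const (1 / 6 : ℝ)).ofReal_comp
    refine this.congr_deriv ?_
    norm_num
  have hd1 : ∀ t : ℝ, HasDerivAt (fun t : ℝ => ((2 * t - 1 : ℝ) : ℂ)) (2 : ℂ) t := by
    intro t
    have := (((hasDerivAt_id t).const_mul (2 : ℝ)).sub_const (1 : ℝ)).ofReal_comp
    simpa using this
  have q2 := integral_mul_deriv_eq_deriv_mul (a := (0 : ℝ)) (b := 1) (u := G')
    (fun t ht => hG' t (hu ▸ ht)) (fun t _ => hd2 t) hiG''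
    (by apply Continuous.intervalIntegrable; fun_prop)
  have q1 := integral_mul_deriv_eq_deriv_mul (a := (0 : ℝ)) (b := 1) (u := G)
    (fun t ht => hG t (hu ▸ ht)) (fun t _ => hd1 t) hiG'
    (by apply Continuous.intervalIntegrable; fun_prop)
  rw [integral_mul_const] at q1
  have e2 : ∫ t in (0 : ℝ)..1, G'' t * ((Real.pi ^ 2 * (t ^ 2 - t + 1 / 6) : ℝ) : ℂ)
        / (2 * Real.pi ^ 2)
      = (1 / 2) * ∫ t in (0 : ℝ)..1, G'' t * ((t ^ 2 - t + 1 / 6 : ℝ) : ℂ) := by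
    rw [← integral_const_mul]
    refine integral_congr fun t _ => ?_
    push_cast
    field_simp
  rw [e2]
  push_cast at q1 q2 ⊢
  have e3 : (G' 1 - G' 0) * ((Real.pi : ℂ) ^ 2 / 6) / (2 * Real.pi ^ 2) = (G' 1 - G' 0) / 12 := by
    field_simp
    ring
  rw [e3]
  linear_combination (1 / 2) * q1 - (1 / 2) * q2

theorem ee_add_ee_neg (x : ℝ) : ee x + ee (-x) = ((2 * Real.cos (2 * Real.pi * x) : ℝ) : ℂ) := by
  rw [ee_neg, Complex.add_conj, ee_re]

/-- Poisson summation over an interval with integer endpoints. -/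
theorem hasSum_poisson {F F' F'' : ℝ → ℂ} {A B : ℕ} (hAB : A ≤ B)
    (hF : ∀ t ∈ Set.Icc (A : ℝ) B, HasDerivAt F (F' t) t)
    (hF' : ∀ t ∈ Set.Icc (A : ℝ) B, HasDerivAt F' (F'' t) t)
    (hF'' : ContinuousOn F'' (Set.Icc A B)) :
    HasSum (fun r : ℕ => (∫ u in (A : ℝ)..B, F u * ee ((r + 1 : ℕ) * u))
        + ∫ u in (A : ℝ)..B, F u * ee (-((r + 1 : ℕ) * u)))
      (∑ n ∈ Finset.Ioc A B, F n + (F A - F B) / 2 - ∫ u in (A : ℝ)..B, F u) := by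
  have hFc : ContinuousOn F (Set.Icc A B) := fun t ht => (hF t ht).continuousAt.continuousWithinAt
  have hint : ∀ g : ℝ → ℂ, Continuous g → ∀ C D : ℕ, A ≤ C → C ≤ D → D ≤ B →
      IntervalIntegrable (fun u => F u * g u) MeasureTheory.volume C D := by
    intro g hg C D h1 h2 h3
    apply ContinuousOn.intervalIntegrable
    have h2' : (C : ℝ) ≤ D := by exact_mod_cast h2
    rw [Set.uIcc_of_le h2']
    refine (hFc.mono (Set.Icc_subset_Icc ?_ ?_)).mul hg.continuousOn
    · exact_mod_cast h1
    · exact_mod_cast h3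
  -- Unit intervals are added one at a time. Cosines of integer frequency do not see the translation
  -- by `D`, and the half-weights at interior integers add up to 1.
  have key : ∀ D, A ≤ D → D ≤ B → HasSum (fun r : ℕ => 2 * ∫ u in (A : ℝ)..D,
      F u * ((Real.cos (2 * Real.pi * (r + 1 : ℕ) * u) : ℝ) : ℂ))
      (∑ n ∈ Finset.Ioc A D, F n + (F A - F D) / 2 - ∫ u in (A : ℝ)..D, F u) := by
    intro D hAD
    induction D, hAD using Nat.le_induction with
    | base => intro _; simp [hasSum_zero]
    | succ D hD ih =>
      intro hDB
      have h1 := ih (by omega)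
      have hmem : ∀ t ∈ Set.Icc (0 : ℝ) 1, t + D ∈ Set.Icc (A : ℝ) B := by
        intro t ht
        have h2 : (A : ℝ) ≤ D := by exact_mod_cast hD
        have h3 : (D : ℝ) + 1 ≤ B := by exact_mod_cast hDB
        exact ⟨by linarith [ht.1], by linarith [ht.2]⟩
      have h2 := hasSum_integral_cos (G := fun t => F (t + D)) (G' := fun t => F' (t + D))
        (G'' := fun t => F'' (t + D))
        (fun t ht => (hF _ (hmem t ht)).comp_add_const t D)
        (fun t ht => (hF' _ (hmem t ht)).comp_add_const t D)
        (hF''.comp (by fun_prop) hmem)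
      have hcos : ∀ (r : ℕ) (t : ℝ), Real.cos (2 * Real.pi * (r + 1 : ℕ) * (t + D))
          = Real.cos (2 * Real.pi * (r + 1 : ℕ) * t) := by
        intro r t
        rw [show 2 * Real.pi * ((r + 1 : ℕ) : ℝ) * (t + D)
          = 2 * Real.pi * (r + 1 : ℕ) * t + (((r + 1) * D : ℕ) : ℝ) * (2 * Real.pi) by
            push_cast; ring]
        exact Real.cos_add_nat_mul_two_pi _ _
      have h4 : ∀ r : ℕ, ∫ t in (0 : ℝ)..1, F (t + D)
          * ((Real.cos (2 * Real.pi * (r + 1 : ℕ) * t) : ℝ) : ℂ)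
          = ∫ u in (D : ℝ)..(D + 1 : ℕ), F u
            * ((Real.cos (2 * Real.pi * (r + 1 : ℕ) * u) : ℝ) : ℂ) := by
        intro r
        have := integral_comp_add_right (a := (0 : ℝ)) (b := 1) (fun u => F u
            * ((Real.cos (2 * Real.pi * (r + 1 : ℕ) * u) : ℝ) : ℂ)) (D : ℝ)
        simp only [hcos] at this
        rw [this]
        congr 1
        · simp
        · push_cast; ring
      have h5 : ∫ t in (0 : ℝ)..1, F (t + D) = ∫ u in (D : ℝ)..(D + 1 : ℕ), F u := by
        rw [integral_comp_add_right (fun u => F u) (D : ℝ)]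
        congr 1
        · simp
        · push_cast; ring
      simp only [h4, h5] at h2
      have hadd : ∀ g : ℝ → ℂ, Continuous g → (∫ u in (A : ℝ)..(D + 1 : ℕ), F u * g u)
          = (∫ u in (A : ℝ)..D, F u * g u) + ∫ u in (D : ℝ)..(D + 1 : ℕ), F u * g u :=
        fun g hg => (integral_add_adjacent_intervals (hint g hg A D le_rfl hD (by omega))
          (hint g hg D (D + 1) hD (by omega) hDB)).symm
      have h6 := h1.add h2
      have hfun : (fun r : ℕ => 2 * ∫ u in (A : ℝ)..(D + 1 : ℕ),
          F u * ((Real.cos (2 * Real.pi * (r + 1 : ℕ) * u) : ℝ) : ℂ))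
          = fun r : ℕ => (2 * ∫ u in (A : ℝ)..D,
            F u * ((Real.cos (2 * Real.pi * (r + 1 : ℕ) * u) : ℝ) : ℂ))
            + 2 * ∫ u in (D : ℝ)..(D + 1 : ℕ),
            F u * ((Real.cos (2 * Real.pi * (r + 1 : ℕ) * u) : ℝ) : ℂ) := by
        funext r
        rw [hadd _ (by fun_prop), mul_add]
      rw [hfun]
      refine h6.congr_val ?_
      have h7 := hadd (fun _ => 1) continuous_const
      simp only [mul_one] at h7
      rw [h7, Finset.sum_Ioc_succ_top (by omega)]
      simp only [zero_add]
      rw [show (1 : ℝ) + D = ((D + 1 : ℕ) : ℝ) by push_cast; ring]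
      ring
  have h := key B hAB le_rfl
  convert h using 1
  funext r
  rw [← integral_add, ← integral_const_mul]
  · refine integral_congr fun u _ => ?_
    rw [← mul_add, ee_add_ee_neg, show 2 * Real.pi * (((r + 1 : ℕ) : ℝ) * u)
      = 2 * Real.pi * (r + 1 : ℕ) * u by ring]
    push_cast
    ring
  · exact hint _ (continuous_ee.comp (by fun_prop)) A B le_rfl hAB le_rfl
  · exact hint _ (continuous_ee.comp (by fun_prop)) A B le_rfl hAB le_rfl

/-! ### Dual integrals and the truncated Poisson formula -/

/-- The dual integral at frequency `ρ` of the phase `Y / w` over `[a, b]`. -/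
noncomputable def dualIntegral (Y a b ρ : ℝ) : ℂ := ∫ w in a..b, ee (Y / w + ρ * w)

theorem hasDerivAt_dualPhase (Y ρ : ℝ) {w : ℝ} (hw : w ≠ 0) :
    HasDerivAt (fun w => Y / w + ρ * w) (ρ - Y / w ^ 2) w := by
  have h := ((hasDerivAt_inv hw).const_mul Y).add ((hasDerivAt_id w).const_mul ρ)
  have h2 : (fun w => Y / w + ρ * w) = (fun y => Y * y⁻¹) + fun y => ρ * id y := by
    funext w; simp [div_eq_mul_inv]
  rw [h2]
  exact h.congr_deriv (by field_simp; ring)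

/-- Partial integration against the reciprocal of the phase derivative `ρ - Y / w²`, which decreases
in `w` as long as there is no stationary point. The boundary terms are kept in the first bound
because they cancel between the frequencies `r` and `-r`. -/
theorem norm_dualIntegral_sub_boundary_le {Y a b ρ : ℝ} (hY : 0 ≤ Y) (ha : 0 < a) (hab : a ≤ b)
    (hne : ∀ w ∈ Set.Icc a b, ρ - Y / w ^ 2 ≠ 0) :
    ‖dualIntegral Y a b ρ - (ee (Y / b + ρ * b) * ((ρ - Y / b ^ 2)⁻¹ : ℝ)
      - ee (Y / a + ρ * a) * ((ρ - Y / a ^ 2)⁻¹ : ℝ)) / (2 * Real.pi * Complex.I)‖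
      ≤ |(ρ - Y / b ^ 2)⁻¹ - (ρ - Y / a ^ 2)⁻¹| / (2 * Real.pi) ∧
    ∀ m : ℝ, |(ρ - Y / a ^ 2)⁻¹| ≤ m → |(ρ - Y / b ^ 2)⁻¹| ≤ m →
      ‖dualIntegral Y a b ρ‖ ≤ m := by
  have h0 : ∀ w ∈ Set.Icc a b, w ≠ 0 := fun w hw => (ha.trans_le hw.1).ne'
  have hφ : ∀ t ∈ Set.Icc a b, HasDerivAt (fun w => Y / w + ρ * w) (ρ - Y / t ^ 2) t :=
    fun t ht => hasDerivAt_dualPhase Y ρ (h0 t ht)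
  have hq : ∀ t ∈ Set.Icc a b, HasDerivAt (fun w => (ρ - Y / w ^ 2)⁻¹)
      (-(2 * Y / t ^ 3) / (ρ - Y / t ^ 2) ^ 2) t := by
    intro t ht
    have ht0 := h0 t ht
    have h1 : HasDerivAt (fun w : ℝ => ρ - Y / w ^ 2) (2 * Y / t ^ 3) t := by
      have h2 := (((hasDerivAt_pow 2 t).fun_inv (pow_ne_zero 2 ht0)).const_mul Y).const_sub ρ
      have h3 : (fun w : ℝ => ρ - Y / w ^ 2) = fun w => ρ - Y * (w ^ 2)⁻¹ := by
        funext w; rw [div_eq_mul_inv]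
      rw [h3]
      refine h2.congr_deriv ?_
      field_simp
      ring
    exact h1.fun_inv (hne t ht)
  have hφc : ContinuousOn (fun t => ρ - Y / t ^ 2) (Set.Icc a b) := by
    apply ContinuousOn.sub continuousOn_const
    exact continuousOn_const.div (by fun_prop) fun t ht => pow_ne_zero 2 (h0 t ht)
  have hqc : ContinuousOn (fun t => -(2 * Y / t ^ 3) / (ρ - Y / t ^ 2) ^ 2) (Set.Icc a b) := by
    refine ContinuousOn.div ?_ (hφc.pow 2) fun t ht => pow_ne_zero 2 (hne t ht)
    exact (continuousOn_const.div (by fun_prop) fun t ht => pow_ne_zero 3 (h0 t ht)).neg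
  have hs : ∀ t ∈ Set.Icc a b, -(2 * Y / t ^ 3) / (ρ - Y / t ^ 2) ^ 2 ≤ 0 := by
    intro t ht
    have ht0 : 0 < t := ha.trans_le ht.1
    apply div_nonpos_of_nonpos_of_nonneg _ (by positivity)
    have : 0 ≤ 2 * Y / t ^ 3 := by positivity
    linarith
  have heq : dualIntegral Y a b ρ = ∫ t in a..b, ee (Y / t + ρ * t)
      * (((ρ - Y / t ^ 2) * (ρ - Y / t ^ 2)⁻¹ : ℝ) : ℂ) := by
    refine integral_congr fun t ht => ?_
    rw [Set.uIcc_of_le hab] at ht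
    rw [mul_inv_cancel₀ (hne t ht)]
    simp
  rw [heq]
  exact ⟨norm_integral_ee_sub_boundary_le hab hφ hq hφc hqc (Or.inr hs),
    fun m h1 h2 => norm_integral_ee_le hab hφ hq hφc hqc (Or.inr hs) h1 h2⟩

theorem norm_dualIntegral_neg_le {Y a b r : ℝ} (hY : 0 < Y) (ha : 0 < a) (hab : a ≤ b)
    (hr : 0 ≤ r) : ‖dualIntegral Y a b (-r)‖ ≤ b ^ 2 / Y := by
  have hb := ha.trans_le hab
  have hpos : ∀ w ∈ Set.Icc a b, Y / b ^ 2 ≤ r + Y / w ^ 2 := by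
    intro w hw
    have hw0 := ha.trans_le hw.1
    have : Y / b ^ 2 ≤ Y / w ^ 2 := by gcongr; exact hw.2
    linarith
  have hYb : 0 < Y / b ^ 2 := by positivity
  have hinv : ∀ w ∈ Set.Icc a b, |(-r - Y / w ^ 2)⁻¹| ≤ b ^ 2 / Y := by
    intro w hw
    have h1 := hpos w hw
    rw [abs_inv, show -r - Y / w ^ 2 = -(r + Y / w ^ 2) by ring, abs_neg,
      abs_of_pos (hYb.trans_le h1), show b ^ 2 / Y = (Y / b ^ 2)⁻¹ by rw [inv_div]]
    exact inv_anti₀ hYb h1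
  refine (norm_dualIntegral_sub_boundary_le hY.le ha hab fun w hw => ?_).2 _
    (hinv a ⟨le_rfl, hab⟩) (hinv b ⟨hab, le_rfl⟩)
  have := hpos w hw
  intro h
  linarith

/-- The slope `Y / w²` is at least `Y / b²`, so a frequency below half of that leaves a phase
derivative of at least `Y / b² / 2` in absolute value. -/
theorem norm_dualIntegral_le_of_small {Y a b r : ℝ} (hY : 0 < Y) (ha : 0 < a) (hab : a ≤ b)
    (hr : r ≤ Y / b ^ 2 / 2) : ‖dualIntegral Y a b r‖ ≤ 2 * (b ^ 2 / Y) := by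
  have hb := ha.trans_le hab
  have hYb : 0 < Y / b ^ 2 := by positivity
  have hpos : ∀ w ∈ Set.Icc a b, Y / b ^ 2 / 2 ≤ Y / w ^ 2 - r := by
    intro w hw
    have hw0 := ha.trans_le hw.1
    have : Y / b ^ 2 ≤ Y / w ^ 2 := by gcongr; exact hw.2
    linarith
  have hinv : ∀ w ∈ Set.Icc a b, |(r - Y / w ^ 2)⁻¹| ≤ 2 * (b ^ 2 / Y) := by
    intro w hw
    have h1 := hpos w hw
    rw [abs_inv, abs_sub_comm, abs_of_pos (by linarith),
      show 2 * (b ^ 2 / Y) = (Y / b ^ 2 / 2)⁻¹ by field_simp]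
    exact inv_anti₀ (by linarith) h1
  refine (norm_dualIntegral_sub_boundary_le hY.le ha hab fun w hw => ?_).2 _
    (hinv a ⟨le_rfl, hab⟩) (hinv b ⟨hab, le_rfl⟩)
  have := hpos w hw
  intro h
  linarith

theorem inv_sub_bounds {r s S : ℝ} (hs : 0 ≤ s) (hsS : s ≤ S) (hr : 0 < r) (hrS : 2 * S ≤ r) :
    1 / r ≤ (r - s)⁻¹ ∧ (r - s)⁻¹ ≤ 1 / r + 2 * S / r ^ 2 ∧
    1 / r - S / r ^ 2 ≤ (r + s)⁻¹ ∧ (r + s)⁻¹ ≤ 1 / r := by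
  have h1 : 0 < r - s := by linarith
  refine ⟨?_, ?_, ?_, ?_⟩
  · rw [← one_div]; exact one_div_le_one_div_of_le h1 (by linarith)
  · rw [inv_le_iff_one_le_mul₀ h1]
    have e : (1 / r + 2 * S / r ^ 2) * (r - s) = 1 + (2 * S * (r - s) - s * r) / r ^ 2 := by
      field_simp; ring
    rw [e]
    have : 0 ≤ (2 * S * (r - s) - s * r) / r ^ 2 := by
      apply div_nonneg _ (by positivity)
      nlinarith
    linarith
  · rw [← one_div, le_div_iff₀ (by linarith)]
    have e : (1 / r - S / r ^ 2) * (r + s) = 1 - (S * (r + s) - s * r) / r ^ 2 := by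
      field_simp; ring
    rw [e]
    have : 0 ≤ (S * (r + s) - s * r) / r ^ 2 := by
      apply div_nonneg _ (by positivity)
      nlinarith
    linarith
  · rw [← one_div]; exact one_div_le_one_div_of_le hr (by linarith)

/-- Separately these integrals decay only like `1 / r`, which is not summable. At endpoints
congruent to `c` modulo 1 the frequencies `r` and `-r` have the same phase, and their boundary terms
of order `1 / r` cancel. What remains is of order `(Y / a²) / r²`. -/
theorem norm_dualIntegral_pair_le {Y a b r c : ℝ} (hY : 0 < Y) (ha : 0 < a) (hab : a ≤ b)
    (hr : 0 < r) (hrS : 2 * (Y / a ^ 2) ≤ r)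
    (hca : ee (r * (a - c)) = 1) (hcb : ee (r * (b - c)) = 1) :
    ‖ee (-(r * c)) * dualIntegral Y a b r + ee (r * c) * dualIntegral Y a b (-r)‖
      ≤ 2 * (Y / a ^ 2) / r ^ 2 := by
  have hb := ha.trans_le hab
  set S := Y / a ^ 2 with hS
  have hS0 : 0 < S := by positivity
  have hs : ∀ w ∈ Set.Icc a b, 0 ≤ Y / w ^ 2 ∧ Y / w ^ 2 ≤ S := by
    intro w hw
    have hw0 := ha.trans_le hw.1
    refine ⟨by positivity, ?_⟩
    rw [hS]
    gcongr
    exact hw.1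
  have h1 := (norm_dualIntegral_sub_boundary_le (ρ := r) hY.le ha hab fun w hw => by
    have := hs w hw
    intro h
    linarith).1
  have h2 := (norm_dualIntegral_sub_boundary_le (ρ := -r) hY.le ha hab fun w hw => by
    have := hs w hw
    intro h
    linarith).1
  have hsb := hs b ⟨hab, le_rfl⟩
  obtain ⟨b1, b2, b3, b4⟩ := inv_sub_bounds hsb.1 hsb.2 hr hrS
  obtain ⟨a1, a2, a3, a4⟩ := inv_sub_bounds hS0.le le_rfl hr hrS
  have nb : (-r - Y / b ^ 2)⁻¹ = -(r + Y / b ^ 2)⁻¹ := by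
    rw [← inv_neg]; congr 1; ring
  have na : (-r - S)⁻¹ = -(r + S)⁻¹ := by
    rw [← inv_neg]; congr 1; ring
  rw [nb, na] at h2
  have ph : ∀ w, ee (r * (w - c)) = 1 → ee (-(r * c)) * ee (Y / w + r * w) = ee (Y / w) ∧
      ee (r * c) * ee (Y / w + -r * w) = ee (Y / w) := by
    intro w hw
    constructor
    · rw [← ee_add, show -(r * c) + (Y / w + r * w) = Y / w + r * (w - c) by ring, ee_add, hw,
        mul_one]
    · have hw' : ee (-(r * (w - c))) = 1 := by rw [ee_neg, hw, map_one]
      rw [← ee_add, show r * c + (Y / w + -r * w) = Y / w + -(r * (w - c)) by ring, ee_add, hw',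
        mul_one]
  obtain ⟨pa, pa'⟩ := ph a hca
  obtain ⟨pb, pb'⟩ := ph b hcb
  set X₁ := dualIntegral Y a b r
  set X₂ := dualIntegral Y a b (-r)
  set qb := (r - Y / b ^ 2)⁻¹
  set qa := (r - S)⁻¹
  set tb := (r + Y / b ^ 2)⁻¹
  set ta := (r + S)⁻¹
  set Z₁ := (ee (Y / b + r * b) * (qb : ℂ) - ee (Y / a + r * a) * (qa : ℂ))
    / (2 * Real.pi * Complex.I)
  set Z₂ := (ee (Y / b + -r * b) * ((-tb : ℝ) : ℂ) - ee (Y / a + -r * a) * ((-ta : ℝ) : ℂ))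
    / (2 * Real.pi * Complex.I)
  have hZ : ee (-(r * c)) * Z₁ + ee (r * c) * Z₂
      = (ee (Y / b) * ((qb - tb : ℝ) : ℂ) - ee (Y / a) * ((qa - ta : ℝ) : ℂ))
        / (2 * Real.pi * Complex.I) := by
    have e1 : ee (-(r * c)) * Z₁ + ee (r * c) * Z₂
      = ((ee (-(r * c)) * ee (Y / b + r * b)) * (qb : ℂ)
        - (ee (-(r * c)) * ee (Y / a + r * a)) * (qa : ℂ)
        + ((ee (r * c) * ee (Y / b + -r * b)) * ((-tb : ℝ) : ℂ)
        - (ee (r * c) * ee (Y / a + -r * a)) * ((-ta : ℝ) : ℂ))) / (2 * Real.pi * Complex.I) := by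
      simp only [Z₁, Z₂]; ring
    rw [e1, pa, pb, pa', pb']
    push_cast
    ring
  have hsplit : ee (-(r * c)) * X₁ + ee (r * c) * X₂
      = ee (-(r * c)) * (X₁ - Z₁) + ee (r * c) * (X₂ - Z₂)
        + (ee (-(r * c)) * Z₁ + ee (r * c) * Z₂) := by ring
  have hpi := Real.pi_gt_three
  set T := S / r ^ 2 with hT
  have hT0 : 0 < T := by positivity
  have eT : 2 * S / r ^ 2 = 2 * T := by rw [hT]; ring
  rw [eT] at b2 a2 ⊢
  rw [hsplit]
  have n1 : ‖ee (-(r * c)) * (X₁ - Z₁)‖ ≤ 2 * T / (2 * Real.pi) := by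
    rw [norm_mul, norm_ee, one_mul]
    refine h1.trans ?_
    gcongr
    rw [abs_le]
    constructor <;> linarith
  have n2 : ‖ee (r * c) * (X₂ - Z₂)‖ ≤ T / (2 * Real.pi) := by
    rw [norm_mul, norm_ee, one_mul]
    refine h2.trans ?_
    gcongr
    rw [abs_le]
    constructor <;> linarith
  have n3 : ‖ee (-(r * c)) * Z₁ + ee (r * c) * Z₂‖ ≤ (3 * T + 3 * T) / (2 * Real.pi) := by
    rw [hZ, norm_div, norm_two_pi_I]
    gcongr
    refine (norm_sub_le _ _).trans ?_
    rw [norm_mul, norm_mul, norm_ee, norm_ee, Complex.norm_real, Complex.norm_real, one_mul,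
      one_mul, Real.norm_eq_abs, Real.norm_eq_abs]
    apply add_le_add <;> rw [abs_le] <;> constructor <;> linarith
  refine (norm_add_le _ _).trans ((add_le_add ((norm_add_le _ _).trans (add_le_add n1 n2))
    n3).trans ?_)
  rw [← add_div, ← add_div, div_le_iff₀ (by positivity)]
  nlinarith

/-- Compared with the telescoping sum of `1 / r - 1 / (r + 1)`. -/
theorem sum_range_one_div_sq_le {R : ℕ} (hR : 0 < R) (K : ℕ) :
    ∑ r ∈ Finset.Ico R K, (1 : ℝ) / ((r + 1 : ℕ) : ℝ) ^ 2 ≤ 1 / R := by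
  rcases le_or_gt K R with h | h
  · rw [Finset.Ico_eq_empty_of_le h]; simp
  suffices h2 : ∑ r ∈ Finset.Ico R K, (1 : ℝ) / ((r + 1 : ℕ) : ℝ) ^ 2 ≤ 1 / R - 1 / K by
    have : (0 : ℝ) ≤ 1 / K := by positivity
    linarith
  induction K, h.le using Nat.le_induction with
  | base => simp
  | succ K hK ih =>
    rw [Finset.sum_Ico_succ_top hK]
    have h1 : ∑ r ∈ Finset.Ico R K, (1 : ℝ) / ((r + 1 : ℕ) : ℝ) ^ 2 ≤ 1 / R - 1 / K := by
      rcases hK.eq_or_lt with rfl | h3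
      · simp
      · exact ih h3
    have hK0 : (0 : ℝ) < K := by exact_mod_cast hR.trans_le hK
    have h2 : (1 : ℝ) / ((K + 1 : ℕ) : ℝ) ^ 2 ≤ 1 / K - 1 / ((K + 1 : ℕ) : ℝ) := by
      push_cast
      rw [div_sub_div _ _ hK0.ne' (by positivity), div_le_div_iff₀ (by positivity) (by positivity)]
      nlinarith
    linarith

/-- Poisson summation for `u ↦ e(Y / (u + α))`; the substitution `w = u + α` takes the shift out of
the phase as a factor `e(∓rα)`. -/
theorem hasSum_dualIntegral {Y α : ℝ} (hα : 0 ≤ α) {A B : ℕ} (hA : 0 < A) (hAB : A ≤ B) :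
    HasSum (fun r : ℕ => ee (-((r + 1 : ℕ) * α)) * dualIntegral Y (A + α) (B + α) (r + 1 : ℕ)
        + ee ((r + 1 : ℕ) * α) * dualIntegral Y (A + α) (B + α) (-(r + 1 : ℕ)))
      (∑ n ∈ Finset.Ioc A B, ee (Y / (n + α)) + (ee (Y / (A + α)) - ee (Y / (B + α))) / 2
        - dualIntegral Y (A + α) (B + α) 0) := by
  have hA0 : (0 : ℝ) < A := by exact_mod_cast hA
  have h0 : ∀ t ∈ Set.Icc (A : ℝ) B, t + α ≠ 0 := fun t ht => by
    have h1 : 0 < t := hA0.trans_le ht.1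
    exact ne_of_gt (by linarith)
  set F : ℝ → ℂ := fun u => ee (Y / (u + α)) with hFdef
  set F' : ℝ → ℂ := fun u => 2 * Real.pi * Complex.I * ((-(Y / (u + α) ^ 2) : ℝ) : ℂ) * F u
    with hF'def
  set F'' : ℝ → ℂ := fun u => 2 * Real.pi * Complex.I * ((2 * Y / (u + α) ^ 3 : ℝ) : ℂ) * F u
    + 2 * Real.pi * Complex.I * ((-(Y / (u + α) ^ 2) : ℝ) : ℂ) * F' u with hF''def
  have hlin : ∀ t : ℝ, HasDerivAt (fun u : ℝ => u + α) 1 t := fun t =>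
    (hasDerivAt_id t).add_const α
  have hF : ∀ t ∈ Set.Icc (A : ℝ) B, HasDerivAt F (F' t) t := by
    intro t ht
    refine hasDerivAt_ee ?_
    have h1 := ((hlin t).fun_inv (h0 t ht)).const_mul Y
    have h2 : (fun u => Y / (u + α)) = fun u => Y * (u + α)⁻¹ := by
      funext u; rw [div_eq_mul_inv]
    rw [h2]
    exact h1.congr_deriv (by ring)
  have hF' : ∀ t ∈ Set.Icc (A : ℝ) B, HasDerivAt F' (F'' t) t := by
    intro t ht
    have h1 : HasDerivAt (fun u => -(Y / (u + α) ^ 2)) (2 * Y / (t + α) ^ 3) t := by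
      have h2 := ((((hlin t).fun_pow 2).fun_inv (pow_ne_zero 2 (h0 t ht))).const_mul Y).fun_neg
      have h3 : (fun u => -(Y / (u + α) ^ 2)) = fun u => -(Y * ((u + α) ^ 2)⁻¹) := by
        funext u; rw [div_eq_mul_inv]
      rw [h3]
      refine h2.congr_deriv ?_
      have := h0 t ht
      field_simp
      ring
    exact (h1.ofReal_comp.const_mul (2 * Real.pi * Complex.I)).mul (hF t ht)
  have hFc : ContinuousOn F (Set.Icc A B) := fun t ht => (hF t ht).continuousAt.continuousWithinAt
  have hFc' : ContinuousOn F' (Set.Icc A B) :=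
    fun t ht => (hF' t ht).continuousAt.continuousWithinAt
  have hF'' : ContinuousOn F'' (Set.Icc A B) := by
    have c1 : ContinuousOn (fun u => 2 * Y / (u + α) ^ 3) (Set.Icc (A : ℝ) B) :=
      continuousOn_const.div (by fun_prop) fun t ht => pow_ne_zero 3 (h0 t ht)
    have c2 : ContinuousOn (fun u => -(Y / (u + α) ^ 2)) (Set.Icc (A : ℝ) B) :=
      (continuousOn_const.div (by fun_prop) fun t ht => pow_ne_zero 2 (h0 t ht)).neg
    exact ((continuousOn_const.mul (Complex.continuous_ofReal.comp_continuousOn c1)).mul hFc).add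
      ((continuousOn_const.mul (Complex.continuous_ofReal.comp_continuousOn c2)).mul hFc')
  have hdual : ∀ k : ℝ, ∫ u in (A : ℝ)..B, F u * ee (k * u)
      = ee (-(k * α)) * dualIntegral Y (A + α) (B + α) k := by
    intro k
    rw [dualIntegral, ← integral_comp_add_right (fun w => ee (Y / w + k * w)) α,
      ← integral_const_mul]
    refine integral_congr fun u _ => ?_
    simp only [hFdef]
    rw [← ee_add, ← ee_add]
    congr 1
    ring
  have h := hasSum_poisson hAB hF hF' hF''
  have h1 : ∫ u in (A : ℝ)..B, F u = dualIntegral Y (A + α) (B + α) 0 := by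
    have := hdual 0
    simpa [ee_zero] using this
  rw [h1] at h
  convert h using 1
  funext r
  rw [hdual]
  have := hdual (-((r + 1 : ℕ) : ℝ))
  simp only [neg_mul, neg_neg] at this
  rw [this]

theorem norm_hasSum_sub_le {f : ℕ → ℂ} {T : ℂ} (hf : HasSum f T) {R : ℕ} (hR : 0 < R) {c : ℝ}
    (hc : 0 ≤ c) (h : ∀ r, R ≤ r → ‖f r‖ ≤ c * (1 / ((r + 1 : ℕ) : ℝ) ^ 2)) :
    ‖T - ∑ r ∈ Finset.range R, f r‖ ≤ c / R := by
  have h1 := (hf.tendsto_sum_nat.sub_const (∑ r ∈ Finset.range R, f r)).norm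
  refine le_of_tendsto h1 (Filter.eventually_atTop.2 ⟨R, fun K hK => ?_⟩)
  rw [← Finset.sum_Ico_eq_sub _ hK]
  refine (norm_sum_le _ _).trans ((Finset.sum_le_sum fun r hr =>
    h r (Finset.mem_Ico.1 hr).1).trans ?_)
  rw [← Finset.mul_sum, div_eq_mul_one_div c]
  exact mul_le_mul_of_nonneg_left (sum_range_one_div_sq_le hR K) hc

/-- The dual form of the exponential sum with phase `Y / (n + α)`, up to a bounded error. -/
theorem norm_sum_ee_le_dual {J : ℕ} (hJ : 2 ≤ J) {Y α : ℝ} (hα0 : 0 ≤ α) (hα1 : α ≤ 1)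
    (hY : (J : ℝ) ^ 2 ≤ Y) :
    ‖∑ n ∈ Finset.Ioc (J / 2) J, ee (Y / (n + α))‖ ≤ 143
      + ‖∑ r ∈ Finset.Ioc ⌊Y / (J + α) ^ 2 / 2⌋₊ ⌈2 * (Y / ((J / 2 : ℕ) + α) ^ 2)⌉₊,
        ee (-(r * α)) * dualIntegral Y ((J / 2 : ℕ) + α) (J + α) r‖ := by
  set A := J / 2 with hAdef
  have hA : 0 < A := by omega
  have hAJ : A ≤ J := by omega
  have hA4 : (J : ℝ) / 4 ≤ A := by
    have : J ≤ 4 * A := by omega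
    have h2 : (J : ℝ) ≤ 4 * A := by exact_mod_cast this
    linarith
  have hJ2 : (2 : ℝ) ≤ J := by exact_mod_cast hJ
  set a := (A : ℝ) + α with ha
  set b := (J : ℝ) + α with hb
  have ha4 : (J : ℝ) / 4 ≤ a := by rw [ha]; linarith
  have hb2 : b ≤ 2 * J := by rw [hb]; linarith
  have ha0 : 0 < a := by linarith
  have hab : a ≤ b := by
    have : (A : ℝ) ≤ J := by exact_mod_cast hAJ
    rw [ha, hb]; linarith
  have hb0 := ha0.trans_le hab
  have hY0 : 0 < Y := lt_of_lt_of_le (by positivity) hY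
  set S := Y / a ^ 2 with hS
  have hS0 : 0 < S := by positivity
  set s := Y / b ^ 2 with hs
  have hs0 : 0 < s := by positivity
  set R := ⌈2 * S⌉₊ with hR
  set r₀ := ⌊s / 2⌋₊ with hr₀
  have hsS : s ≤ S := by rw [hs, hS]; gcongr
  have hRS : 2 * S ≤ R := Nat.le_ceil _
  have hRS' : (R : ℝ) ≤ 2 * S + 1 := (Nat.ceil_lt_add_one (by positivity)).le
  have hR0 : 0 < R := Nat.ceil_pos.2 (by positivity)
  have hr₀s : (r₀ : ℝ) ≤ s / 2 := Nat.floor_le (by positivity)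
  have hr₀R : r₀ ≤ R := by
    have : (r₀ : ℝ) ≤ R := by linarith
    exact_mod_cast this
  -- The hypothesis `J² ≤ Y` makes the slopes at least a positive constant. Hence each nonstationary
  -- integral is bounded, and the number of frequencies times the bound for one stays bounded too.
  have hbY : b ^ 2 / Y ≤ 4 := by
    rw [div_le_iff₀ hY0]
    nlinarith
  have hba : S * (b ^ 2 / Y) ≤ 64 := by
    have : S * (b ^ 2 / Y) = (b / a) ^ 2 := by rw [hS]; field_simp
    rw [this]
    have h1 : b / a ≤ 8 := by rw [div_le_iff₀ ha0]; linarith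
    calc (b / a) ^ 2 ≤ 8 ^ 2 := by gcongr
      _ = 64 := by norm_num
  have hsb : s * (b ^ 2 / Y) = 1 := by rw [hs]; field_simp
  have hsum := hasSum_dualIntegral (Y := Y) hα0 hA hAJ
  rw [← ha, ← hb] at hsum
  set I := dualIntegral Y a b with hI
  have htail := norm_hasSum_sub_le hsum hR0 (c := 2 * S) (by positivity) (fun r hr => by
    have hrR : (R : ℝ) ≤ r := by exact_mod_cast hr
    refine (norm_dualIntegral_pair_le (r := ((r + 1 : ℕ) : ℝ)) hY0 ha0 hab (by positivity) ?_ ?_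
      ?_).trans ?_
    · push_cast; rw [← hS]; linarith
    · rw [ha, add_sub_cancel_right]
      have := ee_nat ((r + 1) * A)
      push_cast at this ⊢
      exact this
    · rw [hb, add_sub_cancel_right]
      have := ee_nat ((r + 1) * J)
      push_cast at this ⊢
      exact this
    · rw [← hS, div_eq_mul_one_div])
  have htail1 : 2 * S / R ≤ 1 := by
    rw [div_le_one (by exact_mod_cast hR0)]
    exact hRS
  -- Only frequencies in `(r₀, R]` can be stationary. The others are those up to half the least
  -- slope and the negative ones; beyond `R`, twice the greatest slope, the paired estimate has
  -- already bounded the tail.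
  have hshift : ∑ r ∈ Finset.range R, (ee (-((r + 1 : ℕ) * α)) * I (r + 1 : ℕ)
        + ee ((r + 1 : ℕ) * α) * I (-(r + 1 : ℕ)))
      = ∑ r ∈ Finset.Ioc r₀ R, ee (-(r * α)) * I r + (∑ r ∈ Finset.Ioc 0 r₀, ee (-(r * α)) * I r
        + ∑ r ∈ Finset.Ioc 0 R, ee (r * α) * I (-r)) := by
    have e : ∀ g : ℕ → ℂ, ∑ r ∈ Finset.range R, g (r + 1) = ∑ r ∈ Finset.Ioc 0 R, g r := by
      intro g
      clear_value R
      clear * -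
      induction R with
      | zero => simp
      | succ R ih => rw [Finset.sum_range_succ, ih, Finset.sum_Ioc_succ_top (Nat.zero_le R)]
    rw [e (fun r => ee (-((r : ℕ) * α)) * I (r : ℕ) + ee ((r : ℕ) * α) * I (-(r : ℕ))),
      Finset.sum_add_distrib, ← Finset.sum_Ioc_consecutive _ (Nat.zero_le r₀) hr₀R]
    ring
  rw [hshift] at htail
  have hn1 : ‖∑ r ∈ Finset.Ioc 0 r₀, ee (-(r * α)) * I r‖ ≤ 1 := by
    refine (norm_sum_le_of_le _ (n := fun _ => 2 * (b ^ 2 / Y)) fun r hr => ?_).trans ?_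
    · rw [norm_mul, norm_ee, one_mul]
      refine norm_dualIntegral_le_of_small hY0 ha0 hab ?_
      have : (r : ℝ) ≤ r₀ := by exact_mod_cast (Finset.mem_Ioc.1 hr).2
      linarith
    · rw [Finset.sum_const, Nat.card_Ioc, nsmul_eq_mul, Nat.sub_zero]
      have : (r₀ : ℝ) * (2 * (b ^ 2 / Y)) ≤ s / 2 * (2 * (b ^ 2 / Y)) := by gcongr
      linarith
  have hn2 : ‖∑ r ∈ Finset.Ioc 0 R, ee (r * α) * I (-r)‖ ≤ 132 := by
    refine (norm_sum_le_of_le _ (n := fun _ => b ^ 2 / Y) fun r hr => ?_).trans ?_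
    · rw [norm_mul, norm_ee, one_mul]
      exact norm_dualIntegral_neg_le hY0 ha0 hab (Nat.cast_nonneg r)
    · rw [Finset.sum_const, Nat.card_Ioc, nsmul_eq_mul, Nat.sub_zero]
      have : (R : ℝ) * (b ^ 2 / Y) ≤ (2 * S + 1) * (b ^ 2 / Y) := by gcongr
      linarith
  have hn3 : ‖I 0‖ ≤ 8 := by
    refine (norm_dualIntegral_le_of_small hY0 ha0 hab (by positivity)).trans ?_
    linarith
  have hn4 : ‖(ee (Y / a) - ee (Y / b)) / 2‖ ≤ 1 := by
    rw [norm_div]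
    have := norm_sub_le (ee (Y / a)) (ee (Y / b))
    rw [norm_ee, norm_ee] at this
    norm_num
    linarith
  -- `143 = 1 + 1 + 132 + 8 + 1`: tail, low frequencies, negative frequencies, frequency zero,
  -- half-weights at the endpoints.
  have hfin : ∀ W D X₁ X₂ X₃ X₄ : ℂ,
      ‖W + X₄ - X₃ - (D + (X₁ + X₂))‖ ≤ 1 → ‖X₁‖ ≤ 1 → ‖X₂‖ ≤ 132 → ‖X₃‖ ≤ 8 → ‖X₄‖ ≤ 1 →
      ‖W‖ ≤ 143 + ‖D‖ := by
    intro W D X₁ X₂ X₃ X₄ h h1 h2 h3 h4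
    have e : W = (W + X₄ - X₃ - (D + (X₁ + X₂))) + (D + (X₁ + X₂) + (X₃ - X₄)) := by ring
    rw [e]
    have t1 := norm_add_le (W + X₄ - X₃ - (D + (X₁ + X₂))) (D + (X₁ + X₂) + (X₃ - X₄))
    have t2 := norm_add_le (D + (X₁ + X₂)) (X₃ - X₄)
    have t3 := norm_add_le D (X₁ + X₂)
    have t4 := norm_add_le X₁ X₂
    have t5 := norm_sub_le X₃ X₄
    linarith
  exact hfin _ _ _ _ _ _ (htail.trans htail1) hn1 hn2 hn3 hn4

/-! ### Fresnel integrals and stationary phase -/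

/-- The Fresnel integral `∫₀ᵛ e(x²) dx`. -/
noncomputable def fresnel (v : ℝ) : ℂ := ∫ x in (0 : ℝ)..v, ee (x ^ 2)

theorem continuous_ee_sq : Continuous fun x : ℝ => ee (x ^ 2) := continuous_ee.comp (by fun_prop)

theorem fresnel_sub (x y : ℝ) : fresnel y - fresnel x = ∫ v in x..y, ee (v ^ 2) :=
  integral_interval_sub_left (continuous_ee_sq.intervalIntegrable _ _)
    (continuous_ee_sq.intervalIntegrable _ _)

theorem fresnel_neg (v : ℝ) : fresnel (-v) = -fresnel v := by
  have h := integral_comp_neg (a := (0 : ℝ)) (b := v) fun x => ee (x ^ 2)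
  simp only [neg_sq, neg_zero] at h
  rw [fresnel, fresnel, h, integral_symm]

/-- Partial integration with phase derivative `2v` and weight `1 / (2v)`. -/
theorem norm_fresnel_sub_le {x y : ℝ} (hx : 0 < x) (hxy : x ≤ y) :
    ‖fresnel y - fresnel x‖ ≤ 1 / (2 * x) := by
  have h0 : ∀ t ∈ Set.Icc x y, t ≠ 0 := fun t ht => (hx.trans_le ht.1).ne'
  have heq : ∫ v in x..y, ee (v ^ 2) = ∫ v in x..y, ee (v ^ 2) * ((2 * v * (1 / 2 * v⁻¹) : ℝ) : ℂ) := by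
    refine integral_congr fun t ht => ?_
    rw [Set.uIcc_of_le hxy] at ht
    have : 2 * t * (1 / 2 * t⁻¹) = 1 := by have := h0 t ht; field_simp
    simp only [this]
    simp
  rw [fresnel_sub, heq]
  have hy := hx.trans_le hxy
  refine norm_integral_ee_le hxy (φ := fun v => v ^ 2) (φ' := fun v => 2 * v)
    (q := fun v => 1 / 2 * v⁻¹) (q' := fun v => 1 / 2 * (-(v ^ 2)⁻¹)) ?_ ?_ (by fun_prop) ?_
    (Or.inr ?_) ?_ ?_
  · intro t _
    simpa using hasDerivAt_pow 2 t
  · intro t ht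
    exact (hasDerivAt_inv (h0 t ht)).const_mul _
  · exact continuousOn_const.mul (ContinuousOn.inv₀ (by fun_prop)
      fun t ht => pow_ne_zero 2 (h0 t ht)).neg
  · intro t _
    have : 0 ≤ (t ^ 2)⁻¹ := by positivity
    linarith
  · rw [abs_of_pos (by positivity), ← one_div, div_mul_div_comm, one_mul]
  · rw [abs_of_pos (by positivity), ← one_div, div_mul_div_comm, one_mul]
    gcongr

theorem norm_fresnel_le {v : ℝ} (hv : 0 ≤ v) : ‖fresnel v‖ ≤ 2 := by
  have h1 : ∀ x : ℝ, 0 ≤ x → x ≤ 1 → ‖fresnel x‖ ≤ 1 := by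
    intro x h0 h1
    have := norm_integral_le_of_norm_le_const (a := 0) (b := x) (C := 1)
      (f := fun x : ℝ => ee (x ^ 2)) fun x _ => (norm_ee _).le
    rw [sub_zero, abs_of_nonneg h0, one_mul] at this
    exact this.trans h1
  rcases le_total v 1 with h | h
  · exact (h1 v hv h).trans (by norm_num)
  · have h2 := norm_fresnel_sub_le one_pos h
    have h3 := norm_add_le (fresnel v - fresnel 1) (fresnel 1)
    rw [sub_add_cancel] at h3
    have := h1 1 zero_le_one le_rfl
    linarith

/-- A finite `V` beyond all arguments in use plays the role of infinity, so the complete Fresnel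
integral need not be evaluated; oddness covers negative `v`. -/
theorem norm_fresnel_sub_sign_le {v V : ℝ} (hv : |v| ≤ V) {σ : ℝ}
    (hσ : 0 < v ∧ σ = 1 ∨ v ≤ 0 ∧ σ = -1) :
    ‖fresnel v - σ * fresnel V‖ ≤ 4 ∧ (v ≠ 0 → ‖fresnel v - σ * fresnel V‖ ≤ 1 / (2 * |v|)) := by
  have key : ∀ u : ℝ, 0 ≤ u → u ≤ V → ‖fresnel u - fresnel V‖ ≤ 4 ∧
      (u ≠ 0 → ‖fresnel u - fresnel V‖ ≤ 1 / (2 * u)) := by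
    intro u hu huV
    constructor
    · have := norm_sub_le (fresnel u) (fresnel V)
      linarith [norm_fresnel_le hu, norm_fresnel_le (hu.trans huV)]
    · intro h
      rw [norm_sub_rev]
      exact norm_fresnel_sub_le (lt_of_le_of_ne hu (Ne.symm h)) huV
  rcases hσ with ⟨h, rfl⟩ | ⟨h, rfl⟩
  · rw [abs_of_pos h] at hv ⊢
    have := key v h.le hv
    simpa using this
  · rw [abs_of_nonpos h] at hv ⊢
    have := key (-v) (by linarith) hv
    have e : fresnel v - ((-1 : ℝ) : ℂ) * fresnel V = -(fresnel (-v) - fresnel V) := by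
      rw [fresnel_neg]; push_cast; ring
    rw [e, norm_neg]
    refine ⟨this.1, fun h0 => this.2 (by simpa using h0)⟩

/-- The amplitude of the stationary phase term of the dual integral. -/
noncomputable def dualAmplitude (Y r : ℝ) : ℝ := Y ^ (1 / 4 : ℝ) * r ^ (-(3 / 4) : ℝ)

/-- The phase is `2P + v²` with `v = √P (t - 1/t)`, and `dv = √P (1 + t⁻²) dt`. Replacing the weight
`2t` by `1 + t⁻²` therefore gives Fresnel integrals exactly. The difference of the weights vanishes
at the stationary point `t = 1`, so it is the phase derivative times a smooth function and partial
integration applies. -/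
theorem saddle_integral {P t₁ t₂ : ℝ} (hP : 0 < P) (ht₁ : 0 < t₁) (ht : t₁ ≤ t₂) :
    ‖(∫ t in t₁..t₂, ee (P * (t ^ 2 + (t ^ 2)⁻¹)) * ((2 * t : ℝ) : ℂ))
      - ((√P)⁻¹ : ℝ) * ee (2 * P) * (fresnel (√P * (t₂ - t₂⁻¹)) - fresnel (√P * (t₁ - t₁⁻¹)))‖
      ≤ 1 / P := by
  have h0 : ∀ t ∈ Set.Icc t₁ t₂, t ≠ 0 := fun t h => (ht₁.trans_le h.1).ne'
  have hp : ∀ t ∈ Set.Icc t₁ t₂, 0 < t := fun t h => ht₁.trans_le h.1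
  have hu : Set.uIcc t₁ t₂ = Set.Icc t₁ t₂ := Set.uIcc_of_le ht
  have hsP : 0 < √P := Real.sqrt_pos.2 hP
  have hsub : ∀ t ∈ Set.Icc t₁ t₂, HasDerivAt (fun t : ℝ => t - t⁻¹) (1 + (t ^ 2)⁻¹) t := by
    intro t h
    exact ((hasDerivAt_id t).sub (hasDerivAt_inv (h0 t h))).congr_deriv (by ring)
  have hφ : ∀ t ∈ Set.Icc t₁ t₂, HasDerivAt (fun t : ℝ => P * (t - t⁻¹) ^ 2)
      (P * (2 * (t - t⁻¹) * (1 + (t ^ 2)⁻¹))) t := by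
    intro t h
    exact (((hsub t h).fun_pow 2).const_mul P).congr_deriv (by simp)
  have hcinv : ContinuousOn (fun t : ℝ => (t ^ 2)⁻¹) (Set.Icc t₁ t₂) :=
    ContinuousOn.inv₀ (by fun_prop) fun t h => pow_ne_zero 2 (h0 t h)
  have hcinv1 : ContinuousOn (fun t : ℝ => t⁻¹) (Set.Icc t₁ t₂) :=
    ContinuousOn.inv₀ (by fun_prop) fun t h => h0 t h
  have hcsub : ContinuousOn (fun t : ℝ => t - t⁻¹) (Set.Icc t₁ t₂) :=
    continuousOn_id.sub hcinv1
  have hcw : ContinuousOn (fun t : ℝ => 1 + (t ^ 2)⁻¹) (Set.Icc t₁ t₂) :=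
    continuousOn_const.add hcinv
  have hce : ContinuousOn (fun t : ℝ => ee (P * (t - t⁻¹) ^ 2)) (Set.Icc t₁ t₂) :=
    continuous_ee.comp_continuousOn (continuousOn_const.mul (hcsub.pow 2))
  have hfres : fresnel (√P * (t₂ - t₂⁻¹)) - fresnel (√P * (t₁ - t₁⁻¹))
      = ∫ t in t₁..t₂, ee (P * (t - t⁻¹) ^ 2) * ((√P * (1 + (t ^ 2)⁻¹) : ℝ) : ℂ) := by
    rw [fresnel_sub]
    rw [← integral_deriv_smul_comp' (a := t₁) (b := t₂) (f := fun t => √P * (t - t⁻¹))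
      (f' := fun t => √P * (1 + (t ^ 2)⁻¹)) (g := fun x => ee (x ^ 2))
      (fun t h => (hsub t (hu ▸ h)).const_mul √P) (by rw [hu]; exact continuousOn_const.mul hcw)
      continuous_ee_sq.continuousOn]
    refine integral_congr fun t _ => ?_
    simp only [Function.comp_apply]
    rw [mul_pow, Real.sq_sqrt hP.le, Complex.real_smul, mul_comm]
  have hmain : (∫ t in t₁..t₂, ee (P * (t ^ 2 + (t ^ 2)⁻¹)) * ((2 * t : ℝ) : ℂ))
      = ee (2 * P) * ∫ t in t₁..t₂, ee (P * (t - t⁻¹) ^ 2) * ((2 * t : ℝ) : ℂ) := by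
    rw [← integral_const_mul]
    refine integral_congr fun t h => ?_
    rw [hu] at h
    have := h0 t h
    rw [← mul_assoc, ← ee_add]
    congr 2
    field_simp
    ring
  have hi1 : IntervalIntegrable (fun t => ee (P * (t - t⁻¹) ^ 2) * ((2 * t : ℝ) : ℂ))
      MeasureTheory.volume t₁ t₂ := by
    apply ContinuousOn.intervalIntegrable
    rw [hu]
    exact hce.mul (Complex.continuous_ofReal.comp_continuousOn (by fun_prop))
  have hi2 : IntervalIntegrable (fun t => ee (P * (t - t⁻¹) ^ 2) * ((1 + (t ^ 2)⁻¹ : ℝ) : ℂ))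
      MeasureTheory.volume t₁ t₂ := by
    apply ContinuousOn.intervalIntegrable
    rw [hu]
    exact hce.mul (Complex.continuous_ofReal.comp_continuousOn hcw)
  have hfres2 : ((√P)⁻¹ : ℝ) * (∫ t in t₁..t₂, ee (P * (t - t⁻¹) ^ 2)
        * ((√P * (1 + (t ^ 2)⁻¹) : ℝ) : ℂ))
      = ∫ t in t₁..t₂, ee (P * (t - t⁻¹) ^ 2) * ((1 + (t ^ 2)⁻¹ : ℝ) : ℂ) := by
    rw [← integral_const_mul]
    refine integral_congr fun t _ => ?_
    have : ((√P : ℝ) : ℂ) ≠ 0 := by exact_mod_cast hsP.ne'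
    push_cast
    field_simp
  -- The quotient of `2t - 1 - t⁻²` by the phase derivative, after cancelling `t - 1`. It increases
  -- and stays between 0 and `1 / P`.
  set q : ℝ → ℝ := fun t => (2 * t ^ 3 + t ^ 2 + t) / (t ^ 3 + t ^ 2 + t + 1) * (1 / (2 * P))
    with hqdef
  have hdiff : (∫ t in t₁..t₂, ee (P * (t ^ 2 + (t ^ 2)⁻¹)) * ((2 * t : ℝ) : ℂ))
      - ((√P)⁻¹ : ℝ) * ee (2 * P) * (fresnel (√P * (t₂ - t₂⁻¹)) - fresnel (√P * (t₁ - t₁⁻¹)))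
      = ee (2 * P) * ∫ t in t₁..t₂, ee (P * (t - t⁻¹) ^ 2)
        * ((P * (2 * (t - t⁻¹) * (1 + (t ^ 2)⁻¹)) * q t : ℝ) : ℂ) := by
    rw [hmain, hfres, mul_assoc, mul_left_comm, hfres2, ← mul_sub, ← integral_sub hi1 hi2]
    congr 1
    refine integral_congr fun t h => ?_
    rw [hu] at h
    have h1 := h0 t h
    have h2 := hp t h
    have : 2 * t - (1 + (t ^ 2)⁻¹) = P * (2 * (t - t⁻¹) * (1 + (t ^ 2)⁻¹)) * q t := by
      simp only [hqdef]
      have h3 : t ^ 3 + t ^ 2 + t + 1 ≠ 0 := by positivity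
      field_simp
      ring
    rw [← mul_sub, ← Complex.ofReal_sub, this]
  rw [hdiff, norm_mul, norm_ee, one_mul]
  have hq : ∀ t ∈ Set.Icc t₁ t₂, HasDerivAt q
      ((t ^ 4 + 2 * t ^ 3 + 6 * t ^ 2 + 2 * t + 1) / (t ^ 3 + t ^ 2 + t + 1) ^ 2
        * (1 / (2 * P))) t := by
    intro t h
    have h2 := hp t h
    have h3 : t ^ 3 + t ^ 2 + t + 1 ≠ 0 := by positivity
    have n1 : HasDerivAt (fun t : ℝ => 2 * t ^ 3 + t ^ 2 + t) (6 * t ^ 2 + 2 * t + 1) t :=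
      ((((hasDerivAt_pow 3 t).const_mul 2).add (hasDerivAt_pow 2 t)).add
        (hasDerivAt_id t)).congr_deriv (by norm_num; ring)
    have n2 : HasDerivAt (fun t : ℝ => t ^ 3 + t ^ 2 + t + 1) (3 * t ^ 2 + 2 * t + 1) t :=
      (((((hasDerivAt_pow 3 t).add (hasDerivAt_pow 2 t)).add
        (hasDerivAt_id t))).add_const 1).congr_deriv (by norm_num)
    refine ((n1.fun_div n2 h3).mul_const (1 / (2 * P))).congr_deriv ?_
    congr 2
    ring
  have hqb : ∀ t ∈ Set.Icc t₁ t₂, |q t| ≤ 1 / P := by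
    intro t h
    have h2 := hp t h
    simp only [hqdef]
    rw [abs_of_nonneg (by positivity), show 1 / P = 2 * (1 / (2 * P)) by field_simp]
    apply mul_le_mul_of_nonneg_right _ (by positivity)
    rw [div_le_iff₀ (by positivity)]
    nlinarith
  refine norm_integral_ee_le ht hφ hq ?_ ?_ (Or.inl ?_) (hqb t₁ ⟨le_rfl, ht⟩)
    (hqb t₂ ⟨ht, le_rfl⟩)
  · exact continuousOn_const.mul ((continuousOn_const.mul hcsub).mul hcw)
  · refine (ContinuousOn.div (by fun_prop) (by fun_prop) fun t h => ?_).mul continuousOn_const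
    have h2 := hp t h
    positivity
  · intro t h
    have h2 := hp t h
    positivity

/-- Stationary phase for the dual integral, with Fresnel integrals at the endpoints. -/
theorem norm_dualIntegral_sub_fresnel_le {Y a b r : ℝ} (hY : 0 < Y) (ha : 0 < a) (hab : a ≤ b)
    (hr : 0 < r) :
    ‖dualIntegral Y a b r - dualAmplitude Y r * ee (2 * √(Y * r))
      * (fresnel (√(r * b) - √(Y / b)) - fresnel (√(r * a) - √(Y / a)))‖ ≤ 1 / r := by
  have hb := ha.trans_le hab
  set w₀ := √(Y / r) with hw₀
  have hw0 : 0 < w₀ := Real.sqrt_pos.2 (by positivity)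
  set P := √(Y * r) with hP
  have hP0 : 0 < P := Real.sqrt_pos.2 (by positivity)
  have e1 : P = r * w₀ := by
    rw [hP, hw₀, show Y * r = r ^ 2 * (Y / r) by field_simp, Real.sqrt_mul (by positivity),
      Real.sqrt_sq hr.le]
  have e2 : P * w₀ = Y := by
    rw [e1, mul_assoc, hw₀, Real.mul_self_sqrt (by positivity)]; field_simp
  have hT : ∀ w, 0 < w → 0 < √(w / w₀) ∧ √P * (√(w / w₀) - (√(w / w₀))⁻¹)
      = √(r * w) - √(Y / w) := by
    intro w hw
    refine ⟨Real.sqrt_pos.2 (by positivity), ?_⟩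
    rw [mul_sub, ← Real.sqrt_inv, ← Real.sqrt_mul hP0.le, ← Real.sqrt_mul hP0.le, inv_div]
    congr 2
    · rw [e1]; field_simp
    · rw [← e2]; ring
  obtain ⟨ha1, ha2⟩ := hT a ha
  obtain ⟨hb1, hb2⟩ := hT b hb
  set t₁ := √(a / w₀) with ht₁
  set t₂ := √(b / w₀) with ht₂
  have ht : t₁ ≤ t₂ := Real.sqrt_le_sqrt (by gcongr)
  have hs := saddle_integral hP0 ha1 ht
  rw [ha2, hb2] at hs
  have hu : Set.uIcc t₁ t₂ = Set.Icc t₁ t₂ := Set.uIcc_of_le ht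
  -- The substitution `w = w₀ t²` moves the stationary point `w₀ = √(Y / r)` to `t = 1` and makes
  -- the phase symmetric under `t ↦ 1/t`.
  have hsubst : dualIntegral Y a b r
      = w₀ * ∫ t in t₁..t₂, ee (P * (t ^ 2 + (t ^ 2)⁻¹)) * ((2 * t : ℝ) : ℂ) := by
    have hpos : ∀ t ∈ Set.Icc t₁ t₂, 0 < t := fun t h => ha1.trans_le h.1
    have hend : ∀ w, 0 < w → w₀ * √(w / w₀) ^ 2 = w := by
      intro w hw
      rw [Real.sq_sqrt (by positivity)]
      field_simp
    have hg : ContinuousOn (fun w => ee (Y / w + r * w))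
        ((fun t => w₀ * t ^ 2) '' Set.uIcc t₁ t₂) := by
      refine continuous_ee.comp_continuousOn (ContinuousOn.add
        (continuousOn_const.div continuousOn_id ?_) (by fun_prop))
      rintro _ ⟨t, h, rfl⟩
      have := hpos t (hu ▸ h)
      positivity
    have h1 := integral_deriv_smul_comp' (a := t₁) (b := t₂) (f := fun t => w₀ * t ^ 2)
      (f' := fun t => w₀ * (2 * t)) (g := fun w => ee (Y / w + r * w))
      (fun t _ => ((hasDerivAt_pow 2 t).const_mul w₀).congr_deriv (by simp))
      (by fun_prop) hg
    simp only [ht₁, ht₂] at h1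
    rw [hend a ha, hend b hb] at h1
    rw [dualIntegral, ← h1, ← integral_const_mul]
    refine integral_congr fun t h => ?_
    have h2 := hpos t (hu ▸ h)
    simp only [Function.comp_apply]
    rw [Complex.real_smul, show Y / (w₀ * t ^ 2) + r * (w₀ * t ^ 2) = P * (t ^ 2 + (t ^ 2)⁻¹) by
      rw [← e2, e1]; field_simp; ring]
    push_cast
    ring
  have hamp : dualAmplitude Y r = w₀ * (√P)⁻¹ := by
    rw [dualAmplitude, hw₀, hP, Real.sqrt_eq_rpow, Real.sqrt_eq_rpow, Real.sqrt_eq_rpow,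
      Real.div_rpow hY.le hr.le, Real.mul_rpow hY.le hr.le,
      Real.mul_rpow (by positivity) (by positivity), ← Real.rpow_mul hY.le, ← Real.rpow_mul hr.le,
      mul_inv, ← Real.rpow_neg hY.le, ← Real.rpow_neg hr.le, div_eq_mul_inv (Y ^ (1 / 2 : ℝ)), ← Real.rpow_neg hr.le,
      mul_mul_mul_comm, ← Real.rpow_add hY, ← Real.rpow_add hr]
    norm_num
  have hfin : dualIntegral Y a b r - dualAmplitude Y r * ee (2 * P)
      * (fresnel (√(r * b) - √(Y / b)) - fresnel (√(r * a) - √(Y / a)))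
      = w₀ * ((∫ t in t₁..t₂, ee (P * (t ^ 2 + (t ^ 2)⁻¹)) * ((2 * t : ℝ) : ℂ))
        - ((√P)⁻¹ : ℝ) * ee (2 * P)
          * (fresnel (√(r * b) - √(Y / b)) - fresnel (√(r * a) - √(Y / a)))) := by
    rw [hsubst, hamp]; push_cast; ring
  rw [hfin, norm_mul, Complex.norm_real, Real.norm_of_nonneg hw0.le]
  calc _ ≤ w₀ * (1 / P) := by gcongr
    _ = 1 / r := by rw [e1]; field_simp

/-! ### Difference tests for the phases `Y / (n + α)` and `2√(Yr) - αr` -/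

/-- Iterated mean value theorem for forward differences. -/
theorem fwdDiff_iterate_mem_Icc {F : ℕ → ℝ → ℝ} {c m M : ℝ} (j n : ℕ)
    (hF : ∀ i < j, ∀ t ∈ Set.Icc (n + c) (n + c + j), HasDerivAt (F i) (F (i + 1) t) t)
    (hm : ∀ t ∈ Set.Icc (n + c) (n + c + j), m ≤ F j t ∧ F j t ≤ M) :
    m ≤ (fwdDiff 1)^[j] (fun k : ℕ => F 0 (k + c)) n ∧
      (fwdDiff 1)^[j] (fun k : ℕ => F 0 (k + c)) n ≤ M := by
  induction j generalizing F with
  | zero => exact hm _ ⟨le_rfl, by simp⟩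
  | succ j ih =>
    have hmem : ∀ t ∈ Set.Icc ((n : ℝ) + c) (n + c + j),
        t ∈ Set.Icc ((n : ℝ) + c) (n + c + (j + 1 : ℕ)) ∧
        t + 1 ∈ Set.Icc ((n : ℝ) + c) (n + c + (j + 1 : ℕ)) := by
      intro t ht
      push_cast
      exact ⟨⟨ht.1, by linarith [ht.2]⟩, ⟨by linarith [ht.1], by linarith [ht.2]⟩⟩
    -- Differencing once replaces every `F i` by its unit increment. The mean value theorem
    -- expresses the last increment through `F (j + 1)`.
    have h := ih (F := fun i t => F i (t + 1) - F i t)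
      (fun i hi t ht => ((hF i (by omega) _ (hmem t ht).2).comp_add_const t 1).fun_sub
        (hF i (by omega) _ (hmem t ht).1))
      (fun t ht => by
        obtain ⟨h1, h2⟩ := hmem t ht
        have hsub : Set.Icc t (t + 1) ⊆ Set.Icc ((n : ℝ) + c) (n + c + (j + 1 : ℕ)) :=
          Set.Icc_subset_Icc h1.1 h2.2
        obtain ⟨ξ, hξ, hξ'⟩ := exists_hasDerivAt_eq_slope (F j) (F (j + 1)) (lt_add_one t)
          (fun u hu => (hF j (by omega) u (hsub hu)).continuousAt.continuousWithinAt)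
          (fun u hu => hF j (by omega) u (hsub (Set.Ioo_subset_Icc_self hu)))
        rw [add_sub_cancel_left, div_one] at hξ'
        rw [← hξ']
        exact hm ξ (hsub (Set.Ioo_subset_Icc_self hξ)))
    rw [Function.iterate_succ_apply]
    have e : fwdDiff 1 (fun k : ℕ => F 0 (k + c)) = fun k : ℕ => F 0 (k + c + 1) - F 0 (k + c) := by
      funext k
      simp only [fwdDiff]
      congr 2
      push_cast
      ring
    rw [e]
    exact h

theorem norm_sum_ee_neg {ι : Type*} (s : Finset ι) (f : ι → ℝ) :
    ‖∑ n ∈ s, ee (-f n)‖ = ‖∑ n ∈ s, ee (f n)‖ := by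
  rw [← Complex.norm_conj (∑ n ∈ s, ee (f n)), map_sum]
  simp_rw [ee_neg]

theorem sum_Ioc_eq_sum_range_add {M : Type*} [AddCommMonoid M] (f : ℕ → M) (i j : ℕ) :
    ∑ n ∈ Finset.Ioc i j, f n = ∑ n ∈ Finset.range (j - i), f (n + (i + 1)) := by
  rw [← Finset.Ico_add_one_add_one_eq_Ioc, Finset.sum_Ico_eq_sum_range,
    show j + 1 - (i + 1) = j - i by omega]
  exact Finset.sum_congr rfl fun n _ => by rw [add_comm]

/-- Third difference test for the phase `Y / (n + α)`. -/
theorem exists_norm_sum_recip_le_third :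
    ∃ C : ℝ, 0 < C ∧ ∀ (J : ℕ) (α Y : ℝ), 1 ≤ J → 0 ≤ α → α ≤ 1 → 0 < Y →
      ‖∑ n ∈ Finset.Ioc (J / 2) J, ee (Y / (n + α))‖
        ≤ C * (J * (Y / J ^ 4) ^ (1 / 6 : ℝ)
          + (J : ℝ) ^ (1 / 2 : ℝ) * (Y / J ^ 4) ^ (-(1 / 6) : ℝ)) := by
  -- All points involved lie between `J/2` and `5J`, so the third derivative `6Y / t⁴` of `-Y / t`
  -- varies by a factor of at most `10⁴`. The sign is chosen to make it positive; conjugation leaves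
  -- the norm unchanged.
  obtain ⟨C, hC, hT⟩ := differenceTest_three (10 ^ 4) (by norm_num)
  refine ⟨C * 10, by positivity, fun J α Y hJ hα0 hα1 hY => ?_⟩
  have hJ1 : (1 : ℝ) ≤ J := by exact_mod_cast hJ
  have hJ0 : (0 : ℝ) < J := by linarith
  rw [← norm_sum_ee_neg, sum_Ioc_eq_sum_range_add]
  set lam := 6 * Y / (5 * J) ^ 4 with hlam
  have hlam0 : 0 < lam := by positivity
  set F : ℕ → ℝ → ℝ := fun i t => match i with
    | 0 => -(Y / t)
    | 1 => Y / t ^ 2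
    | 2 => -(2 * Y / t ^ 3)
    | _ => 6 * Y / t ^ 4 with hFdef
  have hmain := hT (fun n : ℕ => F 0 (n + ((J / 2 + 1 : ℕ) + α))) (J - J / 2) lam hlam0 (by
    intro n hn
    have hx : (J : ℝ) / 2 ≤ n + ((J / 2 + 1 : ℕ) + α) := by
      have : J ≤ 2 * (n + (J / 2 + 1)) := by omega
      have : (J : ℝ) ≤ 2 * (n + ((J / 2 + 1 : ℕ) : ℝ)) := by exact_mod_cast this
      linarith
    have hy : (n : ℝ) + ((J / 2 + 1 : ℕ) + α) + (3 : ℕ) ≤ 5 * J := by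
      have : n + (J / 2 + 1) ≤ J := by omega
      have : (n : ℝ) + ((J / 2 + 1 : ℕ) : ℝ) ≤ J := by exact_mod_cast this
      push_cast at this ⊢
      linarith
    refine fwdDiff_iterate_mem_Icc (F := F) 3 n ?_ ?_
    · intro i hi t ht
      have ht0 : 0 < t := lt_of_lt_of_le (by linarith) ht.1
      interval_cases i
      · have h1 := ((hasDerivAt_inv ht0.ne').const_mul Y).fun_neg
        simp only [hFdef, div_eq_mul_inv]
        exact h1.congr_deriv (by ring)
      · have h1 := (((hasDerivAt_pow 2 t).fun_inv (pow_ne_zero 2 ht0.ne')).const_mul Y)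
        simp only [hFdef, div_eq_mul_inv]
        exact h1.congr_deriv (by push_cast; field_simp)
      · have h1 := (((hasDerivAt_pow 3 t).fun_inv (pow_ne_zero 3 ht0.ne')).const_mul (2 * Y)).fun_neg
        simp only [hFdef, div_eq_mul_inv]
        exact h1.congr_deriv (by push_cast; field_simp; ring)
    · intro t ht
      have ht0 : 0 < t := lt_of_lt_of_le (by linarith) ht.1
      simp only [hFdef]
      constructor
      · rw [hlam]
        gcongr
        exact ht.2.trans hy
      · rw [hlam, show (10 : ℝ) ^ 4 * (6 * Y / (5 * J) ^ 4) = 6 * Y / (J / 2) ^ 4 by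
          field_simp; norm_num]
        gcongr
        exact hx.trans ht.1)
  have e : ∀ n : ℕ, F 0 (n + ((J / 2 + 1 : ℕ) + α)) = -(Y / (((n + (J / 2 + 1) : ℕ) : ℝ) + α)) := by
    intro n
    simp only [hFdef]
    push_cast
    rw [← add_assoc, ← add_assoc]
  simp only [e] at hmain
  refine hmain.trans ?_
  have hM : ((J - J / 2 : ℕ) : ℝ) ≤ J := by exact_mod_cast Nat.sub_le _ _
  set μ := Y / (J : ℝ) ^ 4 with hμ
  have hμ0 : 0 < μ := by positivity
  have hl1 : lam = 6 / 625 * μ := by rw [hlam, hμ]; field_simp; norm_num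
  have h1 : lam ^ (1 / 6 : ℝ) ≤ μ ^ (1 / 6 : ℝ) := by
    apply Real.rpow_le_rpow hlam0.le _ (by norm_num)
    rw [hl1]; linarith
  have h2 : lam ^ (-(1 / 6) : ℝ) ≤ 10 * μ ^ (-(1 / 6) : ℝ) := by
    have h3 : (10 : ℝ) = (1 / 10 ^ 6) ^ (-(1 / 6) : ℝ) := by
      rw [one_div, Real.inv_rpow (by positivity), Real.rpow_neg (by positivity), inv_inv,
        ← Real.rpow_natCast, ← Real.rpow_mul (by norm_num)]
      norm_num
    rw [h3, ← Real.mul_rpow (by positivity) hμ0.le]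
    apply Real.rpow_le_rpow_of_nonpos (by positivity) _ (by norm_num)
    rw [hl1]
    exact mul_le_mul_of_nonneg_right (by norm_num) hμ0.le
  have h3 : ((J - J / 2 : ℕ) : ℝ) ^ (1 - 1 / 2 : ℝ) ≤ (J : ℝ) ^ (1 / 2 : ℝ) := by
    norm_num
    gcongr
  calc C * (((J - J / 2 : ℕ) : ℝ) * lam ^ (1 / 6 : ℝ)
        + ((J - J / 2 : ℕ) : ℝ) ^ (1 - 1 / 2 : ℝ) * lam ^ (-(1 / 6) : ℝ))
      ≤ C * (J * μ ^ (1 / 6 : ℝ) + (J : ℝ) ^ (1 / 2 : ℝ) * (10 * μ ^ (-(1 / 6) : ℝ))) := by gcongr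
    _ ≤ C * 10 * (J * μ ^ (1 / 6 : ℝ) + (J : ℝ) ^ (1 / 2 : ℝ) * μ ^ (-(1 / 6) : ℝ)) := by
      have : 0 ≤ C * (J * μ ^ (1 / 6 : ℝ)) := by positivity
      linarith

/-- Fourth difference test for the phase `2 √(Y r) - α r`. -/
theorem exists_norm_sum_sqrt_le_fourth :
    ∃ C : ℝ, 0 < C ∧ ∀ (i j : ℕ) (α Y D : ℝ), 0 < Y → 1 ≤ D → D / 4 ≤ i + 1 → (j : ℝ) ≤ 16 * D →
      ‖∑ r ∈ Finset.Ioc i j, ee (2 * √(Y * r) - α * r)‖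
        ≤ C * (D * (√Y * D ^ (-(7 / 2) : ℝ)) ^ (1 / 14 : ℝ)
          + D ^ (3 / 4 : ℝ) * (√Y * D ^ (-(7 / 2) : ℝ)) ^ (-(1 / 14) : ℝ)) := by
  -- The points lie between `D/4` and `20D`, and the fourth derivative is a multiple of `t^(-7/2)`.
  -- The linear term `αr` has disappeared by then.
  obtain ⟨C, hC, hT⟩ := differenceTest_four (80 ^ (7 / 2 : ℝ))
    (Real.one_le_rpow (by norm_num) (by norm_num))
  refine ⟨C * 64, by positivity, fun i j α Y D hY hD hi hj => ?_⟩
  have hD0 : 0 < D := by linarith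
  rw [← norm_sum_ee_neg, sum_Ioc_eq_sum_range_add]
  have hsY : 0 < √Y := Real.sqrt_pos.2 hY
  set lam := 15 / 8 * √Y * (20 * D) ^ (-(7 / 2) : ℝ) with hlam
  have hlam0 : 0 < lam := by positivity
  set F : ℕ → ℝ → ℝ := fun i t => match i with
    | 0 => -2 * √Y * t ^ (1 / 2 : ℝ) + α * t
    | 1 => -√Y * t ^ (-(1 / 2) : ℝ) + α
    | 2 => 1 / 2 * √Y * t ^ (-(3 / 2) : ℝ)
    | 3 => -(3 / 4) * √Y * t ^ (-(5 / 2) : ℝ)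
    | _ => 15 / 8 * √Y * t ^ (-(7 / 2) : ℝ) with hFdef
  have hmain := hT (fun n : ℕ => F 0 (n + ((i + 1 : ℕ) : ℝ))) (j - i) lam hlam0 (by
    intro n hn
    have hx : D / 4 ≤ n + ((i + 1 : ℕ) : ℝ) := by
      push_cast
      linarith [Nat.cast_nonneg (α := ℝ) n]
    have hy : (n : ℝ) + ((i + 1 : ℕ) : ℝ) + (4 : ℕ) ≤ 20 * D := by
      have : n + (i + 1) ≤ j := by omega
      have : (n : ℝ) + ((i + 1 : ℕ) : ℝ) ≤ j := by exact_mod_cast this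
      push_cast at this ⊢
      linarith
    refine fwdDiff_iterate_mem_Icc (F := F) 4 n ?_ ?_
    · intro k hk t ht
      have ht0 : 0 < t := lt_of_lt_of_le (by linarith) ht.1
      have hp : ∀ p : ℝ, HasDerivAt (fun t : ℝ => t ^ p) (p * t ^ (p - 1)) t := fun p =>
        Real.hasDerivAt_rpow_const (Or.inl ht0.ne')
      interval_cases k
      · refine (((hp (1 / 2)).const_mul (-2 * √Y)).fun_add
          ((hasDerivAt_id t).const_mul α)).congr_deriv ?_
        simp only [hFdef]
        norm_num
        ring
      · refine (((hp (-(1 / 2))).const_mul (-√Y)).add_const α).congr_deriv ?_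
        simp only [hFdef]
        norm_num
        ring
      · refine ((hp (-(3 / 2))).const_mul (1 / 2 * √Y)).congr_deriv ?_
        simp only [hFdef]
        norm_num
        ring
      · refine ((hp (-(5 / 2))).const_mul (-(3 / 4) * √Y)).congr_deriv ?_
        simp only [hFdef]
        norm_num
        ring
    · intro t ht
      have ht0 : 0 < t := lt_of_lt_of_le (by linarith) ht.1
      simp only [hFdef]
      constructor
      · rw [hlam]
        apply mul_le_mul_of_nonneg_left _ (by positivity)
        exact Real.rpow_le_rpow_of_nonpos ht0 (ht.2.trans hy) (by norm_num)
      · have e80 : (80 : ℝ) ^ (7 / 2 : ℝ) * (20 * D) ^ (-(7 / 2) : ℝ) = (D / 4) ^ (-(7 / 2) : ℝ) := by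
          rw [show 20 * D = 80 * (D / 4) by ring, Real.mul_rpow (by norm_num) (by positivity),
            ← mul_assoc, ← Real.rpow_add (by norm_num)]
          norm_num
        rw [hlam, mul_left_comm, e80]
        apply mul_le_mul_of_nonneg_left _ (by positivity)
        exact Real.rpow_le_rpow_of_nonpos (by positivity) (hx.trans ht.1) (by norm_num))
  have e : ∀ n : ℕ, F 0 (n + ((i + 1 : ℕ) : ℝ))
      = -(2 * √(Y * ((n + (i + 1) : ℕ) : ℝ)) - α * ((n + (i + 1) : ℕ) : ℝ)) := by
    intro n
    simp only [hFdef]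
    rw [Real.sqrt_mul hY.le, Real.sqrt_eq_rpow (((n + (i + 1) : ℕ) : ℝ))]
    push_cast
    ring
  simp only [e] at hmain
  refine hmain.trans ?_
  have hM : ((j - i : ℕ) : ℝ) ≤ 16 * D := by
    have : ((j - i : ℕ) : ℝ) ≤ j := by exact_mod_cast Nat.sub_le _ _
    linarith
  set μ := √Y * D ^ (-(7 / 2) : ℝ) with hμ
  have hμ0 : 0 < μ := by positivity
  have hl1 : lam = 15 / 8 * 20 ^ (-(7 / 2) : ℝ) * μ := by
    rw [hlam, hμ, Real.mul_rpow (by norm_num) hD0.le]; ring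
  have c1 : (15 / 8 : ℝ) * 20 ^ (-(7 / 2) : ℝ) ≤ 1 := by
    have : (20 : ℝ) ^ (-(7 / 2) : ℝ) ≤ 20 ^ (-1 : ℝ) :=
      Real.rpow_le_rpow_of_exponent_le (by norm_num) (by norm_num)
    rw [Real.rpow_neg_one] at this
    linarith
  have c2 : (1 / 4 ^ 14 : ℝ) ≤ 15 / 8 * 20 ^ (-(7 / 2) : ℝ) := by
    have h1 : (20 : ℝ) ^ (-4 : ℝ) ≤ 20 ^ (-(7 / 2) : ℝ) :=
      Real.rpow_le_rpow_of_exponent_le (by norm_num) (by norm_num)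
    have h5 : (20 : ℝ) ^ (-4 : ℝ) = 1 / 160000 := by
      rw [Real.rpow_neg (by norm_num), show (4 : ℝ) = ((4 : ℕ) : ℝ) by norm_num, Real.rpow_natCast]
      norm_num
    linarith
  have h1 : lam ^ (1 / 14 : ℝ) ≤ μ ^ (1 / 14 : ℝ) := by
    apply Real.rpow_le_rpow hlam0.le _ (by norm_num)
    rw [hl1]
    exact mul_le_of_le_one_left hμ0.le c1
  have h2 : lam ^ (-(1 / 14) : ℝ) ≤ 4 * μ ^ (-(1 / 14) : ℝ) := by
    have h3 : (4 : ℝ) = (1 / 4 ^ 14) ^ (-(1 / 14) : ℝ) := by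
      rw [one_div, Real.inv_rpow (by positivity), Real.rpow_neg (by positivity), inv_inv,
        ← Real.rpow_natCast, ← Real.rpow_mul (by norm_num)]
      norm_num
    nth_rewrite 1 [h3]
    rw [← Real.mul_rpow (by positivity) hμ0.le]
    apply Real.rpow_le_rpow_of_nonpos (by positivity) _ (by norm_num)
    rw [hl1]
    exact mul_le_mul_of_nonneg_right c2 hμ0.le
  have h3 : ((j - i : ℕ) : ℝ) ^ (1 - 1 / 4 : ℝ) ≤ 16 * D ^ (3 / 4 : ℝ) := by
    calc ((j - i : ℕ) : ℝ) ^ (1 - 1 / 4 : ℝ) ≤ (16 * D) ^ (3 / 4 : ℝ) := by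
          norm_num
          gcongr
      _ = 16 ^ (3 / 4 : ℝ) * D ^ (3 / 4 : ℝ) := Real.mul_rpow (by norm_num) hD0.le
      _ ≤ 16 * D ^ (3 / 4 : ℝ) := by
          gcongr
          calc (16 : ℝ) ^ (3 / 4 : ℝ) ≤ 16 ^ (1 : ℝ) :=
                Real.rpow_le_rpow_of_exponent_le (by norm_num) (by norm_num)
            _ = 16 := Real.rpow_one _
  calc C * (((j - i : ℕ) : ℝ) * lam ^ (1 / 14 : ℝ)
        + ((j - i : ℕ) : ℝ) ^ (1 - 1 / 4 : ℝ) * lam ^ (-(1 / 14) : ℝ))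
      ≤ C * (16 * D * μ ^ (1 / 14 : ℝ)
        + (16 * D ^ (3 / 4 : ℝ)) * (4 * μ ^ (-(1 / 14) : ℝ))) := by gcongr
    _ ≤ C * 64 * (D * μ ^ (1 / 14 : ℝ) + D ^ (3 / 4 : ℝ) * μ ^ (-(1 / 14) : ℝ)) := by
      have : 0 ≤ C * (D * μ ^ (1 / 14 : ℝ)) := by positivity
      linarith

/-! ### Partial summation and the estimate of the dual sum -/

theorem norm_sum_antitone_mul_le {w : ℕ → ℝ} {z : ℕ → ℂ} {B : ℝ} {i j : ℕ} (hij : i < j)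
    (hw0 : ∀ r, i < r → 0 ≤ w r) (hw : ∀ r, i < r → w (r + 1) ≤ w r)
    (hB : ∀ m, m ≤ j → ‖∑ r ∈ Finset.Ioc i m, z r‖ ≤ B) :
    ‖∑ r ∈ Finset.Ioc i j, (w r : ℂ) * z r‖ ≤ w (i + 1) * B := by
  have hid : ∀ m, i ≤ m → ∑ r ∈ Finset.Ioc i m, (w r : ℂ) * z r
      = w (m + 1) * ∑ r ∈ Finset.Ioc i m, z r
        + ∑ r ∈ Finset.Ioc i m, ((w r - w (r + 1) : ℝ) : ℂ) * ∑ q ∈ Finset.Ioc i r, z q := by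
    intro m hm
    induction m, hm using Nat.le_induction with
    | base => simp
    | succ m hm ih =>
      rw [Finset.sum_Ioc_succ_top hm, ih, Finset.sum_Ioc_succ_top hm,
        Finset.sum_Ioc_succ_top hm (f := fun r => ((w r - w (r + 1) : ℝ) : ℂ) *
          ∑ q ∈ Finset.Ioc i r, z q), Finset.sum_Ioc_succ_top hm]
      push_cast
      ring
  have htel : ∀ m, i ≤ m → ∑ r ∈ Finset.Ioc i m, (w r - w (r + 1)) = w (i + 1) - w (m + 1) := by
    intro m hm
    induction m, hm using Nat.le_induction with
    | base => simp
    | succ m hm ih => rw [Finset.sum_Ioc_succ_top hm, ih]; ring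
  rw [hid j hij.le]
  have h1 : ‖(w (j + 1) : ℂ) * ∑ r ∈ Finset.Ioc i j, z r‖ ≤ w (j + 1) * B := by
    rw [norm_mul, Complex.norm_real, Real.norm_of_nonneg (hw0 _ (by omega))]
    exact mul_le_mul_of_nonneg_left (hB j le_rfl) (hw0 _ (by omega))
  have h2 : ‖∑ r ∈ Finset.Ioc i j, ((w r - w (r + 1) : ℝ) : ℂ) * ∑ q ∈ Finset.Ioc i r, z q‖
      ≤ (w (i + 1) - w (j + 1)) * B := by
    rw [← htel j hij.le, Finset.sum_mul]
    refine norm_sum_le_of_le _ fun r hr => ?_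
    rw [Finset.mem_Ioc] at hr
    have h3 : 0 ≤ w r - w (r + 1) := by linarith [hw r hr.1]
    rw [norm_mul, Complex.norm_real, Real.norm_of_nonneg h3]
    exact mul_le_mul_of_nonneg_left (hB r hr.2) h3
  refine (norm_add_le _ _).trans ((add_le_add h1 h2).trans ?_)
  linarith

theorem sum_Ico_one_div_le (Q : ℕ) :
    ∑ q ∈ Finset.Ico 1 (Q + 1), 1 / (q : ℝ) ≤ 2 * √Q := by
  refine (Finset.sum_le_sum fun q hq => ?_).trans
    ((sum_Ico_rpow_neg_half_le Q).trans (by rw [Real.sqrt_eq_rpow]))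
  rw [Finset.mem_Ico] at hq
  have h1 : (1 : ℝ) ≤ q := by exact_mod_cast hq.1
  rw [one_div, ← Real.rpow_neg_one]
  exact Real.rpow_le_rpow_of_exponent_le h1 (by norm_num)

/-- The two integers next to `s` cost 4 each. The rest form two harmonic sums, for which the crude
bound `2√R` in place of a logarithm is sufficient. -/
theorem sum_range_le_of_inv_dist {f : ℕ → ℝ} {s c : ℝ} {R : ℕ} (hs : 0 ≤ s) (hc : 0 ≤ c)
    (hR : ⌊s⌋₊ + 1 ≤ R) (hf4 : ∀ r ≤ R, f r ≤ 4)
    (hfc : ∀ r ≤ R, f r * |(r : ℝ) - s| ≤ c) :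
    ∑ r ∈ Finset.range (R + 1), f r ≤ 8 + 4 * c * √R := by
  set n := ⌊s⌋₊ with hn
  have hns : (n : ℝ) ≤ s := Nat.floor_le hs
  have hsn : s < n + 1 := Nat.lt_floor_add_one s
  rw [← Finset.sum_range_add_sum_Ico f (show n ≤ R + 1 by omega),
    Finset.sum_eq_sum_Ico_succ_bot (show n < R + 1 by omega),
    Finset.sum_eq_sum_Ico_succ_bot (show n + 1 < R + 1 by omega)]
  have h1 : ∑ r ∈ Finset.range n, f r ≤ 2 * c * √R := by
    have : ∑ r ∈ Finset.range n, f r ≤ ∑ r ∈ Finset.range n, c * (1 / ((n - r : ℕ) : ℝ)) := by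
      refine Finset.sum_le_sum fun r hr => ?_
      rw [Finset.mem_range] at hr
      have h2 : (0 : ℝ) < ((n - r : ℕ) : ℝ) := by exact_mod_cast Nat.sub_pos_of_lt hr
      rw [mul_one_div, le_div_iff₀ h2]
      rcases le_or_gt (f r) 0 with h0 | h0
      · exact (mul_nonpos_of_nonpos_of_nonneg h0 h2.le).trans hc
      refine le_trans ?_ (hfc r (by omega))
      apply mul_le_mul_of_nonneg_left _ h0.le
      rw [Nat.cast_sub hr.le, abs_sub_comm]
      exact le_trans (by linarith) (le_abs_self _)
    refine this.trans ?_
    rw [← Finset.mul_sum]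
    have h3 : ∑ r ∈ Finset.range n, 1 / ((n - r : ℕ) : ℝ)
        = ∑ q ∈ Finset.Ico 1 (n + 1), 1 / (q : ℝ) := by
      rw [← Finset.sum_range_reflect, Finset.sum_Ico_eq_sum_range]
      refine Finset.sum_congr (by simp) fun r hr => ?_
      rw [Finset.mem_range] at hr
      congr 2
      omega
    rw [h3, mul_comm 2 c, mul_assoc]
    apply mul_le_mul_of_nonneg_left _ hc
    refine (sum_Ico_one_div_le n).trans ?_
    gcongr
    omega
  have h4 : ∑ r ∈ Finset.Ico (n + 1 + 1) (R + 1), f r ≤ 2 * c * √R := by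
    have : ∑ r ∈ Finset.Ico (n + 1 + 1) (R + 1), f r
        ≤ ∑ r ∈ Finset.Ico (n + 1 + 1) (R + 1), c * (1 / ((r - (n + 1) : ℕ) : ℝ)) := by
      refine Finset.sum_le_sum fun r hr => ?_
      rw [Finset.mem_Ico] at hr
      have h2 : (0 : ℝ) < ((r - (n + 1) : ℕ) : ℝ) := by
        exact_mod_cast Nat.sub_pos_of_lt (by omega)
      rw [mul_one_div, le_div_iff₀ h2]
      rcases le_or_gt (f r) 0 with h0 | h0
      · exact (mul_nonpos_of_nonpos_of_nonneg h0 h2.le).trans hc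
      refine le_trans ?_ (hfc r (by omega))
      apply mul_le_mul_of_nonneg_left _ h0.le
      rw [Nat.cast_sub (by omega)]
      push_cast
      exact le_trans (by linarith) (le_abs_self _)
    refine this.trans ?_
    rw [← Finset.mul_sum]
    have h3 : ∑ r ∈ Finset.Ico (n + 1 + 1) (R + 1), 1 / ((r - (n + 1) : ℕ) : ℝ)
        ≤ ∑ q ∈ Finset.Ico 1 (R + 1), 1 / (q : ℝ) := by
      have h5 : ∑ r ∈ Finset.Ico (n + 1 + 1) (R + 1), 1 / ((r - (n + 1) : ℕ) : ℝ)
          = ∑ q ∈ Finset.Ico 1 (R - n), 1 / (q : ℝ) := by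
        rw [Finset.sum_Ico_eq_sum_range, Finset.sum_Ico_eq_sum_range]
        refine Finset.sum_congr (by congr 1; omega) fun r _ => ?_
        congr 2
        omega
      rw [h5]
      exact Finset.sum_le_sum_of_subset_of_nonneg (Finset.Ico_subset_Ico le_rfl (by omega))
        fun q _ _ => by positivity
    rw [mul_comm 2 c, mul_assoc]
    exact mul_le_mul_of_nonneg_left (h3.trans (sum_Ico_one_div_le R)) hc
  have h5 := hf4 n (by omega)
  have h6 := hf4 (n + 1) (by omega)
  linarith

/-- The Fresnel argument is `√b (√r - √(Y / b²))`. It changes sign at the frequency `Y / b²` that is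
stationary at the endpoint `b`, and its reciprocal is controlled by the inverse distance of `r` from
that frequency. -/
theorem sum_fresnel_error_le {Y b V c K : ℝ} {R : ℕ} (hY : 0 < Y) (hb : 0 < b)
    (hR : ⌊Y / b ^ 2⌋₊ + 1 ≤ R) (hV : √(R * b) + √(Y / b) ≤ V) (hK : 0 ≤ K)
    (hRK : √R + √(Y / b ^ 2) ≤ K) (hc : K / (2 * √b) ≤ c) :
    ∑ r ∈ Finset.range (R + 1), ‖fresnel (√(r * b) - √(Y / b))
      - ((if Y / b ^ 2 < r then 1 else -1 : ℝ) : ℂ) * fresnel V‖ ≤ 8 + 4 * c * √R := by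
  have hsb : 0 < √b := Real.sqrt_pos.2 hb
  have hc0 : 0 ≤ c := le_trans (by positivity) hc
  refine sum_range_le_of_inv_dist (s := Y / b ^ 2) (by positivity) hc0 hR ?_ ?_
  all_goals
    intro r hr
    have hrR : (r : ℝ) ≤ R := by exact_mod_cast hr
    have hr0 : (0 : ℝ) ≤ r := Nat.cast_nonneg r
    have ev : √(r * b) - √(Y / b) = √b * (√r - √(Y / b ^ 2)) := by
      rw [mul_sub, ← Real.sqrt_mul hb.le, ← Real.sqrt_mul hb.le]
      congr 2
      · ring
      · field_simp
    have hvV : |√(r * b) - √(Y / b)| ≤ V := by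
      refine le_trans ?_ hV
      have h1 : √(r * b) ≤ √(R * b) := Real.sqrt_le_sqrt (by gcongr)
      rw [abs_le]
      constructor <;> linarith [Real.sqrt_nonneg (r * b), Real.sqrt_nonneg (Y / b)]
    have hσ : 0 < √(r * b) - √(Y / b) ∧ (if Y / b ^ 2 < r then 1 else -1 : ℝ) = 1 ∨
        √(r * b) - √(Y / b) ≤ 0 ∧ (if Y / b ^ 2 < r then 1 else -1 : ℝ) = -1 := by
      rw [ev]
      split_ifs with h
      · refine Or.inl ⟨mul_pos hsb ?_, rfl⟩
        have := Real.sqrt_lt_sqrt (by positivity) h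
        linarith
      · refine Or.inr ⟨mul_nonpos_of_nonneg_of_nonpos hsb.le ?_, rfl⟩
        have := Real.sqrt_le_sqrt (not_lt.1 h)
        linarith
    have hF := norm_fresnel_sub_sign_le hvV hσ
  · exact hF.1
  · rcases eq_or_ne (r : ℝ) (Y / b ^ 2) with h | h
    · rw [h, sub_self, abs_zero, mul_zero]; exact hc0
    have hprod : (√r - √(Y / b ^ 2)) * (√r + √(Y / b ^ 2)) = r - Y / b ^ 2 := by
      have h1 := Real.mul_self_sqrt hr0
      have h2 := Real.mul_self_sqrt (show 0 ≤ Y / b ^ 2 by positivity)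
      nlinarith
    have hd : |(r : ℝ) - Y / b ^ 2| ≤ |√r - √(Y / b ^ 2)| * K := by
      rw [← hprod, abs_mul]
      apply mul_le_mul_of_nonneg_left _ (abs_nonneg _)
      rw [abs_of_nonneg (by positivity)]
      refine le_trans ?_ hRK
      gcongr
    have hne : √r - √(Y / b ^ 2) ≠ 0 := by
      intro h0
      rw [h0, zero_mul] at hprod
      exact h (by linarith)
    have h1 := hF.2 (by rw [ev]; exact mul_ne_zero hsb.ne' hne)
    have habs : 0 < |√r - √(Y / b ^ 2)| := abs_pos.2 hne
    calc _ ≤ 1 / (2 * |√(r * b) - √(Y / b)|) * (|√r - √(Y / b ^ 2)| * K) := by gcongr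
      _ = K / (2 * √b) := by
        rw [ev, abs_mul, abs_of_pos hsb]
        field_simp
      _ ≤ c := hc

theorem dualAmplitude_nonneg {Y r : ℝ} (hY : 0 ≤ Y) (hr : 0 ≤ r) : 0 ≤ dualAmplitude Y r := by
  unfold dualAmplitude; positivity

theorem dualAmplitude_anti {Y r r' : ℝ} (hY : 0 ≤ Y) (hr : 0 < r) (h : r ≤ r') :
    dualAmplitude Y r' ≤ dualAmplitude Y r := by
  unfold dualAmplitude
  exact mul_le_mul_of_nonneg_left (Real.rpow_le_rpow_of_nonpos hr h (by norm_num)) (by positivity)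

theorem dualAmplitude_le {J L r : ℝ} (hJ : 0 < J) (hL : 0 < L) (hr : L / 8 ≤ r) :
    dualAmplitude (L * J ^ 2) r ≤ 8 * (√J / √L) := by
  refine (dualAmplitude_anti (by positivity) (by positivity) hr).trans ?_
  have h8 : (8 : ℝ) ^ (3 / 4 : ℝ) ≤ 8 := by
    calc (8 : ℝ) ^ (3 / 4 : ℝ) ≤ 8 ^ (1 : ℝ) :=
          Real.rpow_le_rpow_of_exponent_le (by norm_num) (by norm_num)
      _ = 8 := Real.rpow_one 8
  have e : dualAmplitude (L * J ^ 2) (L / 8) = 8 ^ (3 / 4 : ℝ) * (√J / √L) := by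
    rw [dualAmplitude, Real.mul_rpow hL.le (by positivity), Real.div_rpow hL.le (by norm_num),
      Real.sqrt_eq_rpow, Real.sqrt_eq_rpow, ← Real.rpow_natCast J 2, ← Real.rpow_mul hJ.le,
      Real.rpow_neg (by norm_num : (0 : ℝ) ≤ 8), div_inv_eq_mul,
      div_eq_mul_inv (J ^ (1 / 2 : ℝ)), ← Real.rpow_neg hL.le]
    have : L ^ (-(1 / 2) : ℝ) = L ^ (1 / 4 : ℝ) * L ^ (-(3 / 4) : ℝ) := by
      rw [← Real.rpow_add hL]; norm_num
    rw [this]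
    norm_num
    ring
  rw [e]
  gcongr

/-- The stationary point `√(Y / r)` lies between the endpoints when `r` is between `s = Y / b²` and
`S = Y / a²`. Each Fresnel value is replaced by a signed constant; the signs at the two endpoints
cancel unless `s < r ≤ S`. On that range the amplitude is decreasing and of size at most `8 √(J /
L)`, and is removed by partial summation. -/
theorem norm_dual_sum_le {J L a b α B : ℝ} (hJ : 0 < J) (hL : 1 ≤ L) (ha1 : J / 4 ≤ a)
    (ha2 : a ≤ J) (hb1 : J ≤ b) (hb2 : b ≤ 2 * J)
    (hB : ∀ m, m ≤ ⌊L * J ^ 2 / a ^ 2⌋₊ →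
      ‖∑ r ∈ Finset.Ioc ⌊L * J ^ 2 / b ^ 2⌋₊ m, ee (2 * √(L * J ^ 2 * r) - α * r)‖ ≤ B) :
    ‖∑ r ∈ Finset.Ioc ⌊L * J ^ 2 / b ^ 2 / 2⌋₊ ⌈2 * (L * J ^ 2 / a ^ 2)⌉₊,
        ee (-(r * α)) * dualIntegral (L * J ^ 2) a b r‖
      ≤ 288 + 16 * (√J / √L) * (8 + 240 * (L / √J)) + 32 * (√J / √L) * B := by
  set Y := L * J ^ 2 with hY
  have hL0 : 0 < L := by linarith
  have hY0 : 0 < Y := by positivity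
  have ha0 : 0 < a := by linarith
  have hb0 : 0 < b := by linarith
  have hab : a ≤ b := ha2.trans hb1
  set s := Y / b ^ 2 with hs
  set S := Y / a ^ 2 with hS
  have hs0 : 0 < s := by positivity
  have hsS : s ≤ S := by rw [hs, hS]; gcongr
  have hs1 : L / 4 ≤ s := by
    rw [hs, hY, le_div_iff₀ (by positivity)]
    have : b ^ 2 ≤ (2 * J) ^ 2 := by gcongr
    nlinarith
  have hs2 : s ≤ L := by
    rw [hs, hY, div_le_iff₀ (by positivity)]
    gcongr
  have hS1 : L ≤ S := by
    rw [hS, hY, le_div_iff₀ (by positivity)]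
    gcongr
  have hS2 : S ≤ 16 * L := by
    rw [hS, hY, div_le_iff₀ (by positivity)]
    have : (J / 4) ^ 2 ≤ a ^ 2 := by gcongr
    nlinarith
  set R := ⌈2 * S⌉₊ with hR
  have hRS : 2 * S ≤ R := Nat.le_ceil _
  have hR36 : (R : ℝ) ≤ 36 * L := by
    have := (Nat.ceil_lt_add_one (show 0 ≤ 2 * S by positivity)).le
    linarith
  have hflS : ⌊S⌋₊ + 1 ≤ R := by
    have h1 : (⌊S⌋₊ : ℝ) ≤ S := Nat.floor_le (by positivity)
    have : ((⌊S⌋₊ + 1 : ℕ) : ℝ) ≤ R := by push_cast; linarith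
    exact_mod_cast this
  have hfls : ⌊s⌋₊ + 1 ≤ R := le_trans (Nat.add_le_add_right (Nat.floor_le_floor hsS) 1) hflS
  have hsJ : 0 < √J := Real.sqrt_pos.2 hJ
  have hsL : 0 < √L := Real.sqrt_pos.2 hL0
  have hsqR : √R ≤ 6 * √L := by
    rw [show (6 : ℝ) * √L = √(36 * L) by
      rw [Real.sqrt_mul (by norm_num), show (36 : ℝ) = 6 ^ 2 by norm_num,
        Real.sqrt_sq (by norm_num)]]
    exact Real.sqrt_le_sqrt hR36
  have hsqS : √S ≤ 4 * √L := by
    rw [show (4 : ℝ) * √L = √(16 * L) by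
      rw [Real.sqrt_mul (by norm_num), show (16 : ℝ) = 4 ^ 2 by norm_num,
        Real.sqrt_sq (by norm_num)]]
    exact Real.sqrt_le_sqrt hS2
  have hsqs : √s ≤ 4 * √L := (Real.sqrt_le_sqrt hsS).trans hsqS
  have hsqa : √J / 2 ≤ √a := by
    rw [show √J / 2 = √(J / 4) by
      rw [Real.sqrt_div hJ.le, show (4 : ℝ) = 2 ^ 2 by norm_num, Real.sqrt_sq (by norm_num)]]
    exact Real.sqrt_le_sqrt ha1
  have hsqb : √J / 2 ≤ √b := by
    have := Real.sqrt_le_sqrt hb1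
    linarith
  -- Exceeds all Fresnel arguments at both endpoints, so one constant `fresnel V` serves throughout.
  set V := (√(R * b) + √(Y / b)) + (√(R * a) + √(Y / a)) with hV
  set c := 10 * (√L / √J) with hc
  have hcK : ∀ x : ℝ, √J / 2 ≤ x → 10 * √L / (2 * x) ≤ c := by
    intro x hx
    rw [hc, div_le_iff₀ (by linarith)]
    have : 10 * (√L / √J) * (2 * (√J / 2)) ≤ 10 * (√L / √J) * (2 * x) := by gcongr
    refine le_trans (le_of_eq ?_) this
    field_simp
  set σb : ℕ → ℝ := fun r => if s < r then 1 else -1 with hσb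
  set σa : ℕ → ℝ := fun r => if S < r then 1 else -1 with hσa
  set Eb : ℕ → ℝ := fun r => ‖fresnel (√(r * b) - √(Y / b)) - (σb r : ℂ) * fresnel V‖ with hEb
  set Ea : ℕ → ℝ := fun r => ‖fresnel (√(r * a) - √(Y / a)) - (σa r : ℂ) * fresnel V‖ with hEa
  have hErr : 8 + 4 * c * √R ≤ 8 + 240 * (L / √J) := by
    have h1 : 4 * c * √R ≤ 4 * c * (6 * √L) := by gcongr
    have h2 : 4 * c * (6 * √L) = 240 * (L / √J) := by
      rw [hc]
      have := Real.mul_self_sqrt hL0.le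
      field_simp
      nlinarith
    linarith
  have hEb_sum : ∑ r ∈ Finset.range (R + 1), Eb r ≤ 8 + 240 * (L / √J) :=
    (sum_fresnel_error_le (K := 10 * √L) hY0 hb0 hfls
      (by rw [hV]; have : 0 ≤ √(R * a) + √(Y / a) := by positivity
          linarith)
      (by positivity) (by rw [← hs]; linarith) (hcK _ hsqb)).trans hErr
  have hEa_sum : ∑ r ∈ Finset.range (R + 1), Ea r ≤ 8 + 240 * (L / √J) :=
    (sum_fresnel_error_le (K := 10 * √L) hY0 ha0 hflS
      (by rw [hV]; have : 0 ≤ √(R * b) + √(Y / b) := by positivity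
          linarith)
      (by positivity) (by rw [← hS]; linarith) (hcK _ hsqa)).trans hErr
  set r₀ := ⌊s / 2⌋₊ with hr₀
  have hr₀' : ∀ r ∈ Finset.Ioc r₀ R, L / 8 ≤ r := by
    intro r hr
    have := (Nat.floor_lt (show 0 ≤ s / 2 by positivity)).1 (Finset.mem_Ioc.1 hr).1
    linarith
  set G := 8 * (√J / √L) with hG
  have hG0 : 0 < G := by positivity
  set w : ℕ → ℝ := fun r => dualAmplitude Y r with hw
  set z : ℕ → ℂ := fun r => ee (2 * √(Y * r) - α * r) with hz
  set main : ℕ → ℂ := fun r => fresnel V * (((σb r - σa r : ℝ) : ℂ) * ((w r : ℂ) * z r)) with hmain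
  have hterm : ∀ r ∈ Finset.Ioc r₀ R,
      ‖ee (-(r * α)) * dualIntegral Y a b r - main r‖ ≤ 8 / L + G * (Eb r + Ea r) := by
    intro r hr
    have hrL := hr₀' r hr
    have hr0 : (0 : ℝ) < r := lt_of_lt_of_le (by positivity) hrL
    have h1 := norm_dualIntegral_sub_fresnel_le hY0 ha0 hab hr0
    set Fb := fresnel (√(r * b) - √(Y / b)) with hFb
    set Fa := fresnel (√(r * a) - √(Y / a)) with hFa
    set D := dualIntegral Y a b r with hD
    have hzr : z r = ee (-(r * α)) * ee (2 * √(Y * r)) := by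
      simp only [hz]
      rw [← ee_add]; congr 1; ring
    have e : ee (-(r * α)) * D - main r
        = ee (-(r * α)) * (D - (w r : ℂ) * ee (2 * √(Y * r)) * (Fb - Fa))
          + (w r : ℂ) * z r * ((Fb - (σb r : ℂ) * fresnel V) - (Fa - (σa r : ℂ) * fresnel V)) := by
      simp only [hmain]
      rw [hzr]
      push_cast
      ring
    rw [e]
    refine (norm_add_le _ _).trans (add_le_add ?_ ?_)
    · rw [norm_mul, norm_ee, one_mul]
      refine h1.trans ?_
      rw [div_le_div_iff₀ hr0 hL0]
      linarith
    · rw [norm_mul, norm_mul, Complex.norm_real, show ‖z r‖ = 1 from norm_ee _, mul_one,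
        Real.norm_of_nonneg (dualAmplitude_nonneg hY0.le hr0.le)]
      refine mul_le_mul (dualAmplitude_le hJ hL0 hrL) (norm_sub_le _ _) (norm_nonneg _) hG0.le
  have herr : ‖∑ r ∈ Finset.Ioc r₀ R, (ee (-(r * α)) * dualIntegral Y a b r - main r)‖
      ≤ 288 + 2 * G * (8 + 240 * (L / √J)) := by
    refine (norm_sum_le_of_le _ hterm).trans ?_
    rw [Finset.sum_add_distrib, ← Finset.mul_sum, Finset.sum_add_distrib]
    have hsub : Finset.Ioc r₀ R ⊆ Finset.range (R + 1) := by
      intro r hr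
      rw [Finset.mem_Ioc] at hr
      exact Finset.mem_range.2 (by omega)
    have h1 := Finset.sum_le_sum_of_subset_of_nonneg (f := Eb) hsub fun r _ _ => norm_nonneg _
    have h2 := Finset.sum_le_sum_of_subset_of_nonneg (f := Ea) hsub fun r _ _ => norm_nonneg _
    have h3 : ∑ _r ∈ Finset.Ioc r₀ R, 8 / L ≤ 288 := by
      rw [Finset.sum_const, Nat.card_Ioc, nsmul_eq_mul]
      have : ((R - r₀ : ℕ) : ℝ) ≤ 36 * L := le_trans (by exact_mod_cast Nat.sub_le _ _) hR36
      calc ((R - r₀ : ℕ) : ℝ) * (8 / L) ≤ 36 * L * (8 / L) := by gcongr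
        _ = 288 := by field_simp; norm_num
    have h4 : G * (∑ r ∈ Finset.Ioc r₀ R, Eb r + ∑ r ∈ Finset.Ioc r₀ R, Ea r)
        ≤ G * ((8 + 240 * (L / √J)) + (8 + 240 * (L / √J))) := by
      gcongr
      · exact h1.trans hEb_sum
      · exact h2.trans hEa_sum
    linarith
  have hmainsum : ‖∑ r ∈ Finset.Ioc r₀ R, main r‖ ≤ 4 * G * B := by
    have hfilter : (Finset.Ioc r₀ R).filter (fun r : ℕ => s < r ∧ (r : ℝ) ≤ S)
        = Finset.Ioc ⌊s⌋₊ ⌊S⌋₊ := by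
      ext r
      simp only [Finset.mem_filter, Finset.mem_Ioc]
      rw [Nat.floor_lt hs0.le, Nat.le_floor_iff (by positivity)]
      constructor
      · rintro ⟨-, h⟩; exact h
      · intro h
        refine ⟨⟨?_, ?_⟩, h⟩
        · rw [hr₀, Nat.floor_lt (by positivity)]; linarith
        · have : (r : ℝ) ≤ R := by linarith
          exact_mod_cast this
    -- The difference `σb r - σa r` is 2 for `s < r ≤ S` and 0 otherwise.
    have e : ∑ r ∈ Finset.Ioc r₀ R, main r
        = 2 * fresnel V * ∑ r ∈ Finset.Ioc ⌊s⌋₊ ⌊S⌋₊, (w r : ℂ) * z r := by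
      rw [← hfilter, Finset.sum_filter, Finset.mul_sum]
      refine Finset.sum_congr rfl fun r _ => ?_
      simp only [hmain, hσb, hσa]
      by_cases h1 : s < r
      · by_cases h2 : S < r
        · rw [if_pos h1, if_pos h2, if_neg (fun h => absurd h.2 (not_le.2 h2))]
          simp
        · rw [if_pos h1, if_neg h2, if_pos ⟨h1, not_lt.1 h2⟩]
          push_cast
          ring
      · have h2 : ¬ S < r := fun h => h1 (lt_of_le_of_lt hsS h)
        rw [if_neg h1, if_neg h2, if_neg (fun h => h1 h.1)]
        simp
    have hVpos : 0 ≤ V := by positivity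
    have hB0 : 0 ≤ B := (norm_nonneg _).trans (hB 0 (Nat.zero_le _))
    have hsum : ‖∑ r ∈ Finset.Ioc ⌊s⌋₊ ⌊S⌋₊, (w r : ℂ) * z r‖ ≤ G * B := by
      rcases le_or_gt ⌊S⌋₊ ⌊s⌋₊ with h | h
      · rw [Finset.Ioc_eq_empty (by omega)]; simp; positivity
      have hpos : ∀ r : ℕ, ⌊s⌋₊ < r → s < r := fun r hr => (Nat.floor_lt hs0.le).1 hr
      refine (norm_sum_antitone_mul_le h (fun r hr => ?_) (fun r hr => ?_) hB).trans ?_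
      · exact dualAmplitude_nonneg hY0.le (Nat.cast_nonneg r)
      · have := hpos r hr
        exact dualAmplitude_anti hY0.le (by linarith) (by push_cast; linarith)
      · apply mul_le_mul_of_nonneg_right _ hB0
        have := hpos (⌊s⌋₊ + 1) (Nat.lt_succ_self _)
        exact dualAmplitude_le hJ hL0 (by linarith)
    rw [e, norm_mul, norm_mul]
    have h2 : ‖(2 : ℂ)‖ = 2 := by norm_num
    rw [h2]
    have h3 := norm_fresnel_le hVpos
    calc 2 * ‖fresnel V‖ * ‖∑ r ∈ Finset.Ioc ⌊s⌋₊ ⌊S⌋₊, (w r : ℂ) * z r‖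
        ≤ 2 * 2 * (G * B) := by gcongr
      _ = 4 * G * B := by ring
  have hfin : ∑ r ∈ Finset.Ioc r₀ R, ee (-(r * α)) * dualIntegral Y a b r
      = ∑ r ∈ Finset.Ioc r₀ R, (ee (-(r * α)) * dualIntegral Y a b r - main r)
        + ∑ r ∈ Finset.Ioc r₀ R, main r := by
    rw [← Finset.sum_add_distrib]
    exact Finset.sum_congr rfl fun r _ => by ring
  rw [hfin]
  refine (norm_add_le _ _).trans ((add_le_add herr hmainsum).trans (le_of_eq ?_))
  rw [hG]
  ring

/-! ### The pair `(2/7, 4/7)` for reciprocal phases -/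

/-- A bound of exponent pair type for the phases `Y / (n + α)` over dyadic blocks. -/
def RecipSumBound (k l C : ℝ) : Prop :=
  ∀ (J : ℕ) (α Y : ℝ), 1 ≤ J → 0 ≤ α → α ≤ 1 → (J : ℝ) ^ 2 ≤ Y →
    ‖∑ n ∈ Finset.Ioc (J / 2) J, ee (Y / (n + α))‖ ≤ C * ((Y / J ^ 2) ^ k * (J : ℝ) ^ l)

/-- The third difference test gives `L^(1/6) J^(2/3) + L^(-1/6) J^(5/6)`. The first term equals
`L^(2/7) J^(4/7)` exactly at `L = J^(4/5)`, and this is the source of the threshold. -/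
theorem exists_norm_sum_recip_le_of_large :
    ∃ C : ℝ, 0 < C ∧ ∀ (J : ℕ) (α L : ℝ), 1 ≤ J → 0 ≤ α → α ≤ 1 → 1 ≤ L →
      (J : ℝ) ^ (4 / 5 : ℝ) ≤ L →
      ‖∑ n ∈ Finset.Ioc (J / 2) J, ee (L * (J : ℝ) ^ 2 / (n + α))‖
        ≤ C * (L ^ (2 / 7 : ℝ) * (J : ℝ) ^ (4 / 7 : ℝ)) := by
  obtain ⟨C₃, hC₃, h3⟩ := exists_norm_sum_recip_le_third
  refine ⟨2 * C₃, by positivity, fun J α L hJ hα0 hα1 hL hcase => ?_⟩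
  have hJ1 : (1 : ℝ) ≤ J := by exact_mod_cast hJ
  have hJ0 : (0 : ℝ) < J := by linarith
  have hL0 : 0 < L := by linarith
  set T := L ^ (2 / 7 : ℝ) * (J : ℝ) ^ (4 / 7 : ℝ) with hT
  have hL1 : 1 ≤ L ^ (2 / 7 : ℝ) := Real.one_le_rpow hL (by norm_num)
  have hJp : 1 ≤ (J : ℝ) ^ (4 / 7 : ℝ) := Real.one_le_rpow hJ1 (by norm_num)
  have hb := h3 J α (L * J ^ 2) hJ hα0 hα1 (by positivity)
  have e1 : L * (J : ℝ) ^ 2 / J ^ 4 = L * (J : ℝ) ^ (-2 : ℝ) := by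
    rw [Real.rpow_neg hJ0.le, Real.rpow_two]; field_simp
  rw [e1, Real.mul_rpow hL0.le (by positivity), Real.mul_rpow hL0.le (by positivity),
    ← Real.rpow_mul hJ0.le, ← Real.rpow_mul hJ0.le] at hb
  have hcmp : ∀ x y : ℝ, x ≤ 2 / 7 → y - 4 / 7 ≤ (2 / 7 - x) * (4 / 5) →
      L ^ x * (J : ℝ) ^ y ≤ T := by
    intro x y hx hy
    have h1 : ((J : ℝ) ^ (4 / 5 : ℝ)) ^ (2 / 7 - x) ≤ L ^ (2 / 7 - x) :=
      Real.rpow_le_rpow (by positivity) hcase (by linarith)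
    rw [← Real.rpow_mul hJ0.le] at h1
    have h2 : (J : ℝ) ^ (y - 4 / 7) ≤ L ^ (2 / 7 - x) :=
      (Real.rpow_le_rpow_of_exponent_le hJ1 (by linarith)).trans h1
    calc L ^ x * (J : ℝ) ^ y = L ^ x * ((J : ℝ) ^ (y - 4 / 7) * (J : ℝ) ^ (4 / 7 : ℝ)) := by
          rw [← Real.rpow_add hJ0]; ring_nf
      _ ≤ L ^ x * (L ^ (2 / 7 - x) * (J : ℝ) ^ (4 / 7 : ℝ)) := by gcongr
      _ = T := by rw [← mul_assoc, ← Real.rpow_add hL0, hT]; ring_nf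
  have t1 := hcmp (1 / 6) (2 / 3) (by norm_num) (by norm_num)
  have t2 := hcmp (-(1 / 6)) (5 / 6) (by norm_num) (by norm_num)
  have e2 : (J : ℝ) * (L ^ (1 / 6 : ℝ) * (J : ℝ) ^ (-2 * (1 / 6) : ℝ))
      = L ^ (1 / 6 : ℝ) * (J : ℝ) ^ (2 / 3 : ℝ) := by
    rw [mul_left_comm, show (2 / 3 : ℝ) = 1 + -2 * (1 / 6) by norm_num, Real.rpow_add hJ0,
      Real.rpow_one]
  have e3 : (J : ℝ) ^ (1 / 2 : ℝ) * (L ^ (-(1 / 6) : ℝ) * (J : ℝ) ^ (-2 * -(1 / 6) : ℝ))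
      = L ^ (-(1 / 6) : ℝ) * (J : ℝ) ^ (5 / 6 : ℝ) := by
    rw [mul_left_comm, ← Real.rpow_add hJ0]; norm_num
  rw [e2, e3] at hb
  have : C₃ * (L ^ (1 / 6 : ℝ) * (J : ℝ) ^ (2 / 3 : ℝ)
      + L ^ (-(1 / 6) : ℝ) * (J : ℝ) ^ (5 / 6 : ℝ)) ≤ C₃ * (T + T) := by gcongr
  linarith

/-- The fourth difference test bounds the dual sum, whose length is of order `L`. Multiplied by the
amplitude `√(J / L)`, its first term is `L^(2/7) J^(4/7)` for every `L`; its second term is no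
larger precisely when `L ≤ J^(4/5)`. -/
theorem exists_norm_sum_recip_le_of_small :
    ∃ C : ℝ, 0 < C ∧ ∀ (J : ℕ) (α L : ℝ), 1 ≤ J → 0 ≤ α → α ≤ 1 → 1 ≤ L →
      L < (J : ℝ) ^ (4 / 5 : ℝ) →
      ‖∑ n ∈ Finset.Ioc (J / 2) J, ee (L * (J : ℝ) ^ 2 / (n + α))‖
        ≤ C * (L ^ (2 / 7 : ℝ) * (J : ℝ) ^ (4 / 7 : ℝ)) := by
  obtain ⟨C₄, hC₄, h4⟩ := exists_norm_sum_sqrt_le_fourth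
  refine ⟨143 + 288 + 128 + 3840 + 64 * C₄, by positivity,
    fun J α L hJ hα0 hα1 hL hcase => ?_⟩
  have hJ1 : (1 : ℝ) ≤ J := by exact_mod_cast hJ
  have hJ0 : (0 : ℝ) < J := by linarith
  have hL0 : 0 < L := by linarith
  set T := L ^ (2 / 7 : ℝ) * (J : ℝ) ^ (4 / 7 : ℝ) with hT
  have hL1 : 1 ≤ L ^ (2 / 7 : ℝ) := Real.one_le_rpow hL (by norm_num)
  have hJp : 1 ≤ (J : ℝ) ^ (4 / 7 : ℝ) := Real.one_le_rpow hJ1 (by norm_num)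
  have hY : (J : ℝ) ^ 2 ≤ L * (J : ℝ) ^ 2 := le_mul_of_one_le_left (by positivity) hL
  rcases Nat.lt_or_ge J 2 with hJ2 | hJ2
  -- The dual formula needs a positive left endpoint `J / 2`, so `J = 1` is treated separately.
  · have : J = 1 := by omega
    subst this
    refine (norm_sum_ee_le_card _ _).trans ?_
    have h1 : 1 ≤ T := one_le_mul_of_one_le_of_one_le hL1 hJp
    have h2 : (0 : ℝ) ≤ C₄ * T := by positivity
    simp only [Nat.card_Ioc]
    norm_num
    linarith
  have hcmp : ∀ x y : ℝ, 2 / 7 ≤ x → y + (x - 2 / 7) * (4 / 5) ≤ 4 / 7 →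
      L ^ x * (J : ℝ) ^ y ≤ T := by
    intro x y hx hy
    have h1 : L ^ (x - 2 / 7) ≤ ((J : ℝ) ^ (4 / 5 : ℝ)) ^ (x - 2 / 7) :=
      Real.rpow_le_rpow hL0.le hcase.le (by linarith)
    rw [← Real.rpow_mul hJ0.le] at h1
    calc L ^ x * (J : ℝ) ^ y = L ^ (2 / 7 : ℝ) * (L ^ (x - 2 / 7) * (J : ℝ) ^ y) := by
          rw [← mul_assoc, ← Real.rpow_add hL0]; ring_nf
      _ ≤ L ^ (2 / 7 : ℝ) * ((J : ℝ) ^ (4 / 5 * (x - 2 / 7)) * (J : ℝ) ^ y) := by gcongr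
      _ ≤ L ^ (2 / 7 : ℝ) * (J : ℝ) ^ (4 / 7 : ℝ) := by
          rw [← Real.rpow_add hJ0]
          gcongr
          linarith
  have hA4 : (J : ℝ) / 4 ≤ ((J / 2 : ℕ) : ℝ) := by
    have : J ≤ 4 * (J / 2) := by omega
    have h2 : (J : ℝ) ≤ 4 * ((J / 2 : ℕ) : ℝ) := by exact_mod_cast this
    linarith
  have hA1 : ((J / 2 : ℕ) : ℝ) + 1 ≤ J := by
    have : J / 2 + 1 ≤ J := by omega
    exact_mod_cast this
  set a := ((J / 2 : ℕ) : ℝ) + α with ha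
  set b := (J : ℝ) + α with hb
  have ha1 : (J : ℝ) / 4 ≤ a := by rw [ha]; linarith
  have ha2 : a ≤ J := by rw [ha]; linarith
  have hb1 : (J : ℝ) ≤ b := by rw [hb]; linarith
  have hb2 : b ≤ 2 * J := by rw [hb]; linarith
  have ha0 : 0 < a := by linarith
  have hb0 : 0 < b := by linarith
  have hs1 : L / 4 ≤ L * J ^ 2 / b ^ 2 := by
    rw [le_div_iff₀ (by positivity)]
    have : b ^ 2 ≤ (2 * J) ^ 2 := by gcongr
    nlinarith
  have hS2 : L * J ^ 2 / a ^ 2 ≤ 16 * L := by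
    rw [div_le_iff₀ (by positivity)]
    have : ((J : ℝ) / 4) ^ 2 ≤ a ^ 2 := by gcongr
    nlinarith
  have hd := norm_sum_ee_le_dual hJ2 hα0 hα1 hY
  have hdual := norm_dual_sum_le (α := α) hJ0 hL ha1 ha2 hb1 hb2 (fun m hm =>
    h4 ⌊L * J ^ 2 / b ^ 2⌋₊ m α (L * J ^ 2) L (by positivity) hL
      (by have := Nat.lt_floor_add_one (L * (J : ℝ) ^ 2 / b ^ 2); linarith)
      (by
        have h1 : (m : ℝ) ≤ ⌊L * (J : ℝ) ^ 2 / a ^ 2⌋₊ := by exact_mod_cast hm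
        have h2 := Nat.floor_le (show 0 ≤ L * (J : ℝ) ^ 2 / a ^ 2 by positivity)
        linarith))
  have e0 : √(L * (J : ℝ) ^ 2) * L ^ (-(7 / 2) : ℝ) = J * L ^ (-3 : ℝ) := by
    rw [Real.sqrt_mul hL0.le, Real.sqrt_sq hJ0.le, Real.sqrt_eq_rpow, mul_comm, ← mul_assoc,
      ← Real.rpow_add hL0, mul_comm]
    norm_num
  rw [e0, Real.mul_rpow hJ0.le (by positivity), Real.mul_rpow hJ0.le (by positivity),
    ← Real.rpow_mul hL0.le, ← Real.rpow_mul hL0.le] at hdual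
  have eG : √(J : ℝ) / √L = L ^ (-(1 / 2) : ℝ) * (J : ℝ) ^ (1 / 2 : ℝ) := by
    rw [Real.sqrt_eq_rpow, Real.sqrt_eq_rpow, Real.rpow_neg hL0.le, div_eq_mul_inv, mul_comm]
  have i1 : √(J : ℝ) / √L ≤ T := by
    have h1 : √(J : ℝ) / √L ≤ √(J : ℝ) := by
      apply div_le_self (Real.sqrt_nonneg _)
      rw [Real.one_le_sqrt]; exact hL
    refine h1.trans ?_
    rw [Real.sqrt_eq_rpow]
    calc (J : ℝ) ^ (1 / 2 : ℝ) ≤ (J : ℝ) ^ (4 / 7 : ℝ) :=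
          Real.rpow_le_rpow_of_exponent_le hJ1 (by norm_num)
      _ ≤ T := le_mul_of_one_le_left (by positivity) hL1
  have i2 : √(J : ℝ) / √L * (L / √J) ≤ T := by
    have h1 : √(J : ℝ) / √L * (L / √J) = L ^ (1 / 2 : ℝ) * (J : ℝ) ^ (0 : ℝ) := by
      have h2 : 0 < √(J : ℝ) := Real.sqrt_pos.2 hJ0
      rw [Real.rpow_zero, mul_one, ← Real.sqrt_eq_rpow, div_mul_div_comm, mul_comm (√L),
        mul_div_mul_left _ _ h2.ne', Real.div_sqrt]
    rw [h1]
    exact hcmp _ _ (by norm_num) (by norm_num)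
  have i3 : √(J : ℝ) / √L * (L * ((J : ℝ) ^ (1 / 14 : ℝ) * L ^ (-3 * (1 / 14) : ℝ))) ≤ T := by
    have h1 : √(J : ℝ) / √L * (L * ((J : ℝ) ^ (1 / 14 : ℝ) * L ^ (-3 * (1 / 14) : ℝ)))
        = (L ^ (-(1 / 2) : ℝ) * L ^ (1 : ℝ) * L ^ (-3 * (1 / 14) : ℝ))
          * ((J : ℝ) ^ (1 / 2 : ℝ) * (J : ℝ) ^ (1 / 14 : ℝ)) := by
      rw [eG, Real.rpow_one]; ring
    rw [h1, ← Real.rpow_add hL0, ← Real.rpow_add hL0, ← Real.rpow_add hJ0]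
    exact hcmp _ _ (by norm_num) (by norm_num)
  have i4 : √(J : ℝ) / √L * (L ^ (3 / 4 : ℝ)
      * ((J : ℝ) ^ (-(1 / 14) : ℝ) * L ^ (-3 * -(1 / 14) : ℝ))) ≤ T := by
    have h1 : √(J : ℝ) / √L * (L ^ (3 / 4 : ℝ)
        * ((J : ℝ) ^ (-(1 / 14) : ℝ) * L ^ (-3 * -(1 / 14) : ℝ)))
        = (L ^ (-(1 / 2) : ℝ) * L ^ (3 / 4 : ℝ) * L ^ (-3 * -(1 / 14) : ℝ))
          * ((J : ℝ) ^ (1 / 2 : ℝ) * (J : ℝ) ^ (-(1 / 14) : ℝ)) := by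
      rw [eG]; ring
    rw [h1, ← Real.rpow_add hL0, ← Real.rpow_add hL0, ← Real.rpow_add hJ0]
    exact hcmp _ _ (by norm_num) (by norm_num)
  have hT1 : 1 ≤ T := one_le_mul_of_one_le_of_one_le hL1 hJp
  refine (hd.trans (add_le_add_right hdual 143)).trans ?_
  have j1 := mul_le_mul_of_nonneg_left i3 hC₄.le
  have j2 := mul_le_mul_of_nonneg_left i4 hC₄.le
  have key : ∀ G K A B : ℝ, G ≤ T → G * K ≤ T → C₄ * (G * A) ≤ C₄ * T → C₄ * (G * B) ≤ C₄ * T →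
      143 + (288 + 16 * G * (8 + 240 * K) + 32 * G * (C₄ * (A + B)))
        ≤ (143 + 288 + 128 + 3840 + 64 * C₄) * T := by
    intro G K A B _ _ _ _
    linarith
  exact key _ _ _ _ i1 i2 j1 j2

theorem exists_recipSumBound_two_sevenths :
    ∃ C : ℝ, 0 < C ∧ RecipSumBound (2 / 7) (4 / 7) C := by
  obtain ⟨C, hC, h⟩ := exists_norm_sum_recip_le_of_large
  obtain ⟨C', hC', h'⟩ := exists_norm_sum_recip_le_of_small
  refine ⟨C + C', by positivity, fun J α Y hJ hα0 hα1 hY => ?_⟩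
  have hJ0 : (0 : ℝ) < J := by exact_mod_cast hJ
  obtain ⟨L, rfl⟩ : ∃ L, Y = L * (J : ℝ) ^ 2 := ⟨Y / (J : ℝ) ^ 2, by field_simp⟩
  have hL : 1 ≤ L := by
    have : 1 * (J : ℝ) ^ 2 ≤ L * (J : ℝ) ^ 2 := by linarith
    exact le_of_mul_le_mul_right this (by positivity)
  rw [show L * (J : ℝ) ^ 2 / J ^ 2 = L by field_simp, add_mul]
  rcases le_or_gt ((J : ℝ) ^ (4 / 5 : ℝ)) L with hcase | hcase
  · exact (h J α L hJ hα0 hα1 hL hcase).trans (le_add_of_nonneg_right (by positivity))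
  · exact (h' J α L hJ hα0 hα1 hL hcase).trans (le_add_of_nonneg_left (by positivity))

/-! ### Sawtooth sums from exponential sums -/

/-- The sawtooth function `t - ⌊t⌋ - 1 / 2`. -/
noncomputable def saw (t : ℝ) : ℝ := Int.fract t - 1 / 2

/-- The periodic second Bernoulli function. -/
noncomputable def bernoulliTwo (t : ℝ) : ℝ := Int.fract t ^ 2 - Int.fract t + 1 / 6

theorem abs_saw_le (t : ℝ) : |saw t| ≤ 1 / 2 := by
  have h1 := Int.fract_nonneg t
  have h2 := Int.fract_lt_one t
  rw [saw, abs_le]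
  constructor <;> linarith

theorem hasSum_bernoulliTwo (t : ℝ) :
    HasSum (fun r : ℕ => 1 / ((r + 1 : ℕ) : ℝ) ^ 2 * Real.cos (2 * Real.pi * (r + 1 : ℕ) * t))
      (Real.pi ^ 2 * bernoulliTwo t) := by
  have h := hasSum_cos_div_sq (t := Int.fract t) ⟨Int.fract_nonneg t, (Int.fract_lt_one t).le⟩
  rw [bernoulliTwo]
  convert h using 1
  funext r
  congr 1
  rw [← Real.cos_add_int_mul_two_pi (2 * Real.pi * (r + 1 : ℕ) * Int.fract t) ((r + 1 : ℕ) * ⌊t⌋)]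
  congr 1
  push_cast
  have := Int.fract_add_floor t
  calc 2 * Real.pi * (r + 1) * t = 2 * Real.pi * (r + 1) * (Int.fract t + ⌊t⌋) := by rw [this]
    _ = _ := by ring

/-- The quotient is the mean of `saw` over `[x - δ, x]`, as `bernoulliTwo` has derivative `2 saw`.
The sawtooth rises with slope 1 and jumps only downwards, so this mean is at least `saw x - δ/2`.
Unlike `saw`, the quotient has an absolutely convergent Fourier series. -/
theorem saw_le_bernoulliTwo {δ : ℝ} (h0 : 0 < δ) (h1 : δ ≤ 1) (x : ℝ) :
    saw x ≤ δ / 2 + (bernoulliTwo x - bernoulliTwo (x - δ)) / (2 * δ) := by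
  have hf := Int.fract_nonneg x
  have hf1 := Int.fract_lt_one x
  have hx := Int.fract_add_floor x
  rw [← sub_le_iff_le_add', le_div_iff₀ (by positivity), saw, bernoulliTwo, bernoulliTwo]
  rcases le_or_gt δ (Int.fract x) with h | h
  · have e : Int.fract (x - δ) = Int.fract x - δ :=
      Int.fract_eq_iff.2 ⟨by linarith, by linarith, ⌊x⌋, by linarith⟩
    rw [e]; nlinarith
  · have e : Int.fract (x - δ) = Int.fract x - δ + 1 :=
      Int.fract_eq_iff.2 ⟨by linarith, by linarith, ⌊x⌋ - 1, by push_cast; linarith⟩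
    rw [e]; nlinarith

theorem bernoulliTwo_le_saw {δ : ℝ} (h0 : 0 < δ) (h1 : δ ≤ 1) (x : ℝ) :
    (bernoulliTwo (x + δ) - bernoulliTwo x) / (2 * δ) - δ / 2 ≤ saw x := by
  have hf := Int.fract_nonneg x
  have hf1 := Int.fract_lt_one x
  have hx := Int.fract_add_floor x
  rw [sub_le_iff_le_add, div_le_iff₀ (by positivity), saw, bernoulliTwo, bernoulliTwo]
  rcases lt_or_ge (Int.fract x + δ) 1 with h | h
  · have e : Int.fract (x + δ) = Int.fract x + δ :=
      Int.fract_eq_iff.2 ⟨by linarith, by linarith, ⌊x⌋, by linarith⟩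
    rw [e]; nlinarith
  · have e : Int.fract (x + δ) = Int.fract x + δ - 1 :=
      Int.fract_eq_iff.2 ⟨by linarith, by linarith, ⌊x⌋ + 1, by push_cast; linarith⟩
    rw [e]; nlinarith

theorem norm_ee_sub_one_le (t : ℝ) : ‖ee t - 1‖ ≤ 2 * Real.pi * |t| := by
  have h := Real.norm_exp_I_mul_ofReal_sub_one_le (x := 2 * Real.pi * t)
  have e : ee t = Complex.exp (Complex.I * (2 * Real.pi * t : ℝ)) := by
    rw [ee_eq]; congr 1; push_cast; ring
  rw [e]
  refine h.trans (le_of_eq ?_)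
  rw [Real.norm_eq_abs, abs_mul, abs_of_pos (by positivity)]

/-- Translation by `η` multiplies the exponential sum of frequency `r` by `e(rη)`, and `|e(rη) - 1|`
has a trivial bound and a Lipschitz bound. -/
theorem abs_sum_cos_sub_le (A : Finset ℕ) (y : ℕ → ℝ) (r η : ℝ) :
    |∑ n ∈ A, (Real.cos (2 * Real.pi * r * (y n + η)) - Real.cos (2 * Real.pi * r * y n))|
      ≤ min 2 (2 * Real.pi * |r * η|) * ‖∑ n ∈ A, ee (r * y n)‖ := by
  have e : ∑ n ∈ A, (Real.cos (2 * Real.pi * r * (y n + η)) - Real.cos (2 * Real.pi * r * y n))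
      = ((ee (r * η) - 1) * ∑ n ∈ A, ee (r * y n)).re := by
    rw [Finset.mul_sum, Complex.re_sum]
    refine Finset.sum_congr rfl fun n _ => ?_
    rw [sub_mul, one_mul, ← ee_add, Complex.sub_re, ee_re, ee_re]
    congr 2 <;> ring
  rw [e]
  refine (Complex.abs_re_le_norm _).trans ?_
  rw [norm_mul]
  refine mul_le_mul_of_nonneg_right (le_min ?_ (norm_ee_sub_one_le _)) (norm_nonneg _)
  refine (norm_sub_le _ _).trans ?_
  rw [norm_ee, norm_one]; norm_num

theorem abs_sum_bernoulliTwo_sub_le (A : Finset ℕ) (y : ℕ → ℝ) {H η G : ℝ} (hH : 0 < H)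
    (hη : |η| = 1 / H) {g : ℕ → ℝ} (hg : HasSum g G)
    (h : ∀ r : ℕ, min (1 / ((r + 1 : ℕ) : ℝ)) (H / ((r + 1 : ℕ) : ℝ) ^ 2)
      * ‖∑ n ∈ A, ee ((r + 1 : ℕ) * y n)‖ ≤ g r) :
    |∑ n ∈ A, (bernoulliTwo (y n + η) - bernoulliTwo (y n))| ≤ 2 / H * G := by
  have hπ := Real.pi_pos
  have h1 : HasSum (fun r : ℕ => 1 / ((r + 1 : ℕ) : ℝ) ^ 2
      * ∑ n ∈ A, (Real.cos (2 * Real.pi * (r + 1 : ℕ) * (y n + η))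
        - Real.cos (2 * Real.pi * (r + 1 : ℕ) * y n)))
      (Real.pi ^ 2 * ∑ n ∈ A, (bernoulliTwo (y n + η) - bernoulliTwo (y n))) := by
    have := hasSum_sum (s := A) fun n _ =>
      (hasSum_bernoulliTwo (y n + η)).sub (hasSum_bernoulliTwo (y n))
    simp only [← mul_sub, ← Finset.mul_sum] at this
    exact this
  have h2 : |Real.pi ^ 2 * ∑ n ∈ A, (bernoulliTwo (y n + η) - bernoulliTwo (y n))|
      ≤ 2 * Real.pi / H * G := by
    rw [← Real.norm_eq_abs]
    refine h1.norm_le_of_bounded (hg.mul_left (2 * Real.pi / H)) fun r => ?_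
    set m : ℝ := ((r + 1 : ℕ) : ℝ) with hm
    have hm0 : 0 < m := by rw [hm]; positivity
    rw [norm_mul, Real.norm_of_nonneg (by positivity)]
    have hb := abs_sum_cos_sub_le A y m η
    rw [Real.norm_eq_abs]
    refine le_trans ?_ (mul_le_mul_of_nonneg_left (h r) (by positivity))
    rw [← mul_assoc]
    refine (mul_le_mul_of_nonneg_left hb (by positivity)).trans ?_
    rw [← mul_assoc]
    refine mul_le_mul_of_nonneg_right ?_ (norm_nonneg _)
    rw [abs_mul, hη, abs_of_pos hm0, mul_min_of_nonneg _ _ (by positivity),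
      mul_min_of_nonneg _ _ (by positivity), min_comm]
    refine min_le_min (le_of_eq ?_) ?_
    · rw [← hm]; field_simp
    rw [← hm, show 2 * Real.pi / H * (H / m ^ 2) = 1 / m ^ 2 * (2 * Real.pi) by field_simp]
    refine mul_le_mul_of_nonneg_left ?_ (by positivity)
    linarith [Real.pi_gt_three]
  rw [abs_mul, abs_of_pos (by positivity)] at h2
  have h3 : 2 / H * G = 2 * Real.pi / H * G / Real.pi := by field_simp
  have h4 : 0 ≤ 2 * Real.pi / H * G := le_trans (by positivity) h2
  rw [h3, le_div_iff₀ hπ]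
  refine le_trans ?_ h2
  rw [mul_comm]
  refine mul_le_mul_of_nonneg_right ?_ (abs_nonneg _)
  nlinarith [Real.pi_gt_three]

/-- The one-sided approximations with `δ = 1 / H`: their bias costs at most `A.card / H`, and
frequencies beyond `H` carry the extra decay `H / r²`. -/
theorem abs_sum_saw_le (A : Finset ℕ) (y : ℕ → ℝ) {H G : ℝ} (hH : 1 ≤ H)
    {g : ℕ → ℝ} (hg : HasSum g G)
    (h : ∀ r : ℕ, min (1 / ((r + 1 : ℕ) : ℝ)) (H / ((r + 1 : ℕ) : ℝ) ^ 2)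
      * ‖∑ n ∈ A, ee ((r + 1 : ℕ) * y n)‖ ≤ g r) :
    |∑ n ∈ A, saw (y n)| ≤ A.card / H + G := by
  have hH0 : 0 < H := by linarith
  have hd0 : 0 < 1 / H := by positivity
  have hd1 : 1 / H ≤ 1 := by rw [div_le_one hH0]; exact hH
  have hp := abs_le.1 (abs_sum_bernoulliTwo_sub_le A y hH0 (η := 1 / H) (abs_of_pos hd0) hg h)
  have hm := abs_le.1 (abs_sum_bernoulliTwo_sub_le A y hH0 (η := -(1 / H))
    (by rw [abs_neg, abs_of_pos hd0]) hg h)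
  have hc : (0 : ℝ) ≤ A.card / H := by positivity
  rw [abs_le]
  constructor
  · have h1 := Finset.sum_le_sum fun n (_ : n ∈ A) => bernoulliTwo_le_saw hd0 hd1 (y n)
    rw [Finset.sum_sub_distrib, ← Finset.sum_div, Finset.sum_const, nsmul_eq_mul] at h1
    have h2 := div_le_div_of_nonneg_right hp.1 (show 0 ≤ 2 * (1 / H) by positivity)
    have e : -(2 / H * G) / (2 * (1 / H)) = -G := by field_simp
    have e2 : (A.card : ℝ) * (1 / H / 2) = A.card / H / 2 := by ring
    rw [e] at h2; rw [e2] at h1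
    linarith
  · have h1 := Finset.sum_le_sum fun n (_ : n ∈ A) => saw_le_bernoulliTwo hd0 hd1 (y n)
    rw [Finset.sum_add_distrib, ← Finset.sum_div A fun n => bernoulliTwo (y n) - _,
      Finset.sum_const, nsmul_eq_mul] at h1
    have h2 := div_le_div_of_nonneg_right hm.1 (show 0 ≤ 2 * (1 / H) by positivity)
    have e : -(2 / H * G) / (2 * (1 / H)) = -G := by field_simp
    have e2 : (A.card : ℝ) * (1 / H / 2) = A.card / H / 2 := by ring
    have e3 : ∑ n ∈ A, (bernoulliTwo (y n) - bernoulliTwo (y n - 1 / H))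
        = -∑ n ∈ A, (bernoulliTwo (y n + -(1 / H)) - bernoulliTwo (y n)) := by
      rw [← Finset.sum_neg_distrib]
      exact Finset.sum_congr rfl fun n _ => by rw [← sub_eq_add_neg]; ring
    rw [e] at h2; rw [e2, e3, neg_div] at h1
    linarith

/-! ### Optimising the Fourier cutoff and summing dyadic blocks -/

theorem mul_rpow_sub_one_le {k x : ℝ} (hk0 : 0 ≤ k) (hk1 : k ≤ 1) (hx : 0 ≤ x) :
    k * (x + 1) ^ (k - 1) ≤ (x + 1) ^ k - x ^ k := by
  have hx1 : 0 < x + 1 := by linarith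
  have h := rpow_one_add_le_one_add_mul_self (s := -(1 / (x + 1))) (p := k)
    (by rw [neg_le_neg_iff, div_le_one hx1]; linarith) hk0 hk1
  have e : x ^ k = (x + 1) ^ k * (1 + -(1 / (x + 1))) ^ k := by
    rw [← Real.mul_rpow hx1.le]
    · congr 1; field_simp; ring
    · rw [← sub_eq_add_neg, sub_nonneg, div_le_one hx1]; linarith
  have h2 := mul_le_mul_of_nonneg_left h (Real.rpow_nonneg hx1.le k)
  rw [← e] at h2
  have e2 : k * (x + 1) ^ (k - 1) = (x + 1) ^ k * (k * (1 / (x + 1))) := by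
    rw [Real.rpow_sub_one hx1.ne']; ring
  rw [e2]
  linarith

/-- The previous inequality for the exponent `1 - k`, multiplied by `x^(k-1) (x+1)^(k-1)`. -/
theorem mul_rpow_sub_two_le {k x : ℝ} (hk0 : 0 ≤ k) (hk1 : k ≤ 1) (hx : 0 < x) :
    (1 - k) * (x + 1) ^ (k - 2) ≤ x ^ (k - 1) - (x + 1) ^ (k - 1) := by
  have hx1 : 0 < x + 1 := by linarith
  have h := mul_rpow_sub_one_le (k := 1 - k) (x := x) (by linarith) (by linarith) hx.le
  have ha : 0 < x ^ (k - 1) := by positivity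
  have hb : 0 < (x + 1) ^ (k - 1) := by positivity
  have e1 : x ^ (k - 1) * x ^ (1 - k) = 1 := by
    rw [← Real.rpow_add hx]; norm_num
  have e2 : (x + 1) ^ (k - 1) * (x + 1) ^ (1 - k) = 1 := by
    rw [← Real.rpow_add hx1]; norm_num
  have e3 : (x + 1) ^ (k - 2) = (x + 1) ^ (k - 1) * (x + 1) ^ (k - 1) * (x + 1) ^ (1 - k - 1) := by
    rw [← Real.rpow_add hx1, ← Real.rpow_add hx1]; congr 1; ring
  have hle : (x + 1) ^ (k - 1) ≤ x ^ (k - 1) :=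
    Real.rpow_le_rpow_of_nonpos hx (by linarith) (by linarith)
  rw [e3]
  have hmul := mul_le_mul_of_nonneg_left h (mul_nonneg ha.le hb.le)
  have e4 : x ^ (k - 1) * (x + 1) ^ (k - 1) * ((x + 1) ^ (1 - k) - x ^ (1 - k))
      = x ^ (k - 1) - (x + 1) ^ (k - 1) := by
    linear_combination x ^ (k - 1) * e2 - (x + 1) ^ (k - 1) * e1
  rw [e4] at hmul
  refine le_trans ?_ hmul
  have hq : 0 ≤ (1 - k) * (x + 1) ^ (1 - k - 1) :=
    mul_nonneg (by linarith) (Real.rpow_nonneg hx1.le _)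
  have := mul_le_mul_of_nonneg_right (mul_le_mul_of_nonneg_right hle hb.le) hq
  linarith

/-- Up to `H` the terms `r^(k-1)` are dominated by increments of `r^k / k`, which is where `k > 0`
is needed. Beyond `H` the terms `H r^(k-2)` are dominated by decrements of `2 H r^(k-1)`. -/
theorem sum_range_min_mul_rpow_le {k : ℝ} (hk0 : 0 < k) (hk1 : k ≤ 1 / 2) {H : ℕ} (hH : 1 ≤ H)
    (n : ℕ) :
    ∑ r ∈ Finset.range n, min (1 / ((r + 1 : ℕ) : ℝ)) (H / ((r + 1 : ℕ) : ℝ) ^ 2)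
      * ((r + 1 : ℕ) : ℝ) ^ k ≤ (1 / k + 2) * (H : ℝ) ^ k := by
  have hH0 : (0 : ℝ) < H := by exact_mod_cast hH
  have t1 : ∀ r : ℕ, min (1 / ((r + 1 : ℕ) : ℝ)) (H / ((r + 1 : ℕ) : ℝ) ^ 2)
      * ((r + 1 : ℕ) : ℝ) ^ k ≤ 1 / k * (((r + 1 : ℕ) : ℝ) ^ k - (r : ℝ) ^ k) := by
    intro r
    have hr : (0 : ℝ) < ((r + 1 : ℕ) : ℝ) := by positivity
    have h := mul_rpow_sub_one_le hk0.le (by linarith) (Nat.cast_nonneg (α := ℝ) r)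
    rw [← Nat.cast_succ, Nat.succ_eq_add_one, Real.rpow_sub_one hr.ne'] at h
    rw [div_mul_eq_mul_div, one_mul, le_div_iff₀ hk0]
    calc _ ≤ 1 / ((r + 1 : ℕ) : ℝ) * ((r + 1 : ℕ) : ℝ) ^ k * k := by
          gcongr; exact min_le_left _ _
      _ ≤ _ := by refine le_trans (le_of_eq ?_) h; ring
  have s1 : ∀ m : ℕ, ∑ r ∈ Finset.range m,
      min (1 / ((r + 1 : ℕ) : ℝ)) (H / ((r + 1 : ℕ) : ℝ) ^ 2) * ((r + 1 : ℕ) : ℝ) ^ k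
        ≤ 1 / k * (m : ℝ) ^ k := by
    intro m
    refine (Finset.sum_le_sum fun r _ => t1 r).trans ?_
    rw [← Finset.mul_sum, Finset.sum_range_sub (fun r : ℕ => (r : ℝ) ^ k)]
    simp [Real.zero_rpow hk0.ne']
  rcases le_total n H with h | h
  · refine (s1 n).trans ?_
    have : (n : ℝ) ^ k ≤ (H : ℝ) ^ k := by gcongr
    have h2 : (0 : ℝ) ≤ (H : ℝ) ^ k := by positivity
    have : 1 / k * (n : ℝ) ^ k ≤ 1 / k * (H : ℝ) ^ k := by gcongr
    linarith
  · rw [← Finset.sum_range_add_sum_Ico _ h, add_mul]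
    refine add_le_add (s1 H) ?_
    have t2 : ∀ r ∈ Finset.Ico H n, min (1 / ((r + 1 : ℕ) : ℝ)) (H / ((r + 1 : ℕ) : ℝ) ^ 2)
        * ((r + 1 : ℕ) : ℝ) ^ k ≤ 2 * H * ((r : ℝ) ^ (k - 1) - ((r + 1 : ℕ) : ℝ) ^ (k - 1)) := by
      intro r hr
      have hr0 : (0 : ℝ) < r := by
        have := (Finset.mem_Ico.1 hr).1
        exact_mod_cast (by omega : 0 < r)
      have hr : (0 : ℝ) < ((r + 1 : ℕ) : ℝ) := by positivity
      have h := mul_rpow_sub_two_le hk0.le (by linarith) hr0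
      rw [← Nat.cast_succ, Nat.succ_eq_add_one] at h
      have e : ((r + 1 : ℕ) : ℝ) ^ (k - 2) = ((r + 1 : ℕ) : ℝ) ^ k / ((r + 1 : ℕ) : ℝ) ^ 2 := by
        rw [Real.rpow_sub hr, Real.rpow_two]
      have h0 : 0 ≤ ((r + 1 : ℕ) : ℝ) ^ (k - 2) := by positivity
      calc _ ≤ H / ((r + 1 : ℕ) : ℝ) ^ 2 * ((r + 1 : ℕ) : ℝ) ^ k := by
            gcongr; exact min_le_right _ _
        _ = H * ((r + 1 : ℕ) : ℝ) ^ (k - 2) := by rw [e]; ring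
        _ ≤ H * (2 * ((1 - k) * ((r + 1 : ℕ) : ℝ) ^ (k - 2))) := by
            gcongr; nlinarith
        _ ≤ _ := by rw [mul_comm 2 (H : ℝ), mul_assoc]; gcongr
    refine (Finset.sum_le_sum t2).trans ?_
    rw [← Finset.mul_sum]
    have e : ∑ r ∈ Finset.Ico H n, ((r : ℝ) ^ (k - 1) - ((r + 1 : ℕ) : ℝ) ^ (k - 1))
        = (H : ℝ) ^ (k - 1) - (n : ℝ) ^ (k - 1) := by
      have := Finset.sum_Ico_sub (fun r : ℕ => (r : ℝ) ^ (k - 1)) h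
      rw [← neg_sub ((n : ℝ) ^ (k - 1)), ← this, ← Finset.sum_neg_distrib]
      exact Finset.sum_congr rfl fun r _ => by ring
    rw [e, mul_assoc]
    have h1 : (H : ℝ) * (H : ℝ) ^ (k - 1) = (H : ℝ) ^ k := by
      rw [Real.rpow_sub_one hH0.ne']; field_simp
    have h2 : (0 : ℝ) ≤ H * (n : ℝ) ^ (k - 1) := by positivity
    rw [mul_sub, h1]
    linarith

theorem abs_sum_saw_le_rpow {k U : ℝ} (hk0 : 0 < k) (hk1 : k ≤ 1 / 2) (hU0 : 0 ≤ U) (A : Finset ℕ)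
    (y : ℕ → ℝ) {H : ℕ} (hH : 1 ≤ H)
    (hU : ∀ h : ℕ, 1 ≤ h → ‖∑ n ∈ A, ee (h * y n)‖ ≤ U * (h : ℝ) ^ k) :
    |∑ n ∈ A, saw (y n)| ≤ A.card / H + (1 / k + 2) * (U * (H : ℝ) ^ k) := by
  set g : ℕ → ℝ := fun r => min (1 / ((r + 1 : ℕ) : ℝ)) (H / ((r + 1 : ℕ) : ℝ) ^ 2)
      * ((r + 1 : ℕ) : ℝ) ^ k with hg
  have hg0 : ∀ r, 0 ≤ g r := fun r => by positivity
  have hs := summable_of_sum_range_le hg0 (sum_range_min_mul_rpow_le hk0 hk1 hH)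
  have ht := Real.tsum_le_of_sum_range_le hg0 (sum_range_min_mul_rpow_le hk0 hk1 hH)
  have h := abs_sum_saw_le A y (H := H) (by exact_mod_cast hH) (hs.hasSum.mul_left U) fun r => by
    calc _ ≤ min (1 / ((r + 1 : ℕ) : ℝ)) (H / ((r + 1 : ℕ) : ℝ) ^ 2)
          * (U * ((r + 1 : ℕ) : ℝ) ^ k) := by
          gcongr; exact hU (r + 1) (by omega)
      _ = _ := by simp only [hg]; ring
  refine h.trans (add_le_add_right ?_ _)
  calc U * ∑' r, g r ≤ U * ((1 / k + 2) * (H : ℝ) ^ k) := by gcongr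
    _ = _ := by ring

/-- The cutoff `H₀ = J / T` equates the bias `J / H` with the exponential sum bound `(X/J²)^k J^l
H^k`; the common value is `T`. Frequency `h` has the phase of amplitude `h X ≥ J²`, so the block
bound is available for all of them. -/
theorem RecipSumBound.abs_sum_saw_block_le {k l C : ℝ} (h : RecipSumBound k l C) (hC : 0 < C)
    (hk0 : 0 < k) (hk1 : k ≤ 1 / 2) {J : ℕ} (hJ : 1 ≤ J) {X α β : ℝ} (hα0 : 0 ≤ α) (hα1 : α ≤ 1)
    (hX : (J : ℝ) ^ 2 ≤ X) :
    |∑ n ∈ Finset.Ioc (J / 2) J, saw (X / (n + α) + β)|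
      ≤ (1 + 2 * (1 / k + 2) * C) * ((J : ℝ) ^ ((l - k) / (1 + k)) * X ^ (k / (1 + k))) := by
  have hJ0 : (0 : ℝ) < J := by exact_mod_cast hJ
  have hX0 : 0 < X := lt_of_lt_of_le (by positivity) hX
  have hk2 : 0 < 1 + k := by linarith
  set T := (J : ℝ) ^ ((l - k) / (1 + k)) * X ^ (k / (1 + k)) with hT
  have hT0 : 0 < T := by positivity
  set H₀ := J / T with hH₀
  have hH₀0 : 0 < H₀ := by positivity
  have hTH : (J : ℝ) / H₀ = T := by rw [hH₀]; field_simp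
  have hTpow : T ^ (1 + k) = (J : ℝ) ^ (l - k) * X ^ k := by
    rw [hT, Real.mul_rpow (by positivity) (by positivity), ← Real.rpow_mul hJ0.le,
      ← Real.rpow_mul hX0.le, div_mul_cancel₀ _ hk2.ne', div_mul_cancel₀ _ hk2.ne']
  have hU : (X / (J : ℝ) ^ 2) ^ k * (J : ℝ) ^ l * H₀ ^ k = T := by
    rw [hH₀, Real.div_rpow hX0.le (by positivity), Real.div_rpow hJ0.le hT0.le,
      ← Real.rpow_natCast (J : ℝ) 2, ← Real.rpow_mul hJ0.le]
    have e1 : X ^ k * ((J : ℝ) ^ l * (J : ℝ) ^ k) = T ^ (1 + k) * (J : ℝ) ^ (((2 : ℕ) : ℝ) * k) := by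
      rw [hTpow, ← Real.rpow_add hJ0, mul_right_comm, ← Real.rpow_add hJ0, mul_comm]
      congr 2; push_cast; ring
    rw [Real.rpow_add hT0, Real.rpow_one] at e1
    field_simp
    field_simp at e1
    linarith
  have hcard : ((Finset.Ioc (J / 2) J).card : ℝ) ≤ J := by
    rw [Nat.card_Ioc]; exact_mod_cast Nat.sub_le _ _
  have hc : 0 ≤ 2 * (1 / k + 2) * C * T := by positivity
  -- If `H₀ ≤ 1`, then `J ≤ T` and the trivial bound suffices.
  rcases le_or_gt H₀ 1 with h1 | h1
  · have hJT : (J : ℝ) ≤ T := by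
      rw [← hTH, le_div_iff₀ hH₀0]; nlinarith
    have : |∑ n ∈ Finset.Ioc (J / 2) J, saw (X / (n + α) + β)| ≤ J := by
      refine (Finset.abs_sum_le_sum_abs _ _).trans ?_
      refine (Finset.sum_le_card_nsmul _ _ 1 fun n _ => (abs_saw_le _).trans (by norm_num)).trans ?_
      rw [nsmul_eq_mul, mul_one]; exact hcard
    linarith
  · set H := ⌈H₀⌉₊ with hH
    have hH1 : 1 ≤ H := Nat.one_le_ceil_iff.2 hH₀0
    have hHle : H₀ ≤ H := Nat.le_ceil _
    have hH2 : (H : ℝ) ≤ 2 * H₀ := by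
      have := (Nat.ceil_lt_add_one hH₀0.le).le
      linarith
    set U := C * ((X / (J : ℝ) ^ 2) ^ k * (J : ℝ) ^ l) with hUdef
    have hmain := abs_sum_saw_le_rpow hk0 hk1 (U := U) (by positivity) (Finset.Ioc (J / 2) J)
      (fun n => X / (n + α) + β) hH1 fun r hr => by
        have hr0 : (1 : ℝ) ≤ r := by exact_mod_cast hr
        have e : ∑ n ∈ Finset.Ioc (J / 2) J, ee (r * (X / (n + α) + β))
            = ee (r * β) * ∑ n ∈ Finset.Ioc (J / 2) J, ee (r * X / (n + α)) := by
          rw [Finset.mul_sum]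
          refine Finset.sum_congr rfl fun n _ => ?_
          rw [← ee_add]; congr 1; ring
        rw [e, norm_mul, norm_ee, one_mul]
        refine (h J α (r * X) hJ hα0 hα1 (by nlinarith)).trans (le_of_eq ?_)
        rw [hUdef, mul_div_assoc, Real.mul_rpow (by positivity) (by positivity)]
        ring
    refine hmain.trans ?_
    have i1 : ((Finset.Ioc (J / 2) J).card : ℝ) / H ≤ T := by
      rw [← hTH]; gcongr
    have i2 : U * (H : ℝ) ^ k ≤ 2 * C * T := by
      have h2k : (2 : ℝ) ^ k ≤ 2 := by
        calc (2 : ℝ) ^ k ≤ 2 ^ (1 : ℝ) :=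
              Real.rpow_le_rpow_of_exponent_le (by norm_num) (by linarith)
          _ = 2 := Real.rpow_one 2
      calc U * (H : ℝ) ^ k ≤ U * (2 * H₀) ^ k := by gcongr
        _ = 2 ^ k * C * ((X / (J : ℝ) ^ 2) ^ k * (J : ℝ) ^ l * H₀ ^ k) := by
            rw [Real.mul_rpow (by norm_num) hH₀0.le, hUdef]; ring
        _ = 2 ^ k * C * T := by rw [hU]
        _ ≤ 2 * C * T := by gcongr
    have i3 : (1 / k + 2) * (U * (H : ℝ) ^ k) ≤ (1 / k + 2) * (2 * C * T) := by gcongr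
    linarith

theorem RecipSumBound.abs_sum_saw_dyadic_le {k l C : ℝ} (h : RecipSumBound k l C) (hC : 0 < C)
    (hk0 : 0 < k) (hk1 : k ≤ 1 / 2) (hkl : k < l) :
    ∃ D : ℝ, 0 < D ∧ ∀ (X α β : ℝ), 0 ≤ α → α ≤ 1 → ∀ J : ℕ, (J : ℝ) ^ 2 ≤ X →
      |∑ n ∈ Finset.Ioc 0 J, saw (X / (n + α) + β)|
        ≤ D * ((J : ℝ) ^ ((l - k) / (1 + k)) * X ^ (k / (1 + k))) := by
  set γ := (l - k) / (1 + k) with hγ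
  have hγ0 : 0 < γ := div_pos (by linarith) (by linarith)
  set B := 1 + 2 * (1 / k + 2) * C with hB
  have hB0 : 0 < B := by positivity
  set q := (1 / 2 : ℝ) ^ γ with hq
  have hq1 : q < 1 := Real.rpow_lt_one (by norm_num) (by norm_num) hγ0
  have hq0 : 0 < 1 - q := by linarith
  -- Halving `J` gains the factor `q = 2^(-γ) < 1`, since `k < l`. The constant is the sum of the
  -- geometric series, so `q D + B = D`.
  refine ⟨B / (1 - q), by positivity, fun X α β hα0 hα1 J => ?_⟩
  induction J using Nat.strong_induction_on with
  | _ J ih =>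
    intro hX
    have hX0 : 0 ≤ X := le_trans (by positivity) hX
    rcases Nat.eq_zero_or_pos J with rfl | hJ
    · simp only [Finset.Ioc_self, Finset.sum_empty, abs_zero]
      positivity
    have hlt : J / 2 < J := by omega
    have hhalf : ((J / 2 : ℕ) : ℝ) ≤ 1 / 2 * J := by
      have : 2 * (J / 2) ≤ J := by omega
      have h2 : (2 : ℝ) * ((J / 2 : ℕ) : ℝ) ≤ J := by exact_mod_cast this
      linarith
    have h1 := ih (J / 2) hlt (le_trans (by gcongr) hX)
    have h2 := h.abs_sum_saw_block_le hC hk0 hk1 hJ (β := β) hα0 hα1 hX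
    have hsplit : ∑ n ∈ Finset.Ioc 0 J, saw (X / (n + α) + β)
        = ∑ n ∈ Finset.Ioc 0 (J / 2), saw (X / (n + α) + β)
          + ∑ n ∈ Finset.Ioc (J / 2) J, saw (X / (n + α) + β) :=
      (Finset.sum_Ioc_consecutive _ (Nat.zero_le _) hlt.le).symm
    rw [hsplit]
    refine (abs_add_le _ _).trans ((add_le_add h1 h2).trans ?_)
    have h3 : ((J / 2 : ℕ) : ℝ) ^ γ ≤ q * (J : ℝ) ^ γ := by
      rw [hq, ← Real.mul_rpow (by norm_num) (by positivity)]
      gcongr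
    have h4 : B / (1 - q) * (((J / 2 : ℕ) : ℝ) ^ γ * X ^ (k / (1 + k)))
        ≤ B / (1 - q) * (q * (J : ℝ) ^ γ * X ^ (k / (1 + k))) := by gcongr
    refine (add_le_add_left h4 _).trans (le_of_eq ?_)
    rw [← hB, ← hγ]
    clear_value B γ
    field_simp
    ring

theorem RecipSumBound.exists_abs_sum_saw_le {k l C : ℝ} (h : RecipSumBound k l C) (hC : 0 < C)
    (hk0 : 0 < k) (hk1 : k ≤ 1 / 2) (hkl : k < l) :
    ∃ D : ℝ, 0 < D ∧ ∀ (X α β : ℝ), 0 ≤ α → α ≤ 1 → ∀ J : ℕ, (J : ℝ) ^ 2 ≤ X →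
      |∑ n ∈ Finset.Ioc 0 J, saw (X / (n + α) + β)| ≤ D * X ^ ((k + l) / (2 * k + 2)) := by
  obtain ⟨D, hD, hb⟩ := h.abs_sum_saw_dyadic_le hC hk0 hk1 hkl
  refine ⟨D, hD, fun X α β hα0 hα1 J hX => ?_⟩
  rcases Nat.eq_zero_or_pos J with rfl | hJ
  · simp only [Finset.Ioc_self, Finset.sum_empty, abs_zero]
    have : 0 ≤ X := le_trans (by positivity) hX
    positivity
  have hJ0 : (0 : ℝ) < J := by exact_mod_cast hJ
  have hX0 : 0 < X := lt_of_lt_of_le (by positivity) hX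
  refine (hb X α β hα0 hα1 J hX).trans ?_
  have h1 : (J : ℝ) ≤ X ^ (1 / 2 : ℝ) := by
    rw [← Real.sqrt_eq_rpow]; exact Real.le_sqrt_of_sq_le hX
  have h2 : (J : ℝ) ^ ((l - k) / (1 + k)) ≤ (X ^ (1 / 2 : ℝ)) ^ ((l - k) / (1 + k)) :=
    Real.rpow_le_rpow hJ0.le h1 (div_nonneg (by linarith) (by linarith))
  -- With `J ≤ √X` the exponents add up: `(l - k) / (2 (1 + k)) + k / (1 + k)`.
  have e : X ^ ((k + l) / (2 * k + 2))
      = (X ^ (1 / 2 : ℝ)) ^ ((l - k) / (1 + k)) * X ^ (k / (1 + k)) := by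
    rw [← Real.rpow_mul hX0.le, ← Real.rpow_add hX0]
    congr 1
    have : 1 + k ≠ 0 := by linarith
    have : 2 * k + 2 ≠ 0 := by linarith
    field_simp
    ring
  rw [e]
  gcongr

/-! ### Counting the `m` for which `d` divides `[x/m]` -/

/-- The number of integers `1 ≤ m ≤ x` such that `d` divides `[x / m]`. -/
noncomputable def divCount (x : ℝ) (d : ℕ) : ℕ :=
  ((Finset.Ioc 0 ⌊x⌋₊).filter fun m : ℕ => d ∣ ⌊x / m⌋₊).card

theorem saw_eq (t : ℝ) : saw t = t - ⌊t⌋ - 1 / 2 := by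
  rw [saw, Int.fract]

theorem natFloor_eq_sub_saw {t : ℝ} (ht : 0 ≤ t) : (⌊t⌋₊ : ℝ) = t - saw t - 1 / 2 := by
  rw [saw_eq, natCast_floor_eq_intCast_floor ht]
  ring

/-- The indicator is `⌊t/d⌋ - ⌊(t - 1)/d⌋`, as one sees from the remainder of `⌊t⌋` modulo `d`; each
floor is then written with `saw`. -/
theorem indicator_dvd_floor_eq {t : ℝ} (ht : 0 ≤ t) {d : ℕ} (hd : 1 ≤ d) :
    (if d ∣ ⌊t⌋₊ then (1 : ℝ) else 0) = 1 / d - saw (t / d) + saw (t / d - 1 / d) := by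
  have hd0 : (0 : ℝ) < d := by exact_mod_cast hd
  have h1 := Nat.floor_le ht
  have h2 := Nat.lt_floor_add_one t
  set q := ⌊t⌋₊ with hq
  have hqr := Nat.div_add_mod q d
  have hr := Nat.mod_lt q hd
  simp only [Nat.dvd_iff_mod_eq_zero]
  set a := q / d with ha
  set r := q % d with hr'
  have hqR : (q : ℝ) = d * a + r := by exact_mod_cast hqr.symm
  have hrR : (r : ℝ) + 1 ≤ d := by exact_mod_cast hr
  have hr0 : (0 : ℝ) ≤ r := Nat.cast_nonneg r
  have f1 : ⌊t / d⌋ = (a : ℤ) := by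
    rw [Int.floor_eq_iff, le_div_iff₀ hd0, div_lt_iff₀ hd0]
    push_cast
    constructor <;> nlinarith
  rw [saw_eq, saw_eq, f1, ← sub_div]
  split_ifs with h
  · have f2 : ⌊(t - 1) / d⌋ = (a : ℤ) - 1 := by
      rw [h, Nat.cast_zero] at hqR
      rw [Int.floor_eq_iff, le_div_iff₀ hd0, div_lt_iff₀ hd0]
      have : (1 : ℝ) ≤ d := by exact_mod_cast hd
      push_cast
      constructor <;> nlinarith
    rw [f2]; push_cast; ring
  · have f2 : ⌊(t - 1) / d⌋ = (a : ℤ) := by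
      have h3 : (1 : ℝ) ≤ r := by exact_mod_cast Nat.one_le_iff_ne_zero.2 h
      rw [Int.floor_eq_iff, le_div_iff₀ hd0, div_lt_iff₀ hd0]
      push_cast
      constructor <;> nlinarith
    rw [f2]; push_cast; ring

/-- Sort the `m` by `j = [x/m] / d`. The condition `[x/m] = dj` means `x / (dj + 1) < m ≤ x / (dj)`,
and `M = [x / (d (J + 1))]` is the cut at which `j ≤ J` holds for all remaining `m`. -/
theorem card_large_eq_sum {x : ℝ} (hx : 0 < x) {d M J : ℕ} (hd : 1 ≤ d)
    (hM1 : (M : ℝ) ≤ x / d / (J + 1)) (hM2 : x / d / (J + 1) < M + 1) :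
    ((Finset.Ioc M ⌊x⌋₊).filter fun m : ℕ => d ∣ ⌊x / m⌋₊).card
      = ∑ j ∈ Finset.Ioc 0 J, (⌊x / (d * j)⌋₊ - ⌊x / (d * j + 1)⌋₊) := by
  have hd0 : (1 : ℝ) ≤ d := by exact_mod_cast hd
  have hmaps : ∀ m ∈ (Finset.Ioc M ⌊x⌋₊).filter fun m : ℕ => d ∣ ⌊x / m⌋₊,
      ⌊x / m⌋₊ / d ∈ Finset.Ioc 0 J := by
    intro m hm
    rw [Finset.mem_filter, Finset.mem_Ioc, Nat.le_floor_iff hx.le] at hm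
    obtain ⟨⟨hm1, hm2⟩, q, hq⟩ := hm
    have hm0 : (0 : ℝ) < m := by exact_mod_cast (by omega : 0 < m)
    rw [hq, Nat.mul_div_cancel_left _ hd, Finset.mem_Ioc]
    constructor
    · rcases Nat.eq_zero_or_pos q with rfl | h
      · rw [mul_zero, Nat.floor_eq_zero, div_lt_one hm0] at hq
        linarith
      · exact h
    · have h1 := Nat.floor_le (show 0 ≤ x / m by positivity)
      rw [hq, le_div_iff₀ hm0] at h1
      push_cast at h1
      rw [div_div, div_lt_iff₀ (by positivity)] at hM2
      have h2 : (M : ℝ) + 1 ≤ m := by exact_mod_cast hm1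
      have h3 : (d : ℝ) * q * m < m * (d * (J + 1)) :=
        lt_of_le_of_lt h1 (lt_of_lt_of_le hM2 (by gcongr))
      have h4 : (q : ℝ) < J + 1 := by
        by_contra! h5
        have : (m : ℝ) * (d * (J + 1)) ≤ m * (d * q) := by gcongr
        linarith
      exact Nat.lt_succ_iff.1 (by exact_mod_cast h4)
  rw [Finset.card_eq_sum_card_fiberwise hmaps]
  refine Finset.sum_congr rfl fun j hj => ?_
  obtain ⟨hj1, hj2⟩ := Finset.mem_Ioc.1 hj
  have hj0 : (1 : ℝ) ≤ j := by exact_mod_cast hj1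
  have hjJ : (j : ℝ) ≤ J := by exact_mod_cast hj2
  have hdj : (1 : ℝ) ≤ d * j := by nlinarith
  rw [← Nat.card_Ioc]
  congr 1
  ext m
  rw [Finset.mem_filter, Finset.mem_filter, Finset.mem_Ioc, Finset.mem_Ioc,
    Nat.le_floor_iff hx.le, Nat.le_floor_iff (by positivity), Nat.floor_lt (by positivity)]
  constructor
  · rintro ⟨⟨⟨hm1, hm2⟩, q, hq⟩, hmj⟩
    have hm0 : (0 : ℝ) < m := by exact_mod_cast (by omega : 0 < m)
    rw [hq, Nat.mul_div_cancel_left _ hd] at hmj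
    subst hmj
    rw [Nat.floor_eq_iff (by positivity), le_div_iff₀ hm0, div_lt_iff₀ hm0] at hq
    obtain ⟨h1, h2⟩ := hq
    push_cast at h1 h2
    rw [div_lt_iff₀ (by positivity), le_div_iff₀ (by positivity)]
    constructor <;> linarith
  · rintro ⟨h1, h2⟩
    have hm0 : (0 : ℝ) < m := lt_of_le_of_lt (by positivity) h1
    rw [div_lt_iff₀ (by positivity)] at h1
    rw [le_div_iff₀ (by positivity)] at h2
    have hq : ⌊x / m⌋₊ = d * j := by
      rw [Nat.floor_eq_iff (by positivity), le_div_iff₀ hm0, div_lt_iff₀ hm0]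
      push_cast
      constructor <;> linarith
    refine ⟨⟨⟨?_, ?_⟩, hq ▸ dvd_mul_right d j⟩, by rw [hq, Nat.mul_div_cancel_left _ hd]⟩
    · rw [div_div, le_div_iff₀ (by positivity)] at hM1
      have h3 : (M : ℝ) < m := by
        by_contra! h4
        have h5 : (m : ℝ) * (d * (J + 1)) ≤ M * (d * (J + 1)) := by gcongr
        have h6 : (d : ℝ) * j + 1 ≤ d * (J + 1) := by nlinarith
        have h7 : (m : ℝ) * (d * j + 1) ≤ m * (d * (J + 1)) := by gcongr
        linarith
      exact_mod_cast h3
    · nlinarith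

theorem sum_Ioc_telescope {F : ℕ → ℝ} {a b : ℕ} (h : a ≤ b) :
    ∑ j ∈ Finset.Ioc a b, (F j - F (j + 1)) = F (a + 1) - F (b + 1) := by
  induction b, h using Nat.le_induction with
  | base => simp
  | succ n hn ih => rw [Finset.sum_Ioc_succ_top (by omega), ih]; ring

/-- The tail of the main term, compared with the number of small `m`. -/
theorem abs_main_sub_le {X δ : ℝ} (hδ0 : 0 ≤ δ) (hδ1 : δ ≤ 1) {J K M : ℕ} (hJ1 : 1 ≤ J)
    (hJX : (J : ℝ) ^ 2 ≤ X) (hXJ : X ≤ ((J : ℝ) + 1) ^ 2) (hJK : J ≤ K) (hK : X ≤ K + 1)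
    (hM1 : (M : ℝ) ≤ X / (J + 1)) (hM2 : X / (J + 1) < M + 1) :
    |M * δ - ∑ j ∈ Finset.Ioc J K, (X / j - X / (j + δ))| ≤ 3 := by
  have hJ0 : (1 : ℝ) ≤ J := by exact_mod_cast hJ1
  have hX : 0 < X := lt_of_lt_of_le (by positivity) hJX
  set S := ∑ j ∈ Finset.Ioc J K, 1 / ((j : ℝ) * (j + δ)) with hS
  have e : ∑ j ∈ Finset.Ioc J K, (X / j - X / (j + δ)) = δ * (X * S) := by
    rw [hS, Finset.mul_sum, Finset.mul_sum]
    refine Finset.sum_congr rfl fun j hj => ?_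
    have : (0 : ℝ) < j := by
      have := (Finset.mem_Ioc.1 hj).1
      exact_mod_cast (by omega : 0 < j)
    field_simp
    ring
  have hup : S ≤ 1 / J := by
    have h1 := sum_Ioc_inv_sq_le_sub (α := ℝ) (by omega : J ≠ 0) hJK
    have h2 : S ≤ ∑ j ∈ Finset.Ioc J K, ((j : ℝ) ^ 2)⁻¹ := by
      refine Finset.sum_le_sum fun j hj => ?_
      have : (0 : ℝ) < j := by
        have := (Finset.mem_Ioc.1 hj).1
        exact_mod_cast (by omega : 0 < j)
      rw [← one_div]
      refine one_div_le_one_div_of_le (by positivity) ?_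
      nlinarith
    have h3 : (0 : ℝ) ≤ (K : ℝ)⁻¹ := by positivity
    rw [one_div]; linarith
  -- As `0 ≤ δ ≤ 1`, the sum `S` lies between `∑ 1 / (j (j + 1))` and `∑ 1 / j²`, so `X S` and `M`
  -- are both `X / J + O(1)`.
  have hlo : 1 / ((J : ℝ) + 1) - 1 / ((K : ℝ) + 1) ≤ S := by
    have h1 := sum_Ioc_telescope (F := fun j => 1 / (j : ℝ)) hJK
    push_cast at h1
    rw [← h1]
    refine Finset.sum_le_sum fun j hj => ?_
    have : (0 : ℝ) < j := by
      have := (Finset.mem_Ioc.1 hj).1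
      exact_mod_cast (by omega : 0 < j)
    rw [show 1 / (j : ℝ) - 1 / (j + 1) = 1 / (j * (j + 1)) by field_simp; ring]
    refine one_div_le_one_div_of_le (by positivity) ?_
    nlinarith
  have h1 : X * S ≤ X / J := by
    calc X * S ≤ X * (1 / J) := by gcongr
      _ = X / J := by ring
  have h2 : X / (J + 1) - 1 ≤ X * S := by
    have h3 : X / (K + 1) ≤ 1 := by rw [div_le_one (by positivity)]; exact hK
    have h4 := mul_le_mul_of_nonneg_left hlo hX.le
    have h5 : X * (1 / ((J : ℝ) + 1) - 1 / ((K : ℝ) + 1)) = X / (J + 1) - X / (K + 1) := by ring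
    linarith
  have h3 : X / J - X / (J + 1) ≤ 2 := by
    rw [div_sub_div _ _ (by positivity) (by positivity), div_le_iff₀ (by positivity)]
    nlinarith
  have h4 : |M - X * S| ≤ 3 := by
    rw [abs_le]; constructor <;> linarith
  rw [e, mul_comm (M : ℝ), ← mul_sub, abs_mul, abs_of_nonneg hδ0]
  nlinarith [abs_nonneg (M - X * S)]

/-- With `J = [√X]`, both `M` and `J` are at most `√X`, so `hψ` applies to all four sawtooth sums:
shifts `β = 0, -δ` over `m ≤ M` and `α = 0, δ` over `j ≤ J`. The smooth parts differ by at most 3,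
giving the constant `4D + 3`. -/
theorem abs_divCount_sub_le {D θ : ℝ} (hθ : 0 ≤ θ)
    (hψ : ∀ (X α β : ℝ), 0 ≤ α → α ≤ 1 → ∀ J : ℕ, (J : ℝ) ^ 2 ≤ X →
      |∑ n ∈ Finset.Ioc 0 J, saw (X / (n + α) + β)| ≤ D * X ^ θ)
    {x : ℝ} {d : ℕ} (hd : 1 ≤ d) (hdx : (d : ℝ) ≤ x) :
    |(divCount x d : ℝ)
        - x * ∑ j ∈ Finset.Ioc 0 ⌊x / d⌋₊, 1 / (((d * j : ℕ) : ℝ) * ((d * j : ℕ) + 1))|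
      ≤ (4 * D + 3) * (x / d) ^ θ := by
  have hd0 : (1 : ℝ) ≤ d := by exact_mod_cast hd
  have hx0 : 0 < x := by linarith
  set X := x / d with hX
  have hX1 : 1 ≤ X := by rw [hX, le_div_iff₀ (by positivity)]; linarith
  have hX0 : 0 < X := by linarith
  set δ : ℝ := 1 / d with hδ
  have hδ0 : 0 ≤ δ := by positivity
  have hδ1 : δ ≤ 1 := by rw [hδ, div_le_one (by positivity)]; exact hd0
  set J := ⌊√X⌋₊ with hJ
  set M := ⌊X / (J + 1)⌋₊ with hM
  set K := ⌊X⌋₊ with hK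
  have hJle : (J : ℝ) ≤ √X := Nat.floor_le (Real.sqrt_nonneg _)
  have hJlt : √X < J + 1 := Nat.lt_floor_add_one _
  have hsq : √X ^ 2 = X := Real.sq_sqrt hX0.le
  have hJ1 : 1 ≤ J := Nat.le_floor (by rw [Nat.cast_one, Real.one_le_sqrt]; exact hX1)
  have hJX : (J : ℝ) ^ 2 ≤ X := by rw [← hsq]; gcongr
  have hXJ : X ≤ ((J : ℝ) + 1) ^ 2 := by rw [← hsq]; gcongr
  have hM1 : (M : ℝ) ≤ X / (J + 1) := Nat.floor_le (by positivity)
  have hM2 : X / (J + 1) < M + 1 := Nat.lt_floor_add_one _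
  have hMX : (M : ℝ) ^ 2 ≤ X := by
    have : (M : ℝ) ≤ √X := by
      refine hM1.trans ?_
      rw [div_le_iff₀ (by positivity)]
      nlinarith [Real.sqrt_nonneg X]
    rw [← hsq]; gcongr
  have hJK : J ≤ K := Nat.floor_le_floor (by nlinarith [Real.one_le_sqrt.2 hX1])
  have hK2 : X ≤ K + 1 := (Nat.lt_floor_add_one _).le
  have hMx : M ≤ ⌊x⌋₊ := by
    refine Nat.floor_le_floor ?_
    rw [hX, div_div]
    exact div_le_self hx0.le (by nlinarith)
  have hsplit : (divCount x d : ℝ)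
      = ∑ m ∈ Finset.Ioc 0 M, (δ - saw (X / m) + saw (X / m - δ))
        + ∑ j ∈ Finset.Ioc 0 J, (X / j - X / (j + δ) - saw (X / j) + saw (X / (j + δ))) := by
    have h1 : divCount x d = ((Finset.Ioc 0 M).filter fun m : ℕ => d ∣ ⌊x / m⌋₊).card
        + ((Finset.Ioc M ⌊x⌋₊).filter fun m : ℕ => d ∣ ⌊x / m⌋₊).card := by
      rw [divCount, Finset.card_filter, Finset.card_filter, Finset.card_filter,
        Finset.sum_Ioc_consecutive _ (Nat.zero_le _) hMx]
    rw [h1, card_large_eq_sum hx0 hd hM1 hM2, Nat.cast_add]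
    congr 1
    · rw [Finset.card_filter, Nat.cast_sum]
      refine Finset.sum_congr rfl fun m _ => ?_
      have := indicator_dvd_floor_eq (t := x / m) (by positivity) hd
      rw [div_right_comm] at this
      rw [← this]
      push_cast
      rfl
    · rw [Nat.cast_sum]
      refine Finset.sum_congr rfl fun j hj => ?_
      have hj0 : (0 : ℝ) < j := by exact_mod_cast (Finset.mem_Ioc.1 hj).1
      have e1 : x / (d * j) = X / j := by rw [hX]; field_simp
      have e2 : x / (d * j + 1) = X / (j + δ) := by rw [hX, hδ]; field_simp
      rw [e1, e2, Nat.cast_sub, natFloor_eq_sub_saw (by positivity),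
        natFloor_eq_sub_saw (by positivity)]
      · ring
      · refine Nat.floor_le_floor ?_
        gcongr
        linarith
  have hmain : x * ∑ j ∈ Finset.Ioc 0 K, 1 / (((d * j : ℕ) : ℝ) * ((d * j : ℕ) + 1))
      = ∑ j ∈ Finset.Ioc 0 J, (X / j - X / (j + δ))
        + ∑ j ∈ Finset.Ioc J K, (X / j - X / (j + δ)) := by
    rw [Finset.sum_Ioc_consecutive _ (Nat.zero_le _) hJK, Finset.mul_sum]
    refine Finset.sum_congr rfl fun j hj => ?_
    have hj0 : (0 : ℝ) < j := by exact_mod_cast (Finset.mem_Ioc.1 hj).1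
    rw [hX, hδ]
    push_cast
    field_simp
    ring
  have p1 := hψ X 0 0 le_rfl zero_le_one M hMX
  have p2 := hψ X 0 (-δ) le_rfl zero_le_one M hMX
  have p3 := hψ X 0 0 le_rfl zero_le_one J hJX
  have p4 := hψ X δ 0 hδ0 hδ1 J hJX
  simp only [add_zero, ← sub_eq_add_neg] at p1 p2 p3 p4
  have hb := abs_main_sub_le hδ0 hδ1 hJ1 hJX hXJ hJK hK2 hM1 hM2
  rw [hsplit, hmain]
  simp only [Finset.sum_add_distrib, Finset.sum_sub_distrib, Finset.sum_const, Nat.card_Ioc,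
    nsmul_eq_mul, Nat.sub_zero] at hb ⊢
  have hpow : 1 ≤ X ^ θ := Real.one_le_rpow hX1 hθ
  rw [abs_le] at *
  constructor <;> linarith [p1.1, p1.2, p2.1, p2.2, p3.1, p3.2, p4.1, p4.2, hb.1, hb.2]

/-! ### Möbius inversion and the singular series -/

theorem ite_coprime_eq_sum_moebius {a b D : ℕ} (ha : 1 ≤ a) (haD : a ≤ D) :
    (if Nat.Coprime a b then (1 : ℝ) else 0)
      = ∑ d ∈ Finset.Ioc 0 D, (ArithmeticFunction.moebius d : ℝ)
          * ((if d ∣ a then 1 else 0) * (if d ∣ b then 1 else 0)) := by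
  have hg : Nat.gcd a b ≠ 0 := Nat.gcd_ne_zero_left (by omega)
  have h1 : ∑ d ∈ (Nat.gcd a b).divisors, ArithmeticFunction.moebius d
      = if Nat.gcd a b = 1 then 1 else 0 := by
    rw [← ArithmeticFunction.coe_zeta_mul_apply, ArithmeticFunction.coe_zeta_mul_moebius,
      ArithmeticFunction.one_apply]
  have h2 : (Nat.gcd a b).divisors = (Finset.Ioc 0 D).filter fun d => d ∣ a ∧ d ∣ b := by
    ext d
    rw [Nat.mem_divisors, Finset.mem_filter, Finset.mem_Ioc, Nat.dvd_gcd_iff]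
    constructor
    · rintro ⟨h, -⟩
      exact ⟨⟨Nat.pos_of_dvd_of_pos h.1 ha, (Nat.le_of_dvd ha h.1).trans haD⟩, h⟩
    · rintro ⟨-, h⟩
      exact ⟨h, hg⟩
  rw [h2, Finset.sum_filter] at h1
  have h3 : ((if Nat.gcd a b = 1 then 1 else 0 : ℤ) : ℝ) = if Nat.Coprime a b then 1 else 0 := by
    simp only [Nat.coprime_iff_gcd_eq_one]; push_cast; rfl
  rw [← h3, ← h1]
  push_cast
  refine Finset.sum_congr rfl fun d _ => ?_
  by_cases h : d ∣ a <;> by_cases h' : d ∣ b <;> simp [h, h']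

/-- Product weights let the double sum factor into a square for each `d`. Applied with `q m = [x/m]`
and unit weights to the count, and with `q = id` and `recipWeight` to the series. -/
theorem sum_coprime_eq_sum_moebius {ι : Type*} (I : Finset ι) (q : ι → ℕ) (w : ι → ℝ) {D : ℕ}
    (hq : ∀ i ∈ I, 1 ≤ q i ∧ q i ≤ D) :
    ∑ p ∈ I ×ˢ I, (if Nat.Coprime (q p.1) (q p.2) then (1 : ℝ) else 0) * (w p.1 * w p.2)
      = ∑ d ∈ Finset.Ioc 0 D, (ArithmeticFunction.moebius d : ℝ)
          * (∑ i ∈ I, if d ∣ q i then w i else 0) ^ 2 := by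
  have h1 : ∀ p ∈ I ×ˢ I,
      (if Nat.Coprime (q p.1) (q p.2) then (1 : ℝ) else 0) * (w p.1 * w p.2)
        = ∑ d ∈ Finset.Ioc 0 D, (ArithmeticFunction.moebius d : ℝ)
          * ((if d ∣ q p.1 then w p.1 else 0) * (if d ∣ q p.2 then w p.2 else 0)) := by
    intro p hp
    have := hq p.1 (Finset.mem_product.1 hp).1
    rw [ite_coprime_eq_sum_moebius this.1 this.2, Finset.sum_mul]
    refine Finset.sum_congr rfl fun d _ => ?_
    split_ifs <;> ring
  rw [Finset.sum_congr rfl h1, Finset.sum_comm]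
  refine Finset.sum_congr rfl fun d _ => ?_
  rw [← Finset.mul_sum, sq, Finset.sum_mul_sum, Finset.sum_product]

/-- The weight `1 / (j (j + 1))`, zero at `j = 0`. -/
noncomputable def recipWeight (j : ℕ) : ℝ := 1 / ((j : ℝ) * (j + 1))

theorem recipWeight_nonneg (j : ℕ) : 0 ≤ recipWeight j := by unfold recipWeight; positivity

theorem sum_range_recipWeight (n : ℕ) :
    ∑ j ∈ Finset.range (n + 1), recipWeight j = 1 - 1 / ((n : ℝ) + 1) := by
  induction n with
  | zero => simp [recipWeight]
  | succ n ih =>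
    rw [Finset.sum_range_succ, ih, recipWeight]
    push_cast
    field_simp
    ring

theorem hasSum_recipWeight : HasSum recipWeight 1 := by
  rw [hasSum_iff_tendsto_nat_of_nonneg recipWeight_nonneg, ← Filter.tendsto_add_atTop_iff_nat 1]
  simp only [sum_range_recipWeight]
  simpa using (tendsto_one_div_add_atTop_nhds_zero_nat (𝕜 := ℝ)).const_sub 1

theorem primitiveTerm_eq (p : ℕ × ℕ) :
    primitiveTerm p = (if Nat.Coprime p.1 p.2 then (1 : ℝ) else 0)
      * (recipWeight p.1 * recipWeight p.2) := by
  obtain ⟨a, b⟩ := p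
  rw [primitiveTerm]
  rcases Nat.eq_zero_or_pos a with rfl | ha
  -- Pairs with a zero entry may be coprime, but `recipWeight 0 = 0` by the convention for division
  -- by zero.
  · simp [recipWeight]
  rcases Nat.eq_zero_or_pos b with rfl | hb
  · simp [recipWeight]
  by_cases h : Nat.Coprime a b
  · rw [if_pos ⟨ha, hb, h⟩, if_pos h, recipWeight, recipWeight]
    field_simp
  · rw [if_neg (fun h' => h h'.2.2), if_neg h, zero_mul]

theorem primitiveTerm_nonneg (p : ℕ × ℕ) : 0 ≤ primitiveTerm p := by
  rw [primitiveTerm_eq]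
  have := recipWeight_nonneg p.1
  have := recipWeight_nonneg p.2
  positivity

theorem primitiveTerm_le (p : ℕ × ℕ) : primitiveTerm p ≤ recipWeight p.1 * recipWeight p.2 := by
  rw [primitiveTerm_eq]
  have := mul_nonneg (recipWeight_nonneg p.1) (recipWeight_nonneg p.2)
  split_ifs <;> simp [this]

theorem hasSum_recipWeight_mul :
    HasSum (fun p : ℕ × ℕ => recipWeight p.1 * recipWeight p.2) 1 := by
  have h := hasSum_recipWeight.mul hasSum_recipWeight
    (hasSum_recipWeight.summable.mul_of_nonneg hasSum_recipWeight.summable recipWeight_nonneg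
      recipWeight_nonneg)
  rwa [mul_one] at h

theorem summable_primitiveTerm : Summable primitiveTerm :=
  Summable.of_nonneg_of_le primitiveTerm_nonneg primitiveTerm_le hasSum_recipWeight_mul.summable

theorem sum_primitiveTerm_le (s : Finset (ℕ × ℕ)) : ∑ p ∈ s, primitiveTerm p ≤ primitiveConst :=
  summable_primitiveTerm.sum_le_tsum s fun p _ => primitiveTerm_nonneg p

/-- The tail is dominated by that of the full product series, whose total is 1 and whose sum over
the box is `(1 - 1 / (D + 1))²`. -/
theorem primitiveConst_sub_le (D : ℕ) :
    primitiveConst - ∑ p ∈ Finset.range (D + 1) ×ˢ Finset.range (D + 1), primitiveTerm p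
      ≤ 2 / ((D : ℝ) + 1) := by
  have h := (hasSum_recipWeight_mul.summable.sub summable_primitiveTerm).sum_le_tsum
    (Finset.range (D + 1) ×ˢ Finset.range (D + 1)) fun p _ => sub_nonneg.2 (primitiveTerm_le p)
  rw [hasSum_recipWeight_mul.summable.tsum_sub summable_primitiveTerm,
    hasSum_recipWeight_mul.tsum_eq, Finset.sum_sub_distrib,
    Finset.sum_product (f := fun p : ℕ × ℕ => recipWeight p.1 * recipWeight p.2),
    ← Finset.sum_mul_sum, sum_range_recipWeight] at h
  rw [primitiveConst]
  have h2 : (1 - 1 / ((D : ℝ) + 1)) * (1 - 1 / ((D : ℝ) + 1))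
      = 1 - 2 / ((D : ℝ) + 1) + (1 / ((D : ℝ) + 1)) ^ 2 := by ring
  have h3 : 0 ≤ (1 / ((D : ℝ) + 1)) ^ 2 := by positivity
  linarith

theorem sum_ite_dvd_recipWeight {d : ℕ} (hd : 1 ≤ d) (D : ℕ) :
    ∑ j ∈ Finset.Ioc 0 D, (if d ∣ j then recipWeight j else 0)
      = ∑ j ∈ Finset.Ioc 0 (D / d), recipWeight (d * j) := by
  rw [← Finset.sum_filter]
  symm
  refine Finset.sum_bij (fun j _ => d * j) (fun j hj => ?_) (fun a _ b _ h => ?_) (fun j hj => ?_)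
    fun _ _ => rfl
  · rw [Finset.mem_Ioc, Nat.le_div_iff_mul_le hd] at hj
    rw [Finset.mem_filter, Finset.mem_Ioc]
    exact ⟨⟨Nat.mul_pos hd hj.1, by rw [mul_comm]; exact hj.2⟩, dvd_mul_right _ _⟩
  · exact Nat.eq_of_mul_eq_mul_left hd h
  · rw [Finset.mem_filter, Finset.mem_Ioc] at hj
    obtain ⟨⟨h1, h2⟩, a, rfl⟩ := hj
    refine ⟨a, ?_, rfl⟩
    rw [Finset.mem_Ioc, Nat.le_div_iff_mul_le hd]
    exact ⟨Nat.pos_of_mul_pos_left h1, by rw [mul_comm]; exact h2⟩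

theorem sum_inv_sq_le_two (n : ℕ) : ∑ j ∈ Finset.Ioc 0 n, ((j : ℝ) ^ 2)⁻¹ ≤ 2 := by
  have h := sum_Ioo_inv_sq_le (α := ℝ) 0 (n + 1)
  have e : Finset.Ioo 0 (n + 1) = Finset.Ioc 0 n := by
    ext j; rw [Finset.mem_Ioo, Finset.mem_Ioc, Nat.lt_succ_iff]
  rw [e] at h
  simpa using h

theorem sum_recipWeight_mul_le {d : ℕ} (hd : 1 ≤ d) (n : ℕ) :
    ∑ j ∈ Finset.Ioc 0 n, recipWeight (d * j) ≤ 2 / (d : ℝ) ^ 2 := by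
  have hd0 : (0 : ℝ) < d := by exact_mod_cast hd
  have h : ∀ j ∈ Finset.Ioc 0 n, recipWeight (d * j) ≤ 1 / (d : ℝ) ^ 2 * ((j : ℝ) ^ 2)⁻¹ := by
    intro j hj
    have hj0 : (0 : ℝ) < j := by exact_mod_cast (Finset.mem_Ioc.1 hj).1
    rw [recipWeight, ← one_div, one_div_mul_one_div]
    push_cast
    refine one_div_le_one_div_of_le (by positivity) ?_
    have : 0 < (d : ℝ) * j := by positivity
    nlinarith
  refine (Finset.sum_le_sum h).trans ?_
  rw [← Finset.mul_sum]
  calc 1 / (d : ℝ) ^ 2 * ∑ j ∈ Finset.Ioc 0 n, ((j : ℝ) ^ 2)⁻¹ ≤ 1 / (d : ℝ) ^ 2 * 2 := by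
        gcongr; exact sum_inv_sq_le_two n
    _ = _ := by ring

/-! ### The asymptotic formula from a bound for sawtooth sums -/

theorem primitivePairCount_eq {x : ℝ} (hx : 0 < x) :
    (primitivePairCount x : ℝ) = ∑ d ∈ Finset.Ioc 0 ⌊x⌋₊, (ArithmeticFunction.moebius d : ℝ)
      * (divCount x d : ℝ) ^ 2 := by
  have h := sum_coprime_eq_sum_moebius (Finset.Ioc 0 ⌊x⌋₊) (fun m : ℕ => ⌊x / m⌋₊)
    (fun _ => 1) (D := ⌊x⌋₊) fun m hm => by
      rw [Finset.mem_Ioc, Nat.le_floor_iff hx.le] at hm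
      have hm0 : (1 : ℝ) ≤ m := by exact_mod_cast hm.1
      refine ⟨?_, Nat.floor_le_floor (div_le_self hx.le hm0)⟩
      rw [Nat.one_le_floor_iff, le_div_iff₀ (by linarith)]
      linarith
  have e : Finset.Icc 1 ⌊x⌋₊ = Finset.Ioc 0 ⌊x⌋₊ := rfl
  rw [primitivePairCount, e, Finset.card_filter]
  push_cast
  simp only [mul_one] at h
  rw [h]
  refine Finset.sum_congr rfl fun d _ => ?_
  rw [divCount, Finset.card_filter]
  push_cast
  rfl

theorem sum_primitiveTerm_eq (D : ℕ) :
    ∑ p ∈ Finset.range (D + 1) ×ˢ Finset.range (D + 1), primitiveTerm p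
      = ∑ d ∈ Finset.Ioc 0 D, (ArithmeticFunction.moebius d : ℝ)
        * (∑ j ∈ Finset.Ioc 0 (D / d), recipWeight (d * j)) ^ 2 := by
  have h := sum_coprime_eq_sum_moebius (Finset.Ioc 0 D) id recipWeight (D := D) fun m hm =>
    Finset.mem_Ioc.1 hm
  have hsub : Finset.Ioc 0 D ⊆ Finset.range (D + 1) := fun j hj => by
    rw [Finset.mem_range, Nat.lt_succ_iff]; exact (Finset.mem_Ioc.1 hj).2
  have h2 : ∑ p ∈ Finset.range (D + 1) ×ˢ Finset.range (D + 1), primitiveTerm p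
      = ∑ p ∈ Finset.Ioc 0 D ×ˢ Finset.Ioc 0 D, primitiveTerm p := by
    symm
    refine Finset.sum_subset (Finset.product_subset_product hsub hsub) fun p hp hp' => ?_
    rw [primitiveTerm, if_neg]
    rintro ⟨h1, h2, -⟩
    rw [Finset.mem_product, Finset.mem_range, Finset.mem_range] at hp
    refine hp' (Finset.mem_product.2 ⟨Finset.mem_Ioc.2 ⟨h1, ?_⟩, Finset.mem_Ioc.2 ⟨h2, ?_⟩⟩)
    · omega
    · omega
  rw [h2, Finset.sum_congr rfl fun p _ => primitiveTerm_eq p]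
  refine h.trans (Finset.sum_congr rfl fun d hd => ?_)
  rw [← sum_ite_dvd_recipWeight (Finset.mem_Ioc.1 hd).1]
  rfl

/-- Both sides are Möbius sums of squares once the series is truncated at `[x]`, which costs `O(x)`.
The factorisation `S² - (xG)² = (S - xG)((S - xG) + 2xG)` together with `G ≪ d⁻²` leaves errors
`(x/d)^(2θ)` and `x (x/d)^θ d⁻²`. -/
theorem abs_primitivePairCount_sub_le {D θ : ℝ} (hD : 0 < D) (hθ0 : 0 ≤ θ) (hθ1 : θ ≤ 1 / 2)
    (hψ : ∀ (X α β : ℝ), 0 ≤ α → α ≤ 1 → ∀ J : ℕ, (J : ℝ) ^ 2 ≤ X →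
      |∑ n ∈ Finset.Ioc 0 J, saw (X / (n + α) + β)| ≤ D * X ^ θ)
    {x : ℝ} (hx : 1 ≤ x) :
    |(primitivePairCount x : ℝ) - primitiveConst * x ^ 2|
      ≤ (2 * (4 * D + 3) ^ 2 + 8 * (4 * D + 3) + 2) * x ^ (1 + θ) := by
  have hx0 : 0 < x := by linarith
  set C := 4 * D + 3 with hC
  have hC0 : 0 < C := by rw [hC]; positivity
  set N := ⌊x⌋₊ with hN
  have hNx : (N : ℝ) ≤ x := Nat.floor_le hx0.le
  have hxN : x < N + 1 := Nat.lt_floor_add_one _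
  set P := ∑ p ∈ Finset.range (N + 1) ×ˢ Finset.range (N + 1), primitiveTerm p with hP
  set G : ℕ → ℝ := fun d => ∑ j ∈ Finset.Ioc 0 (N / d), recipWeight (d * j) with hG
  have hxθ : 1 ≤ x ^ θ := Real.one_le_rpow hx hθ0
  have hx1θ : x ^ (1 + θ) = x * x ^ θ := by rw [Real.rpow_add hx0, Real.rpow_one]
  have htail : |P * x ^ 2 - primitiveConst * x ^ 2| ≤ 2 * x ^ (1 + θ) := by
    have h1 := sum_primitiveTerm_le (Finset.range (N + 1) ×ˢ Finset.range (N + 1))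
    have h2 := primitiveConst_sub_le N
    rw [← hP] at h1 h2
    rw [← sub_mul, abs_mul, abs_of_nonneg (by positivity : 0 ≤ x ^ 2), abs_sub_comm,
      abs_of_nonneg (by linarith)]
    calc (primitiveConst - P) * x ^ 2 ≤ 2 / ((N : ℝ) + 1) * x ^ 2 := by gcongr
      _ ≤ 2 / x * x ^ 2 := by gcongr
      _ = 2 * (x * 1) := by field_simp
      _ ≤ 2 * x ^ (1 + θ) := by rw [hx1θ]; gcongr
  have hdiff : (primitivePairCount x : ℝ) - P * x ^ 2
      = ∑ d ∈ Finset.Ioc 0 N, (ArithmeticFunction.moebius d : ℝ)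
        * ((divCount x d : ℝ) ^ 2 - (x * G d) ^ 2) := by
    rw [primitivePairCount_eq hx0, hP, sum_primitiveTerm_eq, Finset.sum_mul,
      ← Finset.sum_sub_distrib]
    exact Finset.sum_congr rfl fun d _ => by rw [hG]; ring
  have hterm : ∀ d ∈ Finset.Ioc 0 N, |(ArithmeticFunction.moebius d : ℝ)
        * ((divCount x d : ℝ) ^ 2 - (x * G d) ^ 2)|
      ≤ C ^ 2 * x ^ θ * x ^ (1 / 2 : ℝ) * (d : ℝ) ^ (-(1 / 2) : ℝ)
        + 4 * C * x ^ (1 + θ) * ((d : ℝ) ^ 2)⁻¹ := by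
    intro d hd
    obtain ⟨hd1, hdN⟩ := Finset.mem_Ioc.1 hd
    have hd0 : (1 : ℝ) ≤ d := by exact_mod_cast hd1
    have hdx : (d : ℝ) ≤ x := le_trans (by exact_mod_cast hdN) hNx
    have hX1 : 1 ≤ x / d := by rw [le_div_iff₀ (by positivity)]; linarith
    have hE := abs_divCount_sub_le hθ0 hψ hd1 hdx
    have hfl : ⌊x / d⌋₊ = N / d := Nat.floor_div_natCast x d
    rw [hfl] at hE
    change |(divCount x d : ℝ) - x * G d| ≤ C * (x / d) ^ θ at hE
    have hG0 : 0 ≤ G d := Finset.sum_nonneg fun j _ => recipWeight_nonneg _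
    have hG2 : G d ≤ 2 / (d : ℝ) ^ 2 := sum_recipWeight_mul_le hd1 _
    have hmu : |(ArithmeticFunction.moebius d : ℝ)| ≤ 1 := by
      exact_mod_cast ArithmeticFunction.abs_moebius_le_one (n := d)
    set S : ℝ := (divCount x d : ℝ)
    have hpow0 : 0 ≤ (x / d) ^ θ := by positivity
    have e1 : S ^ 2 - (x * G d) ^ 2 = (S - x * G d) * ((S - x * G d) + 2 * (x * G d)) := by ring
    have hmono : (x / d) ^ θ ≤ x ^ θ := by
      gcongr; exact div_le_self hx0.le hd0
    -- Only one of the two factors `(x/d)^θ` is enlarged to exponent `1/2`. Then `∑ d^(-1/2) ≪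
    -- x^(1/2)` yields `x^(1 + θ)` uniformly in `θ ≤ 1/2`, without a logarithm.
    have hhalf : (x / d) ^ θ ≤ x ^ (1 / 2 : ℝ) * (d : ℝ) ^ (-(1 / 2) : ℝ) := by
      refine (Real.rpow_le_rpow_of_exponent_le hX1 hθ1).trans (le_of_eq ?_)
      rw [Real.div_rpow hx0.le (by positivity), Real.rpow_neg (by positivity), div_eq_mul_inv]
    have i1 : (x / d) ^ θ * (x / d) ^ θ
        ≤ x ^ θ * (x ^ (1 / 2 : ℝ) * (d : ℝ) ^ (-(1 / 2) : ℝ)) := by gcongr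
    have i2 : (x / d) ^ θ * (x * G d) ≤ x ^ θ * (x * (2 / (d : ℝ) ^ 2)) := by gcongr
    calc _ ≤ 1 * |S ^ 2 - (x * G d) ^ 2| := by
          rw [abs_mul]; gcongr
      _ = |S - x * G d| * |(S - x * G d) + 2 * (x * G d)| := by rw [one_mul, e1, abs_mul]
      _ ≤ C * (x / d) ^ θ * (C * (x / d) ^ θ + 2 * (x * G d)) := by
          gcongr
          refine (abs_add_le _ _).trans (add_le_add hE (le_of_eq ?_))
          exact abs_of_nonneg (by positivity)
      _ = C ^ 2 * ((x / d) ^ θ * (x / d) ^ θ) + 2 * C * ((x / d) ^ θ * (x * G d)) := by ring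
      _ ≤ C ^ 2 * (x ^ θ * (x ^ (1 / 2 : ℝ) * (d : ℝ) ^ (-(1 / 2) : ℝ)))
          + 2 * C * (x ^ θ * (x * (2 / (d : ℝ) ^ 2))) := by gcongr
      _ = _ := by rw [hx1θ]; ring
  have hhalfsum : ∑ d ∈ Finset.Ioc 0 N, (d : ℝ) ^ (-(1 / 2) : ℝ) ≤ 2 * x ^ (1 / 2 : ℝ) := by
    have e : Finset.Ioc 0 N = Finset.Ico 1 (N + 1) := rfl
    rw [e]
    refine (sum_Ico_rpow_neg_half_le N).trans ?_
    gcongr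
  have hsum : |(primitivePairCount x : ℝ) - P * x ^ 2|
      ≤ (2 * C ^ 2 + 8 * C) * x ^ (1 + θ) := by
    rw [hdiff]
    refine (Finset.abs_sum_le_sum_abs _ _).trans ((Finset.sum_le_sum hterm).trans ?_)
    rw [Finset.sum_add_distrib, ← Finset.mul_sum, ← Finset.mul_sum]
    have e2 : x ^ (1 / 2 : ℝ) * x ^ (1 / 2 : ℝ) = x := by
      rw [← Real.rpow_add hx0]; norm_num
    calc _ ≤ C ^ 2 * x ^ θ * x ^ (1 / 2 : ℝ) * (2 * x ^ (1 / 2 : ℝ))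
          + 4 * C * x ^ (1 + θ) * 2 := by
          gcongr
          exact sum_inv_sq_le_two N
      _ = C ^ 2 * x ^ θ * 2 * (x ^ (1 / 2 : ℝ) * x ^ (1 / 2 : ℝ)) + 4 * C * x ^ (1 + θ) * 2 := by
          ring
      _ = _ := by rw [e2, hx1θ]; ring
  have := abs_sub_le (primitivePairCount x : ℝ) (P * x ^ 2) (primitiveConst * x ^ 2)
  linarith

/-! ### From exponent pairs to reciprocal phases -/

theorem iteratedDeriv_neg_mul_inv_add (Y α : ℝ) (p : ℕ) (x : ℝ) :
    iteratedDeriv p (fun u : ℝ => -Y * (u + α)⁻¹) x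
      = -Y * ((-1) ^ p * p.factorial * ((x + α) ^ (p + 1))⁻¹) := by
  rw [iteratedDeriv_const_mul_field, iteratedDeriv_eq_iterate]
  have h := congrFun (iter_deriv_inv_linear (𝕜 := ℝ) p 1 α) x
  simp only [one_mul, one_pow, mul_one] at h
  rw [h, show (-1 - p : ℤ) = -((p + 1 : ℕ) : ℤ) by push_cast; ring, zpow_neg, zpow_natCast]

theorem modelPhase_two (Y : ℝ) : modelPhase Y 2 = fun u : ℝ => -Y * (u + 0)⁻¹ := by
  funext u
  rw [modelPhase, if_neg (by norm_num), show (1 - 2 : ℝ) = -1 by norm_num, Real.rpow_neg_one,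
    add_zero]
  ring

/-- The shift multiplies the `p`-th derivative of the model `-Y / u` by `(x / (x + α))^(p + 1)`.
Bernoulli's inequality puts this within `(p + 1) α / (x + α)` of 1, hence within `ε` once `N ≥ (P +
1) / ε`. -/
theorem isAdmissiblePhase_neg_div_add {N Y α ε : ℝ} {P : ℕ} (hN : 0 < N) (hα : 0 ≤ α)
    (hα1 : α ≤ 1) (hε : (P + 1 : ℝ) ≤ ε * N) :
    IsAdmissiblePhase N P Y 2 ε N (2 * N) (fun u => -Y * (u + α)⁻¹) where
  lt := by linarith
  subset := le_rfl
  contDiffOn := by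
    refine contDiffOn_const.mul (ContDiffOn.inv (contDiffOn_id.add contDiffOn_const) ?_)
    intro u hu
    have := hu.1
    exact (show 0 < u + α by linarith).ne'
  deriv_close := by
    intro p hp1 hpP x hx
    have hx0 : 0 < x := lt_of_lt_of_le hN hx.1
    have hxα : 0 < x + α := by linarith
    have hcd : ContDiffAt ℝ p (fun u : ℝ => -Y * (u + α)⁻¹) x :=
      contDiffAt_const.mul (ContDiffAt.inv (contDiffAt_id.add contDiffAt_const) hxα.ne')
    rw [iteratedDerivWithin_eq_iteratedDeriv (uniqueDiffOn_Icc (by linarith)) hcd hx,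
      modelPhase_two, iteratedDeriv_neg_mul_inv_add, iteratedDeriv_neg_mul_inv_add, add_zero]
    set A := -Y * ((-1) ^ p * p.factorial * (x ^ (p + 1))⁻¹) with hA
    have e : -Y * ((-1) ^ p * p.factorial * ((x + α) ^ (p + 1))⁻¹)
        = A * (1 + -(α / (x + α))) ^ (p + 1) := by
      rw [show 1 + -(α / (x + α)) = x / (x + α) by field_simp; ring, div_pow, hA]
      field_simp
    have hb0 : 0 ≤ 1 + -(α / (x + α)) := by
      rw [show 1 + -(α / (x + α)) = x / (x + α) by field_simp; ring]; positivity
    have hα2 : 0 ≤ α / (x + α) := by positivity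
    have h1 : (1 + -(α / (x + α))) ^ (p + 1) ≤ 1 := pow_le_one₀ hb0 (by linarith)
    have h2 := one_add_mul_le_pow (a := -(α / (x + α))) (by linarith) (p + 1)
    have h3 : ((p + 1 : ℕ) : ℝ) * (α / (x + α)) ≤ ε := by
      have hpP' : ((p + 1 : ℕ) : ℝ) ≤ P + 1 := by exact_mod_cast Nat.add_le_add_right hpP 1
      have hε0 : 0 ≤ ε := by
        by_contra! h
        have : ε * N < 0 := mul_neg_of_neg_of_pos h hN
        have : (0 : ℝ) ≤ P := Nat.cast_nonneg P
        linarith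
      rw [← mul_div_assoc, div_le_iff₀ hxα]
      calc ((p + 1 : ℕ) : ℝ) * α ≤ (P + 1) * 1 := by gcongr
        _ ≤ ε * N := by linarith
        _ ≤ ε * (x + α) := by gcongr; linarith [hx.1]
    rw [e, ← mul_sub_one, abs_mul, mul_comm]
    refine mul_le_mul_of_nonneg_right ?_ (abs_nonneg _)
    rw [abs_sub_comm, abs_of_nonneg (by linarith)]
    linarith

/-- The definition is used with `s = 2` and `N = J / 2`, where `L = 4Y / J² ≥ 4`, so that the term
`1 / L` is harmless. Blocks too short for the shifted phase to be admissible have bounded length and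
are estimated trivially. -/
theorem IsExponentPair.exists_recipSumBound {k l : ℝ} (h : IsExponentPair k l) :
    ∃ C : ℝ, 0 < C ∧ RecipSumBound k l C := by
  obtain ⟨hk0, hk1, hl0, -, h⟩ := h
  obtain ⟨P, -, ε, hε, C, hC, hb⟩ := h 2 two_pos
  refine ⟨5 * C + 2 * (P + 1) / ε, by positivity, fun J α Y hJ hα0 hα1 hY => ?_⟩
  have hJ1 : (1 : ℝ) ≤ J := by exact_mod_cast hJ
  have hJ0 : (0 : ℝ) < J := by linarith
  have hY0 : 0 < Y := lt_of_lt_of_le (by positivity) hY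
  set T := (Y / (J : ℝ) ^ 2) ^ k * (J : ℝ) ^ l with hT
  have hL1 : 1 ≤ Y / (J : ℝ) ^ 2 := by rw [le_div_iff₀ (by positivity)]; linarith
  have hT1 : 1 ≤ T := one_le_mul_of_one_le_of_one_le (Real.one_le_rpow hL1 hk0)
    (Real.one_le_rpow hJ1 (by linarith))
  rcases le_or_gt (P + 1 : ℝ) (ε * (J / 2)) with hlarge | hsmall
  · have hs := hb (J / 2) Y (by positivity) hY0 _ _ _
      (isAdmissiblePhase_neg_div_add (Y := Y) (by positivity) hα0 hα1 hlarge)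
    have f1 : ⌊(J : ℝ) / 2⌋₊ = J / 2 := by
      have := Nat.floor_div_natCast (J : ℝ) 2
      rw [Nat.floor_natCast] at this
      exact_mod_cast this
    have f2 : ⌊2 * ((J : ℝ) / 2)⌋₊ = J := by
      rw [mul_div_cancel₀ _ (two_ne_zero), Nat.floor_natCast]
    rw [f1, f2] at hs
    have e : ∑ n ∈ Finset.Ioc (J / 2) J,
        Complex.exp (2 * Real.pi * Complex.I * ((-Y * ((n : ℝ) + α)⁻¹ : ℝ) : ℂ))
        = ∑ n ∈ Finset.Ioc (J / 2) J, ee (-(Y / (n + α))) := by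
      refine Finset.sum_congr rfl fun n _ => ?_
      rw [ee]; congr 3; ring
    rw [e, norm_sum_ee_neg] at hs
    have eL : Y * ((J : ℝ) / 2) ^ (-2 : ℝ) = 4 * (Y / (J : ℝ) ^ 2) := by
      rw [Real.rpow_neg (by positivity), Real.rpow_two]; field_simp; norm_num
    rw [eL] at hs
    refine hs.trans ?_
    have i1 : (4 * (Y / (J : ℝ) ^ 2)) ^ k * ((J : ℝ) / 2) ^ l ≤ 4 * T := by
      have h4 : (4 : ℝ) ^ k ≤ 4 := by
        calc (4 : ℝ) ^ k ≤ 4 ^ (1 : ℝ) :=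
              Real.rpow_le_rpow_of_exponent_le (by norm_num) (by linarith)
          _ = 4 := Real.rpow_one 4
      rw [Real.mul_rpow (by norm_num) (by positivity), hT, ← mul_assoc]
      gcongr
      linarith
    have i2 : (4 * (Y / (J : ℝ) ^ 2))⁻¹ ≤ T := by
      refine le_trans ?_ hT1
      exact inv_le_one_of_one_le₀ (by linarith)
    have i3 : C * ((4 * (Y / (J : ℝ) ^ 2)) ^ k * ((J : ℝ) / 2) ^ l
        + (4 * (Y / (J : ℝ) ^ 2))⁻¹) ≤ C * (4 * T + T) := by gcongr
    have i4 : 0 ≤ 2 * (P + 1) / ε * T := by positivity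
    linarith
  · refine (norm_sum_ee_le_card _ _).trans ?_
    have h1 : ((Finset.Ioc (J / 2) J).card : ℝ) ≤ J := by
      rw [Nat.card_Ioc]; exact_mod_cast Nat.sub_le _ _
    have h2 : (J : ℝ) ≤ 2 * (P + 1) / ε := by
      rw [le_div_iff₀ hε]; linarith
    have h3 : 2 * (P + 1) / ε ≤ 2 * (P + 1) / ε * T := le_mul_of_one_le_right (by positivity) hT1
    have h4 : 0 ≤ 5 * C * T := by positivity
    linarith

/-- A phase with integer values shows that the first exponent cannot vanish unless the second
is at least `1`. -/
theorem RecipSumBound.one_le_of_zero {l C : ℝ} (h : RecipSumBound 0 l C) : 1 ≤ l := by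
  by_contra! hl
  have key : ∀ J : ℕ, 1 ≤ J → (J : ℝ) ^ (1 - l) ≤ 2 * C := by
    intro J hJ
    have hJ0 : (0 : ℝ) < J := by exact_mod_cast hJ
    have hf : (1 : ℝ) ≤ J.factorial := by exact_mod_cast Nat.one_le_iff_ne_zero.2 J.factorial_ne_zero
    -- Since `J!` is divisible by each `n ≤ J`, all terms of this sum equal 1; with `k = 0` the
    -- bound ignores how large the amplitude is.
    have hb := h J 0 (J ^ 2 * J.factorial) hJ le_rfl zero_le_one
      (le_mul_of_one_le_right (by positivity) hf)
    have e : ∑ n ∈ Finset.Ioc (J / 2) J, ee ((J : ℝ) ^ 2 * J.factorial / (n + 0))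
        = ((J - J / 2 : ℕ) : ℂ) := by
      have h1 : ∀ n ∈ Finset.Ioc (J / 2) J, ee ((J : ℝ) ^ 2 * J.factorial / (n + 0)) = 1 := by
        intro n hn
        obtain ⟨hn1, hn2⟩ := Finset.mem_Ioc.1 hn
        have hn0 : 0 < n := by omega
        obtain ⟨c, hc⟩ := Nat.dvd_factorial hn0 hn2
        have : (J : ℝ) ^ 2 * J.factorial / (n + 0) = ((J ^ 2 * c : ℕ) : ℝ) := by
          have : (n : ℝ) ≠ 0 := by exact_mod_cast hn0.ne'
          rw [hc]; push_cast; field_simp; ring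
        rw [this, ee_nat]
      rw [Finset.sum_congr rfl h1]
      simp
    rw [e, Complex.norm_natCast, Real.rpow_zero, one_mul] at hb
    have h2 : (J : ℝ) ≤ 2 * ((J - J / 2 : ℕ) : ℝ) := by
      have : J ≤ 2 * (J - J / 2) := by omega
      exact_mod_cast this
    rw [Real.rpow_sub hJ0, Real.rpow_one, div_le_iff₀ (by positivity)]
    linarith
  have ht : Filter.Tendsto (fun J : ℕ => (J : ℝ) ^ (1 - l)) Filter.atTop Filter.atTop :=
    (tendsto_rpow_atTop (by linarith)).comp tendsto_natCast_atTop_atTop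
  obtain ⟨J, hJ1, hJ⟩ := ((Filter.eventually_ge_atTop 1).and
    (ht.eventually_gt_atTop (2 * C))).exists
  exact absurd (key J hJ1) (not_le.2 hJ)

/-! ### Conclusion -/

/-- For `θ < 1/3` one has `k + 3l < 2`. Together with `l ≥ 1/2` this gives `k < l`, and it excludes
`k = 0`, which would require `l ≥ 1`. For `θ ≥ 1/3` the pair `(2/7, 4/7)`, whose own exponent is
`1/3`, does at least as well; this includes the degenerate cases `k = 0` and `k = l = 1/2`. -/
theorem IsExponentPair.exists_abs_sum_saw_le {k l : ℝ} (h : IsExponentPair k l) :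
    ∃ D : ℝ, 0 < D ∧ ∀ (X α β : ℝ), 0 ≤ α → α ≤ 1 → ∀ J : ℕ, (J : ℝ) ^ 2 ≤ X →
      |∑ n ∈ Finset.Ioc 0 J, saw (X / (n + α) + β)| ≤ D * X ^ ((k + l) / (2 * k + 2)) := by
  obtain ⟨hk0, hk1, hl0, hl1, -⟩ := id h
  have hden : 0 < 2 * k + 2 := by linarith
  rcases lt_or_ge ((k + l) / (2 * k + 2)) (1 / 3) with hθ | hθ
  · obtain ⟨C, hC, hb⟩ := h.exists_recipSumBound
    rw [div_lt_iff₀ hden] at hθ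
    have hk : 0 < k := by
      rcases hk0.eq_or_lt with rfl | hk
      · have := hb.one_le_of_zero
        linarith
      · exact hk
    exact hb.exists_abs_sum_saw_le hC hk hk1 (by linarith)
  · obtain ⟨C, hC, hb⟩ := exists_recipSumBound_two_sevenths
    obtain ⟨D, hD, hs⟩ := hb.exists_abs_sum_saw_le hC (by norm_num) (by norm_num) (by norm_num)
    refine ⟨D, hD, fun X α β hα0 hα1 J hX => ?_⟩
    rcases Nat.eq_zero_or_pos J with rfl | hJ
    · have : 0 ≤ X := le_trans (by positivity) hX
      simp only [Finset.Ioc_self, Finset.sum_empty, abs_zero]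
      positivity
    · have hJ0 : (1 : ℝ) ≤ J := by exact_mod_cast hJ
      have hX1 : 1 ≤ X := le_trans (one_le_pow₀ hJ0) hX
      refine (hs X α β hα0 hα1 J hX).trans ?_
      refine mul_le_mul_of_nonneg_left (Real.rpow_le_rpow_of_exponent_le hX1 ?_) hD.le
      exact le_trans (by norm_num) hθ

theorem theorem1p3 (k l : ℝ) (hkl : IsExponentPair k l) :
    Summable primitiveTerm ∧
      ∃ C : ℝ, 0 < C ∧ ∀ x : ℝ, 2 ≤ x →
        |(primitivePairCount x : ℝ) - primitiveConst * x ^ 2|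
          ≤ C * x ^ (1 + (k + l) / (2 * k + 2)) := by
  obtain ⟨hk0, hk1, hl0, hl1, -⟩ := id hkl
  obtain ⟨D, hD, hψ⟩ := hkl.exists_abs_sum_saw_le
  have hden : 0 < 2 * k + 2 := by linarith
  refine ⟨summable_primitiveTerm, _, ?_, fun x hx => abs_primitivePairCount_sub_le hD
    (div_nonneg (by linarith) hden.le) ?_ hψ (by linarith)⟩
  · positivity
  -- The condition `θ ≤ 1/2` amounts to `l ≤ 1`.
  · rw [div_le_iff₀ hden]
    linarith
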